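/- **Conventions.** Let $A=C^\infty(\mathbb R^d)$. Let $T=T_{poly}(\mathbb R^d)$ be the graded Lie algebra of polyvector fields ($k$-vector fields in degree $k-1$) with zero differential and the Schouten–Nijenhuis bracket, and let $D=D_{poly}(\mathbb R^d)$ be the DGLA of polydifferential operators ($m$-ary operators in degree $m-1$) with the Gerstenhaber bracket and the differential $[\mu,\cdot]$, where $\mu$ is the multiplication of $A$. Both are viewed as $L_\infty$-algebras, with $Q_1=d$ and $Q_2(x,y)=(-1)^{|x|}[x,y]$ on the shifts $T[1]$, $D[1]$ ($|x|$ the shifted degree). A pre-$L_\infty$-morphism $f:T\to D$ is a sequence of graded symmetric multilinear maps $f_n:T[1]^n\to D[1]$ ($n\ge1$) of degree $0$, i.e. the Taylor coefficients of a morphism of the cofree graded cocommutative coalgebras; $[Q,f]=Q\circ f-f\circ Q$ has the Taylor coefficients $$[Q,f]_n(\gamma)=Q_1f_n(\gamma)+\tfrac12\sum_{I\sqcup J=[n],\ I,J\ne\emptyset}\pm Q_2(f_I(\gamma_I),f_J(\gamma_J))-\sum_{i<j}\pm f_{n-1}(Q_2(\gamma_i,\gamma_j),\dots)$$ with Koszul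 signs, and $f$ is an $L_\infty$-morphism iff $[Q,f]=0$. An (admissible) graph of type $(n,m)$ has internal vertices $1,\dots,n$, boundary vertices $1,\dots,m$ (in this order), and edges that start at internal vertices, without multiple edges and without edges from a vertex to itself; it has degree $l$ if it has $2n+m-2+l$ edges. An orientation is an ordering of the edges, up to even permutations. Let $g$ be the real vector space spanned by oriented graphs, modulo the relations that reversing the orientation changes the sign and that relabelling the internal vertices changes nothing, and let $H=T(g)$ be its tensor algebra. For a graph $\Gamma$ let $$d^{int}\Gamma=\sum_{e}\pm\,\Gamma/e,\qquad \Delta_b\Gamma=\sum_{\gamma}\pm\,\Gamma/\gamma\otimes\gamma .$$ The first sum is over the edges $e$ joining two internal vertices. The second sum is over the full subgraphs $\gamma$ on a set of $n'$ internal vertices and $m'$ consecutive boundary vertices ($m'\ge0$), where $2n'+m'\ge2$, $n'+m'<n+m$ and no edge leads from $\gamma$ to a vertex outside $\gamma$; in $\Gamma/\gamma$ the subgraph is collapsed to a boundary vertex (for $m'=0$: to a new boundary vertex, inserted at any of the $m+1$ places). Quotients that are not admissible are $0$. The signs are those of reordering the edges, for $\Delta_b$ times the sign of the Gerstenhaber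 composition. Let $W:H\to\mathbb R$ be a character (algebra homomorphism) of degree $0$ (it vanishes on graphs of nonzero degree), normalized to be $1$ on the graph of type $(0,2)$ without edges, and put $$(\delta W)(\Gamma)=W(d^{int}\Gamma)+W(\Delta_b\Gamma).$$ For a graph $\Gamma$ of type $(n,m)$ let $U_\Gamma:T^n\to \mathrm{Hom}(A^{\otimes m},A)$ be Kontsevich's state sum $$U_\Gamma(\gamma_1,\dots,\gamma_n)(f_1,\dots,f_m)=\pm\sum_{I:E_\Gamma\to\{1,\dots,d\}}\ \prod_{v\ \mathrm{internal}}\Big(\prod_{e\in In(v)}\partial_{I(e)}\Big)\Big\langle\gamma_v,\bigotimes_{e\in Out(v)}dx^{I(e)}\Big\rangle\ \prod_{w\ \mathrm{boundary}}\Big(\prod_{e\in In(w)}\partial_{I(e)}\Big)f_w ,$$ with the sign of sorting the edges by their starting points. Let $f^{(d)}=W\cdot U$, i.e. $f^{(d)}_n=\sum_m\sum_\Gamma W(\Gamma)U_\Gamma$ over the graphs of type $(n,m)$ and degree $0$; similarly $(\delta W)\cdot U$ has the components $\sum_m\sum_\Gamma(\delta W)(\Gamma)U_\Gamma$ over the graphs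 of type $(n,m)$ and degree $-1$. (Vertices are labelled in these sums; each graph is taken with one ordering of its edges.) **Theorem.** For every $d$, $f^{(d)}=W\cdot U:T_{poly}(\mathbb R^d)\to D_{poly}(\mathbb R^d)$ is a pre-$L_\infty$-morphism, and (i) $[Q,f^{(d)}]=(\delta W)\cdot U$ for every $d$; (ii) $f^{(d)}$ is an $L_\infty$-morphism for all $d$ if and only if $W$ is a cocycle, i.e. $\delta W=0$ on all graphs. More precisely, if $f^{(d)}$ is an $L_\infty$-morphism for one $d$, then $\delta W$ vanishes on all graphs with at most $d$ edges. -/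

import Mathlib

open scoped ContDiff

namespace Feynman

/-! ### Smooth functions on `ℝ^d` -/

/-- The algebra `A = C^∞(ℝ^d)`. -/
def smoothAlg (d : ℕ) : Subalgebra ℝ ((Fin d → ℝ) → ℝ) where
  carrier := {f | ContDiff ℝ ∞ f}
  mul_mem' := by
    intro f g (hf : ContDiff ℝ ∞ f) (hg : ContDiff ℝ ∞ g)
    exact hf.mul hg
  add_mem' := by
    intro f g (hf : ContDiff ℝ ∞ f) (hg : ContDiff ℝ ∞ g)
    exact hf.add hg
  algebraMap_mem' := by
    intro r
    exact (contDiff_const : ContDiff ℝ ∞ fun _ : Fin d → ℝ => r)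

abbrev Smooth (d : ℕ) : Type := smoothAlg d

/-- The partial derivative `∂/∂x_i` on `C^∞(ℝ^d)`. -/
noncomputable def pd {d : ℕ} (i : Fin d) (f : Smooth d) : Smooth d :=
  ⟨fun x => fderiv ℝ f.1 x (Pi.single i 1), by
    have hf : ContDiff ℝ ∞ f.1 := f.2
    exact (hf.fderiv_right (m := ∞) le_rfl).clm_apply contDiff_const⟩

/-- The iterated partial derivative `∂_{i_1} ⋯ ∂_{i_r}`. -/
noncomputable def pdList {d : ℕ} (is : List (Fin d)) (f : Smooth d) : Smooth d :=
  is.foldr pd f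

/-! ### Polyvector fields with the Schouten–Nijenhuis bracket -/

/-- Polyvector fields on `ℝ^d`: `γ` stands for `∑_I γ(I) ψ_I`, where for
`I = {i_1 < ⋯ < i_k}` we put `ψ_I = ∂_{i_1} ∧ ⋯ ∧ ∂_{i_k}`. -/
abbrev Polyvector (d : ℕ) : Type := Finset (Fin d) → Smooth d

/-- The `k`-vector fields.  They have degree `k - 1` in the Lie algebra `T` of polyvector fields,
and degree `k - 2` in the shift `T[1]`. -/
def IsHomogeneous {d : ℕ} (k : ℕ) (γ : Polyvector d) : Prop :=
  ∀ I : Finset (Fin d), I.card ≠ k → γ I = 0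

/-- The sign in `ψ_I ψ_J = ± ψ_{I ∪ J}` for disjoint `I`, `J`. -/
def wedgeSign {d : ℕ} (I J : Finset (Fin d)) : ℝ :=
  (-1) ^ ((I ×ˢ J).filter fun p => p.2 < p.1).card

/-- The wedge product. -/
noncomputable def wedge {d : ℕ} (x y : Polyvector d) : Polyvector d :=
  fun K => ∑ I ∈ K.powerset, wedgeSign I (K \ I) • (x I * y (K \ I))

/-- The left derivative `∂γ/∂ψ_i`. -/
noncomputable def leftDer {d : ℕ} (i : Fin d) (γ : Polyvector d) : Polyvector d :=
  fun I => if i ∈ I then 0 else wedgeSign {i} I • γ (insert i I)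

/-- The right derivative of `γ` with respect to `ψ_i`. -/
noncomputable def rightDer {d : ℕ} (i : Fin d) (γ : Polyvector d) : Polyvector d :=
  fun I => if i ∈ I then 0 else wedgeSign I {i} • γ (insert i I)

/-- The partial derivative `∂γ/∂x_i` of the coefficients. -/
noncomputable def coeffDer {d : ℕ} (i : Fin d) (γ : Polyvector d) : Polyvector d :=
  fun I => pd i (γ I)

/-- The Schouten–Nijenhuis bracket, i.e. the odd Poisson bracket
`∑_i (x ∂/∂ψ_i) ∧ (∂/∂x_i y) - (x ∂/∂x_i) ∧ (∂/∂ψ_i y)`. -/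
noncomputable def schouten {d : ℕ} (x y : Polyvector d) : Polyvector d :=
  ∑ i : Fin d, (wedge (rightDer i x) (coeffDer i y) - wedge (coeffDer i x) (leftDer i y))

/-- The `L_∞`-structure on `T[1]`: `Q_1 = 0` and `Q_2(x,y) = (-1)^{|x|} [x,y]`, with `|x|` the degree
of `x` in `T[1]` (a `k`-vector field has the parity of `k`). -/
noncomputable def polyvectorQ {d : ℕ} (x y : Polyvector d) : Polyvector d :=
  schouten (fun I => ((-1 : ℝ) ^ I.card) • x I) y

/-- The pairing `⟨γ, dx^{i_1} ⊗ ⋯ ⊗ dx^{i_k}⟩`, for which `⟨∂_{i_1} ∧ ⋯ ∧ ∂_{i_k}, dx^{i_1} ⊗ ⋯ ⊗ dx^{i_k}⟩ = 1`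
for distinct `i_1, …, i_k`.  It only sees the `k`-vector part of `γ`. -/
noncomputable def pairing {d : ℕ} (γ : Polyvector d) (is : List (Fin d)) : Smooth d :=
  if is.Nodup then
    ((-1 : ℝ) ^ (Finset.univ.filter fun p : Fin is.length × Fin is.length =>
      p.1 < p.2 ∧ is.get p.2 < is.get p.1).card) • γ is.toFinset
  else 0

/-! ### Polydifferential operators with the Gerstenhaber bracket -/

/-- Operators on `A = C^∞(ℝ^d)` of all arities at once: the restriction of `Φ` to lists of
length `m` is the `m`-ary part, a map `A^m → A`.  The `m`-ary operators have degree `m - 1` in the Lie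
algebra `D` of polydifferential operators and degree `m - 2` in the shift `D[1]`. -/
abbrev Cochain (d : ℕ) : Type := List (Smooth d) → Smooth d

/-- The operator `(f_1, …, f_m) ↦ c · ∂^{α_1} f_1 ⋯ ∂^{α_m} f_m`, where `m` is the length of `α`. -/
noncomputable def elementaryOp {d : ℕ} (c : Smooth d) (α : List (List (Fin d))) : Cochain d :=
  fun l => if l.length = α.length then c * (List.zipWith pdList α l).prod else 0

/-- The space `D` of polydifferential operators on `ℝ^d`. -/
noncomputable def polyDiff (d : ℕ) : Submodule ℝ (Cochain d) :=
  Submodule.span ℝ {Φ | ∃ c α, Φ = elementaryOp c α}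

/-- The Gerstenhaber composition
`(Φ ∘ Ψ)(f_0, …, f_{r-1}) = ∑ (-1)^{p(b-1)} Φ(f_0, …, f_{p-1}, Ψ(f_p, …, f_{p+b-1}), f_{p+b}, …)`,
where `b` is the arity of `Ψ`. -/
noncomputable def circ {d : ℕ} (Φ Ψ : Cochain d) : Cochain d := fun l =>
  ∑ p ∈ Finset.range (l.length + 1), ∑ b ∈ Finset.range (l.length - p + 1),
    ((-1 : ℝ) ^ (p * (b + 1))) •
      Φ (l.take p ++ [Ψ ((l.drop p).take b)] ++ l.drop (p + b))

/-- The Gerstenhaber bracket `[Φ,Ψ] = Φ ∘ Ψ - (-1)^{(a-1)(b-1)} Ψ ∘ Φ` for `Φ` of arity `a` and `Ψ` of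
arity `b`, extended to sums of operators of different arities (on `r` arguments, `a + b = r + 1`). -/
noncomputable def gerstenhaber {d : ℕ} (Φ Ψ : Cochain d) : Cochain d := fun l =>
  circ Φ Ψ l -
    ∑ p ∈ Finset.range (l.length + 1), ∑ a ∈ Finset.range (l.length - p + 1),
      ((-1 : ℝ) ^ ((a + 1) * (l.length + a)) * (-1 : ℝ) ^ (p * (a + 1))) •
        Ψ (l.take p ++ [Φ ((l.drop p).take a)] ++ l.drop (p + a))

/-- The multiplication of `A`, as a binary operator. -/
noncomputable def mulOp (d : ℕ) : Cochain d :=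
  fun l => if l.length = 2 then l.prod else 0

/-- `Q_1` on `D[1]`: the Hochschild differential `[m, ·]`, where `m` is the multiplication of `A`. -/
noncomputable def hochschild {d : ℕ} (Φ : Cochain d) : Cochain d := gerstenhaber (mulOp d) Φ

/-- `Q_2` on `D[1]`: `Q_2(Φ,Ψ) = (-1)^{|Φ|} [Φ,Ψ]`, with `|Φ|` the degree of `Φ` in `D[1]`
(an `a`-ary operator has the parity of `a`). -/
noncomputable def cochainQ {d : ℕ} (Φ Ψ : Cochain d) : Cochain d :=
  gerstenhaber (fun l => ((-1 : ℝ) ^ l.length) • Φ l) Ψ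

/-! ### Pre-`L_∞`-morphisms and `L_∞`-morphisms -/

/-- The Koszul sign of moving the factors with index in `I` to the front, where the `i`-th factor
has the parity of `k i`. -/
def unshuffleSign {n : ℕ} (k : Fin n → ℕ) (I : Finset (Fin n)) : ℝ :=
  ∏ i ∈ I, ∏ j ∈ Iᶜ, if j < i then (-1) ^ (k i * k j) else 1

/-- The Koszul sign of a permutation of factors of parities `k i`. -/
def koszulSign {n : ℕ} (k : Fin n → ℕ) (σ : Equiv.Perm (Fin n)) : ℝ :=
  ∏ a : Fin n, ∏ b : Fin n, if a < b ∧ σ b < σ a then (-1) ^ (k (σ a) * k (σ b)) else 1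

/-- A family of maps, to become the Taylor coefficients of a map `T[1] → D[1]`. -/
abbrev Taylor (d : ℕ) : Type := (n : ℕ) → (Fin n → Polyvector d) → Cochain d

/-- The Taylor coefficient on the sub-collection `(γ_i)_{i ∈ I}`, in increasing order. -/
noncomputable def Taylor.on {d : ℕ} (F : Taylor d) {n : ℕ} (γ : Fin n → Polyvector d)
    (I : Finset (Fin n)) : Cochain d :=
  F I.card fun a => γ (I.orderEmbOfFin rfl a)

/-- `F` is a pre-`L_∞`-morphism from `T` to `D`: its coefficients `F_n`, `n ≥ 1`, are
multilinear maps with values in `D`, graded symmetric and of degree `0` as maps `T[1]^n → D[1]`.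
Equivalently they are the Taylor coefficients of a morphism of the graded cocommutative coalgebras
cogenerated by `T[1]` and `D[1]`. -/
structure IsPreLInfty {d : ℕ} (F : Taylor d) : Prop where
  multilinear : ∀ n, 1 ≤ n →
    ∃ M : MultilinearMap ℝ (fun _ : Fin n => Polyvector d) (Cochain d), ∀ γ, F n γ = M γ
  mem : ∀ n, 1 ≤ n → ∀ γ, F n γ ∈ polyDiff d
  symm : ∀ n, 1 ≤ n → ∀ (k : Fin n → ℕ) (γ : Fin n → Polyvector d),
    (∀ i, IsHomogeneous (k i) (γ i)) → ∀ σ : Equiv.Perm (Fin n),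
      F n (γ ∘ σ) = koszulSign k σ • F n γ
  degree : ∀ n, 1 ≤ n → ∀ (k : Fin n → ℕ) (γ : Fin n → Polyvector d),
    (∀ i, IsHomogeneous (k i) (γ i)) → ∀ l : List (Smooth d),
      l.length + 2 * n ≠ ∑ i, k i + 2 → F n γ l = 0

/-- The `n`-th Taylor coefficient of `[Q,F] = Q ∘ F - F ∘ Q` at homogeneous
`γ_1, …, γ_n`, where `γ_i` is a `k_i`-vector field:
`Q_1 F_n(γ) + 1/2 ∑_{I ⊔ J} ± Q_2(F_I(γ_I), F_J(γ_J)) - ∑_{i<j} ± F_{n-1}(Q_2(γ_i,γ_j), …)`,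
with Koszul signs and `I`, `J` nonempty. -/
noncomputable def commutatorQ {d : ℕ} (F : Taylor d) (n : ℕ) (k : Fin n → ℕ)
    (γ : Fin n → Polyvector d) : Cochain d :=
  hochschild (F n γ)
    + (1 / 2 : ℝ) • ∑ I : Finset (Fin n) with I.Nonempty ∧ Iᶜ.Nonempty,
        unshuffleSign k I • cochainQ (F.on γ I) (F.on γ Iᶜ)
    - ∑ p : Fin n × Fin n with p.1 < p.2,
        unshuffleSign k {p.1, p.2} •
          F ((({p.1, p.2} : Finset (Fin n))ᶜ).card + 1)
            (Fin.cons (polyvectorQ (γ p.1) (γ p.2))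
              fun a => γ ((({p.1, p.2} : Finset (Fin n))ᶜ).orderEmbOfFin rfl a))

/-- `F` is an `L_∞`-morphism from `T` to `D`: a pre-`L_∞`-morphism with `[Q,F] = 0`. -/
def IsLInfty {d : ℕ} (F : Taylor d) : Prop :=
  IsPreLInfty F ∧ ∀ n, 1 ≤ n → ∀ (k : Fin n → ℕ) (γ : Fin n → Polyvector d),
    (∀ i, IsHomogeneous (k i) (γ i)) → commutatorQ F n k γ = 0

/-! ### Feynman graphs -/

/-- A possible edge of a graph with internal vertices `Fin n` and boundary vertices `Fin m`.
It starts at an internal vertex and ends at any vertex. -/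
abbrev Edge (n m : ℕ) : Type := Fin n × (Fin n ⊕ Fin m)

/-- A graph of type `(n,m)`, with labelled vertices and ordered edges. -/
abbrev Graph (n m : ℕ) : Type := List (Edge n m)

/-- Admissible graphs have no multiple edges and no edges from a vertex to itself. -/
def Admissible {n m : ℕ} (Γ : Graph n m) : Prop :=
  Γ.Nodup ∧ ∀ e ∈ Γ, e.2 ≠ Sum.inl e.1

/-- Relabelling of the internal vertices. -/
def relabel {n m : ℕ} (τ : Equiv.Perm (Fin n)) (Γ : Graph n m) : Graph n m :=
  Γ.map fun e => (τ e.1, Sum.map τ id e.2)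

/-- Graphs of all types. -/
abbrev AnyGraph : Type := Σ n : ℕ, Σ m : ℕ, Graph n m

/-- The formal linear combination consisting of one graph. -/
noncomputable def basisGraph {n m : ℕ} (Γ : Graph n m) : AnyGraph →₀ ℝ :=
  Finsupp.single ⟨n, m, Γ⟩ 1

/-- The relations between graphs: only admissible graphs count, exchanging two neighbours in the order
of the edges reverses the orientation, and the labels of the internal vertices do not matter. -/
inductive GraphRel : (AnyGraph →₀ ℝ) → Prop
  | inadmissible {n m : ℕ} (Γ : Graph n m) (h : ¬ Admissible Γ) : GraphRel (basisGraph Γ)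
  | swap {n m : ℕ} (u v : List (Edge n m)) (a b : Edge n m) :
      GraphRel (basisGraph (u ++ a :: b :: v) + basisGraph (u ++ b :: a :: v))
  | relabel {n m : ℕ} (Γ : Graph n m) (τ : Equiv.Perm (Fin n)) :
      GraphRel (basisGraph (relabel τ Γ) - basisGraph Γ)

/-- The vector space spanned by the admissible graphs, with orientations. -/
abbrev GraphSpace : Type := (AnyGraph →₀ ℝ) ⧸ Submodule.span ℝ {x | GraphRel x}

/-- The algebra `H` of Feynman graphs: the tensor algebra of the space of graphs. -/
abbrev FeynmanAlgebra : Type := TensorAlgebra ℝ GraphSpace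

/-- A graph as a generator of `H`. -/
noncomputable def gen {n m : ℕ} (Γ : Graph n m) : FeynmanAlgebra :=
  TensorAlgebra.ι ℝ (Submodule.Quotient.mk (basisGraph Γ))

/-! ### Subgraphs, quotients and the differential -/

/-- The identification of the vertices `i ≠ j`, as a map to the labels of the quotient; `j` is removed
from the list of vertices. -/
noncomputable def mergeVertex {n : ℕ} (i j : Fin (n + 1)) (h : i ≠ j) (v : Fin (n + 1)) : Fin n :=
  (finSuccAboveEquiv j).symm (if hv : v = j then ⟨i, h⟩ else ⟨v, hv⟩)

/-- The quotient `Γ/e`, where `e` is the `a`-th edge, from `i` to `j`. -/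
noncomputable def contractEdge {n m : ℕ} (Γ : Graph (n + 1) m) (a : ℕ) (i j : Fin (n + 1))
    (h : i ≠ j) : Graph n m :=
  (Γ.eraseIdx a).map fun e => (mergeVertex i j h e.1, Sum.map (mergeVertex i j h) id e.2)

/-- The internal part of the graph differential, `d^{int} Γ = ∑ ± Γ/e`, the sum over the
edges `e` between internal vertices. -/
noncomputable def dInt : {n m : ℕ} → Graph n m → FeynmanAlgebra
  | 0, _, _ => 0
  | _ + 1, _, Γ => ∑ a : Fin Γ.length,
      match Γ.get a with
      | (i, Sum.inl j) =>
          if h : i ≠ j then ((-1 : ℝ) ^ (a : ℕ)) • gen (contractEdge Γ a i j h) else 0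
      | (_, Sum.inr _) => 0

/-- The position of a vertex of `J` in the increasing enumeration of `J`. -/
noncomputable def indexIn {n : ℕ} (J : Finset (Fin n)) (v : Fin n) (h : v ∈ J) : Fin J.card :=
  (J.orderIsoOfFin rfl).symm ⟨v, h⟩

/-- The full subgraph on the internal vertices `J` and the boundary vertices `p, …, p + b - 1`. -/
noncomputable def subgraph {n m : ℕ} (Γ : Graph n m) (J : Finset (Fin n)) (p b : ℕ) :
    Graph J.card b :=
  Γ.filterMap fun e =>
    if hs : e.1 ∈ J then
      match e.2 with
      | Sum.inl v => if hv : v ∈ J then some (indexIn J e.1 hs, Sum.inl (indexIn J v hv)) else none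
      | Sum.inr w =>
          if hw : p ≤ (w : ℕ) ∧ (w : ℕ) < p + b then
            some (indexIn J e.1 hs, Sum.inr ⟨w - p, by omega⟩)
          else none
    else none

/-- The quotient by the full subgraph on the internal vertices `J` and the boundary
vertices `p, …, p + b - 1`, which becomes the boundary vertex `p` of the quotient. -/
noncomputable def quotientGraph {n m : ℕ} (Γ : Graph n m) (J : Finset (Fin n)) (p b : ℕ)
    (hp : p + b ≤ m) : Graph Jᶜ.card (m - b + 1) :=
  Γ.filterMap fun e =>
    if hs : e.1 ∈ Jᶜ then
      some (indexIn Jᶜ e.1 hs,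
        match e.2 with
        | Sum.inl v =>
            if hv : v ∈ Jᶜ then Sum.inl (indexIn Jᶜ v hv) else Sum.inr ⟨p, by omega⟩
        | Sum.inr w =>
            Sum.inr ⟨if (w : ℕ) < p then w else if (w : ℕ) < p + b then p else w - b + 1, by
              have := w.2
              split_ifs <;> omega⟩)
    else none

/-- The full subgraph on the internal vertices `J` and the boundary vertices `p, …, p + b - 1` is
proper and normal: it has at least two vertices or is an internal vertex, it does not contain all
vertices, and no edge leads from it to a vertex outside (in the quotient such an edge would start
at a boundary vertex). -/
def IsNormal {n m : ℕ} (Γ : Graph n m) (J : Finset (Fin n)) (p b : ℕ) : Prop :=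
  2 ≤ 2 * J.card + b ∧ J.card + b < n + m ∧
    ∀ e ∈ Γ, e.1 ∈ J →
      match e.2 with
      | Sum.inl v => v ∈ J
      | Sum.inr w => p ≤ (w : ℕ) ∧ (w : ℕ) < p + b

/-- The sign of reordering the edges of `Γ` so that those starting outside `J` come first. -/
def splitSign {n m : ℕ} (Γ : Graph n m) (J : Finset (Fin n)) : ℝ :=
  (-1) ^ (Finset.univ.filter fun q : Fin Γ.length × Fin Γ.length =>
    q.1 < q.2 ∧ (Γ.get q.1).1 ∈ J ∧ (Γ.get q.2).1 ∉ J).card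

open Classical in
/-- The boundary part of the coproduct, `Δ_b Γ = ∑ ± Γ/γ ⊗ γ`, the sum over the proper normal full
subgraphs `γ` that are collapsed to a boundary vertex; `γ` has internal vertices `J` and
consecutive boundary vertices `p, …, p + b - 1`. -/
noncomputable def coprodB {n m : ℕ} (Γ : Graph n m) : FeynmanAlgebra :=
  ∑ J : Finset (Fin n), ∑ p ∈ Finset.range (m + 1), ∑ b ∈ Finset.range (m + 1),
    if hp : p + b ≤ m then
      if IsNormal Γ J p b then
        ((-1 : ℝ) ^ (m - b + 1 + p * (b + 1)) * splitSign Γ J) •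
          (gen (quotientGraph Γ J p b hp) * gen (subgraph Γ J p b))
      else 0
    else 0

/-- The total differential `Γ ↦ d^{int} Γ + Δ_b Γ` on graphs. -/
noncomputable def totalD {n m : ℕ} (Γ : Graph n m) : FeynmanAlgebra := dInt Γ + coprodB Γ

/-- `(δW)(Γ) = W(d^{int} Γ) + W(Δ_b Γ)`. -/
noncomputable def coboundary (W : FeynmanAlgebra →ₐ[ℝ] ℝ) {n m : ℕ} (Γ : Graph n m) : ℝ :=
  W (totalD Γ)

/-! ### The state sum and Feynman expansions -/

/-- The colours of the edges that start at the internal vertex `v`, in the order of the edges. -/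
def outColours {n m d : ℕ} (Γ : Graph n m) (I : Fin Γ.length → Fin d) (v : Fin n) :
    List (Fin d) :=
  ((List.finRange Γ.length).filter fun a => (Γ.get a).1 = v).map I

/-- The colours of the edges that end at the vertex `t`. -/
def inColours {n m d : ℕ} (Γ : Graph n m) (I : Fin Γ.length → Fin d) (t : Fin n ⊕ Fin m) :
    List (Fin d) :=
  ((List.finRange Γ.length).filter fun a => (Γ.get a).2 = t).map I

/-- The sign of sorting the edges by their starting points. -/
def starSign {n m : ℕ} (Γ : Graph n m) : ℝ :=
  (-1) ^ (Finset.univ.filter fun q : Fin Γ.length × Fin Γ.length =>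
    q.1 < q.2 ∧ (Γ.get q.2).1 < (Γ.get q.1).1).card

/-- The state sum `U_Γ(γ_1, …, γ_n)(f_1, …, f_m)` over all colourings of the edges
by `1, …, d`.  An internal vertex `v` contributes `(∏_{e ∈ In(v)} ∂_{I(e)}) ⟨γ_v, ⊗_{e ∈ Out(v)} dx^{I(e)}⟩`,
a boundary vertex `w` contributes `(∏_{e ∈ In(w)} ∂_{I(e)}) f_w`. -/
noncomputable def stateSum {n m d : ℕ} (Γ : Graph n m) (γ : Fin n → Polyvector d)
    (f : Fin m → Smooth d) : Smooth d :=
  starSign Γ • ∑ I : Fin Γ.length → Fin d,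
    (∏ v : Fin n, pdList (inColours Γ I (Sum.inl v)) (pairing (γ v) (outColours Γ I v))) *
      ∏ w : Fin m, pdList (inColours Γ I (Sum.inr w)) (f w)

open Classical in
/-- The Feynman expansion `∑_m ∑_Γ c_Γ U_Γ` over the admissible graphs of type `(n,m)`
with `2n + m - s` edges.  As every graph occurs with all orders of its edges, the number of orders
is divided out. -/
noncomputable def expansion (d : ℕ) (s : ℕ) (c : (n m : ℕ) → Graph n m → ℝ) : Taylor d :=
  fun n γ l => ∑ E ∈ Finset.range (2 * n + l.length + 1) with E + s = 2 * n + l.length,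
    ∑ Γ : Fin E → Edge n l.length with Admissible (List.ofFn Γ),
      ((E.factorial : ℝ)⁻¹ * c n l.length (List.ofFn Γ)) • stateSum (List.ofFn Γ) γ l.get

/-- The Feynman expansion `f = W · U` on `ℝ^d` with weights `W`, over the graphs of type `(n,m)`
with `2n + m - 2` edges. -/
noncomputable def feynmanMap (W : FeynmanAlgebra →ₐ[ℝ] ℝ) (d : ℕ) : Taylor d :=
  expansion d 2 fun _ _ Γ => W (gen Γ)

/-- The Feynman expansion `(δW) · U` on `ℝ^d`, over the graphs of type `(n,m)`
with `2n + m - 3` edges. -/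
noncomputable def coboundaryMap (W : FeynmanAlgebra →ₐ[ℝ] ℝ) (d : ℕ) : Taylor d :=
  expansion d 3 fun _ _ Γ => coboundary W Γ

/-- The character `W` has degree `0` (a graph of type `(n,m)` with `2n + m - 2 + l` edges has degree `l`)
and is normalized to `1` on the graph with two boundary vertices and no edges, whose operator is the
multiplication of functions. -/
structure IsWeight (W : FeynmanAlgebra →ₐ[ℝ] ℝ) : Prop where
  degree_zero : ∀ (n m : ℕ) (Γ : Graph n m), Γ.length + 2 ≠ 2 * n + m → W (gen Γ) = 0
  normalized : W (gen ([] : Graph 0 2)) = 1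

end Feynman

namespace Feynman

/-! ### Alternating and symmetric functions of lists -/

/-! Both sides of (i) become sums over finite sets of coloured edges. A coloured edge `(s, t, i)` is
an odd operator on the fields at the vertices: it applies `∂/∂ψ_i` at `s`, `∂/∂x_i` at `t`, and the
parity sign at all vertices before `s`. These operators anticommute, so the amplitude of an ordered
list of coloured edges is alternating (`isAlt_amp`), and Kontsevich's state sum is the sum of the
amplitudes over all colourings (`stateSum_eq`). Weights are alternating as well. Hence weight times
amplitude depends only on the set of coloured edges, lists with repetitions drop out, and an
expansion with the number `E!` of edge orders divided out is a sum over sets (`ampSum`,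
`expansion_eq_ampSum`). Changing the order of the vertices produces exactly the Koszul signs
(`amp_reorder`); with the invariance of weights under relabelling this gives graded symmetry. The
degree is found by counting edges.

Identity (i) is then the Leibniz rule, used twice. At a merged vertex, derivatives of a wedge
product distribute over the two factors, so an amplitude of a quotient graph is the sum over all
graphs with this quotient (`liftSum_amp_merge`). Adding the two directions of the contracted edge
between `i` and `j` gives `-Q_2(γ_i, γ_j)` up to the Koszul sign (`liftSum_graphAmp_pair`), so `W ∘
d^int` yields the Schouten terms (`ampSum_dInt`). At a collapsed vertex, derivatives of a function
that is itself an amplitude distribute over the vertices of the inner graph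
(`liftSum_amp_collapse`). As `W` is multiplicative, `W ∘ Δ_b` yields the Gerstenhaber compositions
of `f_{Jᶜ}` with `f_J` (`ampSum_coWeight`). The size conditions on subgraphs in `Δ_b` cost nothing:
when one of them fails, the subgraph or the quotient has weight `0` for reasons of degree
(`coWeight_split`). Finally the normalization says that the zeroth coefficient is the
multiplication, so the Hochschild differential supplies the terms with `J` empty or full. Graded
symmetry of `Q_2` and the factor `1/2` leave one composition for each `J`
(`hochschild_add_sum_cochainQ`).

In (ii), a cocycle gives an `L_∞`-morphism by (i). Conversely the operators on `ℝ^d` determine the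
coefficients of graphs with at most `d` edges: give the edges pairwise different colours, put `x_A
ψ_K` at each internal vertex and `x_A` at each boundary vertex, with `A` the incoming and `K` the
outgoing colours, and evaluate at the origin. Only the chosen set of coloured edges survives
(`eq_zero_of_ampSum_eq_zero`). Graphs without internal vertices are invisible to the coefficients
with `n ≥ 1`; for them `δW = 0` is the associativity of the multiplication
(`coboundary_of_isEmpty`). -/

/-- A function of lists that changes sign when two neighbours are exchanged. -/
def IsAlt {X M : Type*} [Neg M] (c : List X → M) : Prop :=
  ∀ u v a b, c (u ++ a :: b :: v) = -c (u ++ b :: a :: v)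

/-- A function of lists that does not depend on the order. -/
def IsSymm {X M : Type*} (G : List X → M) : Prop :=
  ∀ l l' : List X, l.Perm l' → G l = G l'

/-- A function of lists that vanishes on lists with repetitions. -/
def VanishesOnDuplicates {X M : Type*} [Zero M] (G : List X → M) : Prop :=
  ∀ l : List X, ¬ l.Nodup → G l = 0

lemma isSymm_of_swap {X M : Type*} {G : List X → M}
    (h : ∀ u v a b, G (u ++ a :: b :: v) = G (u ++ b :: a :: v)) : IsSymm G := by
  intro l l' hl
  -- The prefix `u` is carried along so that the `cons` case can move the common head into it.
  suffices H : ∀ u, G (u ++ l) = G (u ++ l') by simpa using H []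
  induction hl with
  | nil => intro u; rfl
  | cons x _ ih => intro u; simpa using ih (u ++ [x])
  | swap x y l => intro u; exact h u l y x
  | trans _ _ ih₁ ih₂ => intro u; rw [ih₁, ih₂]

lemma IsAlt.cons {X M : Type*} [Neg M] {c : List X → M} (hc : IsAlt c) (x : X) :
    IsAlt fun l => c (x :: l) := fun u v a b => hc (x :: u) v a b

lemma IsAlt.map {X Y M : Type*} [Neg M] {c : List Y → M} (hc : IsAlt c) (π : X → Y) :
    IsAlt fun l => c (l.map π) := by
  intro u v a b
  simpa using hc (u.map π) (v.map π) (π a) (π b)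

lemma IsAlt.append_right {X M : Type*} [Neg M] {c : List X → M} (hc : IsAlt c) (l' : List X) :
    IsAlt fun l => c (l ++ l') := by
  intro u v a b
  simpa using hc u (v ++ l') a b

lemma IsAlt.isSymm_smul {X M : Type*} [AddCommGroup M] [Module ℝ M] {c : List X → ℝ}
    {A : List X → M} (hc : IsAlt c) (hA : IsAlt A) : IsSymm fun l => c l • A l := by
  apply isSymm_of_swap
  intro u v a b
  simp only [hc u v a b, hA u v a b, smul_neg, neg_smul, neg_neg]

lemma IsAlt.perm {X M : Type*} [AddCommGroup M] {c : List X → M} (hc : IsAlt c)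
    {l l' : List X} (h : l.Perm l') : c l = c l' ∨ c l = -c l' := by
  suffices H : ∀ u, c (u ++ l) = c (u ++ l') ∨ c (u ++ l) = -c (u ++ l') by simpa using H []
  induction h with
  | nil => intro u; left; rfl
  | cons x _ ih => intro u; simpa using ih (u ++ [x])
  | swap x y l => intro u; right; exact hc u l y x
  | trans _ _ ih₁ ih₂ =>
    intro u
    rcases ih₁ u with h₁ | h₁ <;> rcases ih₂ u with h₂ | h₂ <;> simp [h₁, h₂]

/-- Moving two equal entries to the front changes the value at most by a sign; exchanging them shows
that the new value is its own negative. -/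
lemma IsAlt.vanishesOnDuplicates {X M : Type*} [AddCommGroup M] [Module ℝ M] {c : List X → M}
    (hc : IsAlt c) : VanishesOnDuplicates c := by
  classical
  intro l hl
  obtain ⟨a, ha⟩ : ∃ a, List.Duplicate a l := by
    by_contra h
    push Not at h
    exact hl (List.nodup_iff_forall_not_duplicate.2 h)
  rw [List.duplicate_iff_sublist] at ha
  obtain ⟨l', hl'⟩ := ha.exists_perm_append
  have h0 : c (a :: a :: l') = 0 := by
    have h1 : c (a :: a :: l') = -c (a :: a :: l') := hc [] l' a a
    have h2 : (2 : ℝ) • c (a :: a :: l') = 0 := by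
      rw [two_smul]; nth_rewrite 1 [h1]; simp
    simpa using h2
  rcases hc.perm (hl'.trans (by simp : ([a, a] ++ l').Perm (a :: a :: l'))) with h | h <;>
    simp [h, h0]

/-- The number of pairs of positions in a list whose entries are related. -/
def pairCount {X : Type*} (r : X → X → Prop) [DecidableRel r] : List X → ℕ
  | [] => 0
  | x :: l => l.countP (fun y => r x y) + pairCount r l

/-- The signs of the theorem count pairs of positions; the recursive count makes them accessible to
induction on the list of edges. -/
lemma card_pairs_eq_pairCount {X : Type*} (r : X → X → Prop) [DecidableRel r] (l : List X) :
    (Finset.univ.filter fun q : Fin l.length × Fin l.length =>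
      q.1 < q.2 ∧ r (l.get q.1) (l.get q.2)).card = pairCount r l := by
  induction l with
  | nil => simp [pairCount]
  | cons x l ih =>
    rw [pairCount, ← ih, Finset.card_filter, Finset.card_filter, Fintype.sum_prod_type,
      Fintype.sum_prod_type]
    have key : ∀ f : Fin (l.length + 1) → Fin (l.length + 1) → ℕ,
        (∑ p : Fin (x :: l).length, ∑ q : Fin (x :: l).length, f p q) =
          ∑ p, ∑ q, f p q := fun _ => rfl
    rw [key, Fin.sum_univ_succ]
    congr 1
    · rw [Fin.sum_univ_succ]
      have : ∀ l : List X, (∑ i : Fin l.length, if r x (l.get i) then 1 else 0)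
          = l.countP fun y => r x y := by
        intro l
        induction l with
        | nil => simp
        | cons y l ih =>
          rw [List.countP_cons, ← ih, add_comm]
          refine (Fin.sum_univ_succ (n := l.length) _).trans ?_
          simp only [List.get_eq_getElem, Fin.val_zero, Fin.val_succ, List.getElem_cons_zero,
            List.getElem_cons_succ, decide_eq_true_eq]
          rfl
      simpa using this l
    · refine Finset.sum_congr rfl fun p _ => ?_
      rw [Fin.sum_univ_succ]
      simp

/-! ### Sums over lists of a given length and over finite sets -/

section Sums
variable {X Y M : Type*} [Fintype X] [AddCommGroup M]

/-- The sum of the values of a function at all lists of length `E`. -/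
def listSum : ℕ → (List X → M) → M
  | 0, G => G []
  | E + 1, G => ∑ x, listSum E fun l => G (x :: l)

lemma listSum_congr {E : ℕ} {G G' : List X → M} (h : ∀ l, l.length = E → G l = G' l) :
    listSum E G = listSum E G' := by
  induction E generalizing G G' with
  | zero => exact h [] rfl
  | succ E ih => exact Finset.sum_congr rfl fun x _ => ih fun l hl => h _ (by simp [hl])

lemma listSum_eq_zero {E : ℕ} {G : List X → M} (h : ∀ l, l.length = E → G l = 0) :
    listSum E G = 0 := by
  induction E generalizing G with
  | zero => exact h [] rfl
  | succ E ih => exact Finset.sum_eq_zero fun x _ => ih fun l hl => h _ (by simp [hl])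

lemma listSum_add (E : ℕ) (G G' : List X → M) :
    listSum E (fun l => G l + G' l) = listSum E G + listSum E G' := by
  induction E generalizing G G' with
  | zero => rfl
  | succ E ih => simp only [listSum, ih, Finset.sum_add_distrib]

lemma listSum_finset_sum {ι : Type*} (s : Finset ι) (E : ℕ) (G : ι → List X → M) :
    listSum E (fun l => ∑ i ∈ s, G i l) = ∑ i ∈ s, listSum E (G i) := by
  induction E generalizing G with
  | zero => rfl
  | succ E ih => simp only [listSum, ih]; exact Finset.sum_comm

lemma sum_ofFn_eq_listSum (E : ℕ) (G : List X → M) :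
    ∑ L : Fin E → X, G (List.ofFn L) = listSum E G := by
  induction E generalizing G with
  | zero => simp [listSum]
  | succ E ih =>
    rw [← (Fin.consEquiv fun _ : Fin (E + 1) => X).sum_comp, Fintype.sum_prod_type]
    simp only [listSum, ← ih]
    simp [Fin.consEquiv]

open Classical in
-- A set of `E + 1` elements arises once for each choice of its first element `x`; sets already
-- containing `x` would give a repetition and contribute nothing.
lemma sum_cons_eq_sum_powersetCard (E : ℕ) (G : List X → M) (hG : IsSymm G)
    (h0 : VanishesOnDuplicates G) :
    ∑ x, ∑ S ∈ Finset.powersetCard E (Finset.univ : Finset X), G (x :: S.toList) =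
      (E + 1) • ∑ S ∈ Finset.powersetCard (E + 1) (Finset.univ : Finset X), G S.toList := by
  have h1 : ∀ x, ∑ S ∈ Finset.powersetCard E (Finset.univ : Finset X), G (x :: S.toList) =
      ∑ S ∈ Finset.powersetCard (E + 1) (Finset.univ : Finset X) with x ∈ S, G S.toList := by
    intro x
    rw [← Finset.sum_filter_of_ne (p := fun S => x ∉ S)]
    · refine Finset.sum_bij' (fun S _ => insert x S) (fun S _ => S.erase x) ?_ ?_ ?_ ?_ ?_
      · intro S hS
        simp only [Finset.mem_filter, Finset.mem_powersetCard_univ] at hS ⊢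
        simp [Finset.card_insert_of_notMem hS.2, hS.1]
      · intro S hS
        simp only [Finset.mem_filter, Finset.mem_powersetCard_univ] at hS ⊢
        simp [Finset.card_erase_of_mem hS.2, hS.1]
      · intro S hS
        exact Finset.erase_insert (Finset.mem_filter.1 hS).2
      · intro S hS
        exact Finset.insert_erase (Finset.mem_filter.1 hS).2
      · intro S hS
        exact hG _ _ (Finset.toList_insert (Finset.mem_filter.1 hS).2).symm
    · intro S _ hne hx
      exact hne (h0 _ fun hn => (List.nodup_cons.1 hn).1 (Finset.mem_toList.2 hx))
  simp_rw [h1, Finset.sum_filter]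
  rw [Finset.sum_comm, Finset.smul_sum]
  refine Finset.sum_congr rfl fun S hS => ?_
  rw [Finset.sum_ite_mem, Finset.univ_inter, Finset.sum_const, (Finset.mem_powersetCard_univ.1 hS)]

/-- A set of `E` elements has `E!` orderings with equal values, and lists with repetitions do not
count. -/
lemma listSum_eq_factorial_smul (E : ℕ) (G : List X → M) (hG : IsSymm G)
    (h0 : VanishesOnDuplicates G) :
    listSum E G = E.factorial •
      ∑ S ∈ Finset.powersetCard E (Finset.univ : Finset X), G S.toList := by
  induction E generalizing G with
  | zero => simp [listSum]
  | succ E ih =>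
    have : ∀ x, listSum E (fun l => G (x :: l)) = E.factorial •
        ∑ S ∈ Finset.powersetCard E (Finset.univ : Finset X), G (x :: S.toList) := fun x =>
      ih (fun l => G (x :: l)) (fun l l' h => hG _ _ (h.cons x))
        fun l hl => h0 _ fun h => hl (List.nodup_cons.1 h).2
    simp only [listSum, this]
    rw [← Finset.smul_sum, sum_cons_eq_sum_powersetCard E G hG h0, smul_smul, mul_comm,
      Nat.factorial_succ]

lemma inv_factorial_smul_listSum [Module ℝ M] (E : ℕ) (G : List X → M) (hG : IsSymm G)
    (h0 : VanishesOnDuplicates G) :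
    (E.factorial : ℝ)⁻¹ • listSum E G =
      ∑ S ∈ Finset.powersetCard E (Finset.univ : Finset X), G S.toList := by
  rw [listSum_eq_factorial_smul E G hG h0, ← Nat.cast_smul_eq_nsmul ℝ, smul_smul,
    inv_mul_cancel₀ (by exact_mod_cast E.factorial_ne_zero), one_smul]

/-- A function of finite sets that is supported on sets of `E` elements. -/
lemma sum_eq_inv_factorial_smul_listSum [Module ℝ M] (E : ℕ) (G : List X → M) (hG : IsSymm G)
    (h0 : VanishesOnDuplicates G) (hE : ∀ l, l.length ≠ E → G l = 0) :
    ∑ S : Finset X, G S.toList = (E.factorial : ℝ)⁻¹ • listSum E G := by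
  rw [inv_factorial_smul_listSum E G hG h0]
  symm
  refine Finset.sum_subset (Finset.subset_univ _) fun S _ hS => hE _ ?_
  simpa using hS

/-- The sum of `g x l'` over the entries `x` of a list, `l'` being the list of the other entries. -/
def pick {X M : Type*} [AddCommGroup M] (g : X → List X → M) : List X → M
  | [] => 0
  | x :: l => g x l + pick (fun e l' => g e (x :: l')) l

/-- The sum of `± h x l'` over the entries `x` of a list, `l'` being the list of the other entries
and `±` the sign of moving `x` to the front. -/
def signedPick {X : Type*} (h : X → List X → ℝ) : List X → ℝ
  | [] => 0
  | x :: l => h x l - signedPick (fun e l' => h e (x :: l')) l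

lemma sum_eraseIdx_eq_signedPick {X : Type*} (h : X → List X → ℝ) (l : List X) :
    ∑ a : Fin l.length, (-1 : ℝ) ^ (a : ℕ) * h (l.get a) (l.eraseIdx a) = signedPick h l := by
  induction l generalizing h with
  | nil => simp [signedPick]
  | cons x l ih =>
    rw [signedPick, ← ih]
    refine (Fin.sum_univ_succ (n := l.length) _).trans ?_
    simp [pow_succ, Finset.sum_neg_distrib, sub_eq_add_neg]

lemma signedPick_neg {X : Type*} (k : X → List X → ℝ) (l : List X) :
    signedPick (fun e l' => -k e l') l = -signedPick k l := by
  induction l generalizing k with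
  | nil => simp [signedPick]
  | cons y l ih => simp only [signedPick, ih fun e l' => k e (y :: l')]; ring

/-- The terms that pick one of the two exchanged entries trade places, and their position signs
differ by one; in all other terms both entries remain and `h` changes sign. -/
lemma isAlt_signedPick {X : Type*} {h : X → List X → ℝ} (hh : ∀ x, IsAlt (h x)) :
    IsAlt (signedPick h) := by
  intro u v a b
  induction u generalizing h with
  | nil =>
    have : signedPick (fun e l' => h e (a :: b :: l')) v =
        -signedPick (fun e l' => h e (b :: a :: l')) v := by
      have : (fun e l' => h e (a :: b :: l')) = fun e l' => -h e (b :: a :: l') := by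
        funext e l'; exact hh e [] l' a b
      rw [this, signedPick_neg]
    simp only [List.nil_append, signedPick]
    rw [this]
    ring
  | cons x u ih =>
    simp only [List.cons_append, signedPick]
    rw [hh x u v a b, ih (fun e => (hh e).cons x)]
    ring

/-- Moving the picked entry to the front of `A` produces the same sign a second time, so the signs
cancel. This removes the sign `(-1)^a` from the contraction of the `a`-th edge. -/
lemma signedPick_smul {X : Type*} [Module ℝ M] (h : X → List X → ℝ) {A : List X → M} (hA : IsAlt A)
    (l : List X) : signedPick h l • A l = pick (fun e l' => h e l' • A (e :: l')) l := by
  induction l generalizing h A with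
  | nil => simp [signedPick, pick]
  | cons x l ih =>
    have e : (fun e l' => h e (x :: l') • A (e :: x :: l')) =
        fun e l' => (-h e (x :: l')) • A (x :: e :: l') := by
      funext e l'
      rw [show A (e :: x :: l') = -A (x :: e :: l') from hA [] l' e x]
      simp
    rw [signedPick, pick, e, ← ih (fun e l' => -h e (x :: l')) (hA.cons x), signedPick_neg, sub_smul, neg_smul,
      sub_eq_add_neg]

/-- Each of the `E + 1` positions of the picked entry contributes the same sum. The factor later
reduces `(E + 1)!` to `E!`. -/
lemma listSum_pick (E : ℕ) (g : X → List X → M) :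
    listSum (E + 1) (pick g) = (E + 1) • ∑ e, listSum E (g e) := by
  induction E generalizing g with
  | zero => simp [listSum, pick]
  | succ E ih =>
    have : listSum (E + 1 + 1) (pick g) = ∑ x, (listSum (E + 1) (g x) +
        listSum (E + 1) (pick fun e l' => g e (x :: l'))) := by
      rw [listSum]
      exact Finset.sum_congr rfl fun x _ => listSum_add _ _ _
    rw [this, Finset.sum_add_distrib]
    simp_rw [ih]
    rw [← Finset.smul_sum, Finset.sum_comm, add_smul (E + 1) 1, one_smul, add_comm]
    rfl

/-- The sum of the values of `G` over all ways of replacing each entry `y` of a list by an element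
of `fib y`. -/
def liftSum {X Y M : Type*} [AddCommMonoid M] (fib : Y → Finset X) (G : List X → M) : List Y → M
  | [] => G []
  | y :: l => ∑ x ∈ fib y, liftSum fib (fun L => G (x :: L)) l

lemma liftSum_finset_sum {X Y M ι : Type*} [AddCommMonoid M] (fib : Y → Finset X) (s : Finset ι)
    (G : ι → List X → M) (l : List Y) :
    liftSum fib (fun L => ∑ i ∈ s, G i L) l = ∑ i ∈ s, liftSum fib (G i) l := by
  induction l generalizing G with
  | nil => rfl
  | cons y l ih =>
    simp only [liftSum, ih]
    exact Finset.sum_comm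

/-- Lists are grouped by their image under `π`. With `π` the map of edges to a quotient graph, this
passes from sums over graphs to sums over quotients and their lifts. -/
lemma listSum_lift [Module ℝ M] [Fintype Y] [DecidableEq Y] (π : X → Y) (w : List Y → ℝ) (G : List X → M)
    (E : ℕ) : listSum E (fun L => w (L.map π) • G L) =
      listSum E fun L' => w L' • liftSum (fun y => Finset.univ.filter fun x => π x = y) G L' := by
  induction E generalizing w G with
  | zero => simp [listSum, liftSum]
  | succ E ih =>
    simp only [listSum, List.map_cons, liftSum]
    rw [← Finset.sum_fiberwise _ π]
    refine Finset.sum_congr rfl fun y _ => ?_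
    rw [← listSum_congr (fun l _ => (Finset.smul_sum (r := w (y :: l))).symm), listSum_finset_sum]
    refine Finset.sum_congr rfl fun x hx => ?_
    rw [(Finset.mem_filter.1 hx).2]
    exact ih (fun l => w (y :: l)) fun L => G (x :: L)

/-- Splitting a sum over finite sets along two disjoint parts that carry the support. -/
lemma sum_finset_split {A B : Type*} [Fintype A] [Fintype B] (iA : A → X) (iB : B → X)
    (hA : Function.Injective iA) (hB : Function.Injective iB) (hAB : ∀ a b, iA a ≠ iB b)
    (G : List X → M) (hG : IsSymm G)
    (h0 : ∀ l, ∀ x ∈ l, (∀ a, iA a ≠ x) → (∀ b, iB b ≠ x) → G l = 0) :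
    ∑ S : Finset X, G S.toList =
      ∑ SA : Finset A, ∑ SB : Finset B, G (SA.toList.map iA ++ SB.toList.map iB) := by
  classical
  rw [← Fintype.sum_prod_type', ← Finset.sumEquiv.toEquiv.sum_comp]
  symm
  let i : A ⊕ B ↪ X := ⟨Sum.elim iA iB, Function.Injective.sumElim hA hB hAB⟩
  refine Finset.sum_of_injOn (fun S => S.map i) ?_ (by simp) ?_ ?_
  · exact fun S _ T _ h => Finset.map_injective i h
  · intro S _ hS
    have : ∃ x ∈ S, x ∉ Set.range i := by
      by_contra h
      push Not at h
      apply hS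
      refine ⟨Finset.univ.filter (fun y => i y ∈ S), by simp, ?_⟩
      ext x
      simp only [Finset.mem_map, Finset.mem_filter, Finset.mem_univ, true_and]
      constructor
      · rintro ⟨y, hy, rfl⟩; exact hy
      · intro hx
        obtain ⟨y, rfl⟩ := h x hx
        exact ⟨y, hx, rfl⟩
    obtain ⟨x, hx, hxi⟩ := this
    refine h0 _ x (Finset.mem_toList.2 hx) ?_ ?_
    · exact fun a ha => hxi ⟨Sum.inl a, ha⟩
    · exact fun b hb => hxi ⟨Sum.inr b, hb⟩
  · intro S _
    refine hG _ _ ?_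
    rw [List.perm_ext_iff_of_nodup]
    · intro x
      simp only [List.mem_append, List.mem_map, Finset.mem_toList, Finset.mem_map, i]
      simp [Finset.sumEquiv]
    · rw [List.nodup_append]
      refine ⟨(Finset.nodup_toList _).map hA, (Finset.nodup_toList _).map hB, ?_⟩
      rintro x hx y hy rfl
      obtain ⟨a, _, rfl⟩ := List.mem_map.1 hx
      obtain ⟨b, _, hb⟩ := List.mem_map.1 hy
      exact hAB a b hb.symm
    · exact Finset.nodup_toList _

end Sums

/-! ### Partial derivatives -/

lemma Smooth.differentiable {d : ℕ} (f : Smooth d) : Differentiable ℝ f.1 :=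
  ContDiff.differentiable (n := ∞) f.2 (by simp)

/-- The partial derivative as a linear map. -/
noncomputable def pdLinear {d : ℕ} (i : Fin d) : Smooth d →ₗ[ℝ] Smooth d where
  toFun := pd i
  map_add' f g := by
    ext x
    change fderiv ℝ (f.1 + g.1) x _ = fderiv ℝ f.1 x _ + fderiv ℝ g.1 x _
    rw [fderiv_add (f.differentiable x) (g.differentiable x)]
    rfl
  map_smul' c f := by
    ext x
    change fderiv ℝ (c • f.1) x _ = c • fderiv ℝ f.1 x _
    rw [fderiv_const_smul (f.differentiable x)]
    rfl

@[simp] lemma pd_zero {d : ℕ} (i : Fin d) : pd i (0 : Smooth d) = 0 := map_zero (pdLinear i)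

lemma pd_add {d : ℕ} (i : Fin d) (f g : Smooth d) : pd i (f + g) = pd i f + pd i g :=
  map_add (pdLinear i) f g

lemma pd_smul {d : ℕ} (i : Fin d) (c : ℝ) (f : Smooth d) : pd i (c • f) = c • pd i f :=
  map_smul (pdLinear i) c f

lemma pd_sum {d : ℕ} {ι : Type*} (i : Fin d) (s : Finset ι) (f : ι → Smooth d) :
    pd i (∑ a ∈ s, f a) = ∑ a ∈ s, pd i (f a) :=
  map_sum (pdLinear i) f s

lemma pd_mul {d : ℕ} (i : Fin d) (f g : Smooth d) : pd i (f * g) = pd i f * g + f * pd i g := by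
  ext x
  change fderiv ℝ (f.1 * g.1) x _ = fderiv ℝ f.1 x _ * g.1 x + f.1 x * fderiv ℝ g.1 x _
  rw [fderiv_mul (f.differentiable x) (g.differentiable x)]
  simp
  ring

lemma pd_one {d : ℕ} (i : Fin d) : pd i (1 : Smooth d) = 0 := by
  ext x
  change fderiv ℝ (fun _ => (1 : ℝ)) x _ = 0
  simp

lemma pd_prod {d : ℕ} {ι : Type*} [DecidableEq ι] (i : Fin d) (s : Finset ι) (f : ι → Smooth d) :
    pd i (∏ a ∈ s, f a) = ∑ b ∈ s, ∏ a ∈ s, if a = b then pd i (f a) else f a := by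
  induction s using Finset.induction_on with
  | empty => simp [pd_one]
  | insert c s hc ih =>
    rw [Finset.prod_insert hc, pd_mul, ih, Finset.sum_insert hc, Finset.mul_sum,
      Finset.prod_insert hc, if_pos rfl]
    congr 1
    · congr 1
      refine Finset.prod_congr rfl fun a ha => ?_
      rw [if_neg (by rintro rfl; exact hc ha)]
    · refine Finset.sum_congr rfl fun b hb => ?_
      rw [Finset.prod_insert hc, if_neg (by rintro rfl; exact hc hb)]

lemma pd_comm {d : ℕ} (i j : Fin d) (f : Smooth d) : pd i (pd j f) = pd j (pd i f) := by
  have key : ∀ (i j : Fin d) (x : Fin d → ℝ), (pd i (pd j f)).1 x =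
      fderiv ℝ (fderiv ℝ f.1) x (Pi.single i 1) (Pi.single j 1) := by
    intro i j x
    have hf : ContDiff ℝ ∞ f.1 := f.2
    have hd : Differentiable ℝ (fderiv ℝ f.1) :=
      (hf.fderiv_right (m := ∞) le_rfl).differentiable (by simp)
    change fderiv ℝ (fun y => fderiv ℝ f.1 y (Pi.single j 1)) x (Pi.single i 1) = _
    rw [fderiv_clm_apply (hd x) (differentiableAt_const _)]
    simp
  ext x
  rw [key, key]
  have hf : ContDiff ℝ ∞ f.1 := f.2
  have h : IsSymmSndFDerivAt ℝ f.1 x := hf.contDiffAt.isSymmSndFDerivAt (by simp; exact WithTop.coe_le_coe.2 (le_top : (2 : ℕ∞) ≤ ⊤))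
  exact h _ _

lemma pdList_cons {d : ℕ} (i : Fin d) (is : List (Fin d)) (f : Smooth d) :
    pdList (i :: is) f = pd i (pdList is f) := rfl

lemma pdList_pd {d : ℕ} (i : Fin d) (is : List (Fin d)) (f : Smooth d) :
    pdList is (pd i f) = pd i (pdList is f) := by
  induction is with
  | nil => rfl
  | cons j is ih => rw [pdList_cons, pdList_cons, ih, pd_comm]

/-- The iterated partial derivative as a linear map. -/
noncomputable def pdListLinear {d : ℕ} (is : List (Fin d)) : Smooth d →ₗ[ℝ] Smooth d where
  toFun := pdList is
  map_add' f g := by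
    induction is with
    | nil => rfl
    | cons j is ih => rw [pdList_cons, ih, pd_add]; rfl
  map_smul' c f := by
    induction is with
    | nil => rfl
    | cons j is ih => rw [pdList_cons, ih, RingHom.id_apply, pd_smul]; rfl

@[simp] lemma pdListLinear_apply {d : ℕ} (is : List (Fin d)) (f : Smooth d) :
    pdListLinear is f = pdList is f := rfl

/-! ### Wedge products and derivatives of polyvectors -/

lemma wedgeSign_eq_prod {d : ℕ} (I J : Finset (Fin d)) :
    wedgeSign I J = ∏ a ∈ I, ∏ b ∈ J, if b < a then (-1 : ℝ) else 1 := by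
  rw [wedgeSign, Finset.card_filter, ← Finset.prod_pow_eq_pow_sum, Finset.prod_product]
  refine Finset.prod_congr rfl fun a _ => Finset.prod_congr rfl fun b _ => ?_
  split_ifs <;> simp

lemma wedgeSign_insert_left {d : ℕ} {i : Fin d} {I : Finset (Fin d)} (h : i ∉ I)
    (J : Finset (Fin d)) : wedgeSign (insert i I) J = wedgeSign {i} J * wedgeSign I J := by
  simp only [wedgeSign_eq_prod, Finset.prod_insert h, Finset.prod_singleton]

lemma wedgeSign_insert_right {d : ℕ} {i : Fin d} {J : Finset (Fin d)} (h : i ∉ J)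
    (I : Finset (Fin d)) : wedgeSign I (insert i J) = wedgeSign I {i} * wedgeSign I J := by
  simp only [wedgeSign_eq_prod, Finset.prod_insert h, Finset.prod_singleton, Finset.prod_mul_distrib]

lemma wedgeSign_mul_self {d : ℕ} (I J : Finset (Fin d)) : wedgeSign I J * wedgeSign I J = 1 := by
  rw [wedgeSign, ← mul_pow]; simp

lemma wedgeSign_singleton_comm {d : ℕ} {i : Fin d} {I : Finset (Fin d)} (h : i ∉ I) :
    wedgeSign I {i} = (-1) ^ I.card * wedgeSign {i} I := by
  simp only [wedgeSign_eq_prod, Finset.prod_singleton]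
  rw [← Finset.prod_const, ← Finset.prod_mul_distrib]
  refine Finset.prod_congr rfl fun a ha => ?_
  have : a ≠ i := by rintro rfl; exact h ha
  rcases lt_or_gt_of_ne this with h | h <;> simp [h, not_lt_of_gt h]

/-- The sign of the parity. -/
noncomputable def barL (d : ℕ) : Polyvector d →ₗ[ℝ] Polyvector d where
  toFun γ := fun I => ((-1 : ℝ) ^ I.card) • γ I
  map_add' x y := by funext I; simp
  map_smul' c x := by funext I; exact smul_comm ((-1 : ℝ) ^ I.card) c (x I)

/-- The left derivative as a linear map. -/
noncomputable def leftDerL {d : ℕ} (i : Fin d) : Polyvector d →ₗ[ℝ] Polyvector d where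
  toFun := leftDer i
  map_add' x y := by funext I; by_cases h : i ∈ I <;> simp [leftDer, h]
  map_smul' c x := by
    funext I
    by_cases h : i ∈ I
    · simp [leftDer, h]
    · simpa [leftDer, h] using smul_comm (wedgeSign {i} I) c (x (insert i I))

/-- The derivative of the coefficients as a linear map. -/
noncomputable def coeffDerL {d : ℕ} (i : Fin d) : Polyvector d →ₗ[ℝ] Polyvector d where
  toFun := coeffDer i
  map_add' x y := by funext I; simp [coeffDer, pd_add]
  map_smul' c x := by funext I; simp [coeffDer, pd_smul]

lemma barL_apply {d : ℕ} (x : Polyvector d) (I : Finset (Fin d)) :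
    barL d x I = ((-1 : ℝ) ^ I.card) • x I := rfl

lemma leftDerL_apply {d : ℕ} (i : Fin d) (x : Polyvector d) : leftDerL i x = leftDer i x := rfl

lemma coeffDerL_apply {d : ℕ} (i : Fin d) (x : Polyvector d) : coeffDerL i x = coeffDer i x := rfl

lemma leftDerL_barL {d : ℕ} (i : Fin d) (x : Polyvector d) :
    leftDerL i (barL d x) = -barL d (leftDerL i x) := by
  funext I
  rw [Pi.neg_apply, barL_apply, leftDerL_apply, leftDerL_apply, leftDer, leftDer]
  split_ifs with h
  · simp
  · rw [barL_apply, Finset.card_insert_of_notMem h, smul_smul, smul_smul, ← neg_smul]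
    congr 1
    ring

lemma coeffDerL_barL {d : ℕ} (i : Fin d) (x : Polyvector d) :
    coeffDerL i (barL d x) = barL d (coeffDerL i x) := by
  funext I
  exact pd_smul _ _ _

lemma coeffDerL_leftDerL {d : ℕ} (i j : Fin d) (x : Polyvector d) :
    coeffDerL i (leftDerL j x) = leftDerL j (coeffDerL i x) := by
  funext I
  simp only [coeffDerL_apply, leftDerL_apply, coeffDer, leftDer]
  split_ifs with h
  · simp
  · exact pd_smul _ _ _

lemma coeffDerL_comm {d : ℕ} (i j : Fin d) (x : Polyvector d) :
    coeffDerL i (coeffDerL j x) = coeffDerL j (coeffDerL i x) := by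
  funext I
  exact pd_comm _ _ _

/-- The `ψ_i` are odd variables: removing `i` and `j` in the two orders gives signs that differ by
the transposition of `ψ_i` and `ψ_j`. -/
lemma leftDerL_leftDerL {d : ℕ} (i j : Fin d) (x : Polyvector d) :
    leftDerL i (leftDerL j x) = -leftDerL j (leftDerL i x) := by
  funext I
  simp only [leftDerL_apply, leftDer, Pi.neg_apply]
  by_cases hi : i ∈ I <;> by_cases hj : j ∈ I <;> simp only [hi, hj, if_true, if_false, smul_zero,
    neg_zero, Finset.mem_insert_of_mem]
  by_cases hij : i = j
  · subst hij; simp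
  · have h1 : j ∉ insert i I := by simp [hj, Ne.symm hij]
    have h2 : i ∉ insert j I := by simp [hi, hij]
    rw [if_neg h1, if_neg h2, Finset.insert_comm, wedgeSign_insert_right hi,
      wedgeSign_insert_right hj, smul_smul, smul_smul, ← neg_smul]
    congr 1
    have : wedgeSign {j} {i} = -wedgeSign {i} {j} := by
      rw [wedgeSign_singleton_comm (by simpa using hij)]; simp
    rw [this]
    ring

lemma barL_wedge {d : ℕ} (x y : Polyvector d) :
    barL d (wedge x y) = wedge (barL d x) (barL d y) := by
  funext K
  rw [barL_apply, wedge, wedge, Finset.smul_sum]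
  refine Finset.sum_congr rfl fun I hI => ?_
  rw [barL_apply, barL_apply, smul_mul_smul_comm, smul_comm, ← pow_add,
    Finset.card_sdiff_of_subset (Finset.mem_powerset.1 hI),
    Nat.add_sub_cancel' (Finset.card_le_card (Finset.mem_powerset.1 hI))]

lemma coeffDerL_wedge {d : ℕ} (i : Fin d) (x y : Polyvector d) :
    coeffDerL i (wedge x y) = wedge (coeffDerL i x) y + wedge x (coeffDerL i y) := by
  funext K
  simp only [coeffDerL_apply, coeffDer, wedge, Pi.add_apply, pd_sum, pd_smul, pd_mul, smul_add,
    Finset.sum_add_distrib]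

lemma leftDerL_wedge {d : ℕ} (i : Fin d) (x y : Polyvector d) :
    leftDerL i (wedge x y) = wedge (leftDerL i x) y + wedge (barL d x) (leftDerL i y) := by
  funext K
  rw [Pi.add_apply, leftDerL_apply, leftDer]
  split_ifs with h
  · obtain ⟨M, hM, rfl⟩ : ∃ M, i ∉ M ∧ K = insert i M :=
      ⟨K.erase i, by simp, (Finset.insert_erase h).symm⟩
    simp only [wedge, Finset.sum_powerset_insert hM]
    rw [← Finset.sum_add_distrib, ← Finset.sum_add_distrib, ← Finset.sum_add_distrib]
    symm
    -- Here `ψ_i ψ_i = 0` is at work: both sums contain `x (insert i I) * y (insert i (M \ I))`, the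
    -- first from the subset `I`, the second from `insert i I`, with opposite signs.
    refine Finset.sum_eq_zero fun I hI => ?_
    have hiI : i ∉ I := fun h => hM (Finset.mem_powerset.1 hI h)
    have h1 : insert i M \ I = insert i (M \ I) := Finset.insert_sdiff_of_notMem _ hiI
    have h2 : insert i M \ insert i I = M \ I := by
      ext a; simp only [Finset.mem_sdiff, Finset.mem_insert]; grind
    have h3 : i ∉ M \ I := by simp [hM]
    rw [h1, h2, leftDerL_apply, leftDerL_apply, barL_apply, barL_apply]
    simp only [leftDer, hiI, h3, if_false, Finset.mem_insert_self, if_true, zero_mul, mul_zero,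
      smul_zero, add_zero, zero_add]
    rw [Finset.card_insert_of_notMem hiI, wedgeSign_insert_left hiI, wedgeSign_insert_right h3,
      wedgeSign_singleton_comm hiI]
    simp only [smul_mul_assoc, mul_smul_comm, smul_smul]
    rw [← add_smul]
    rw [show (-1 : ℝ) ^ I.card * wedgeSign {i} I * wedgeSign I (M \ I) * wedgeSign {i} I +
      wedgeSign {i} (M \ I) * wedgeSign I (M \ I) * (wedgeSign {i} (M \ I) * (-1) ^ (I.card + 1))
      = 0 by rw [pow_succ]; linear_combination (-1 : ℝ) ^ I.card * wedgeSign I (M \ I) *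
        (wedgeSign_mul_self {i} I - wedgeSign_mul_self {i} (M \ I)), zero_smul]
  · simp only [wedge, Finset.sum_powerset_insert h, smul_add]
    rw [add_comm]
    congr 1
    · rw [Finset.smul_sum]
      refine Finset.sum_congr rfl fun I hI => ?_
      have hiI : i ∉ I := fun h' => h (Finset.mem_powerset.1 hI h')
      have h2 : insert i K \ insert i I = K \ I := by
        ext a; simp only [Finset.mem_sdiff, Finset.mem_insert]; grind
      rw [h2, leftDerL_apply, leftDer, if_neg hiI, wedgeSign_insert_left hiI]
      simp only [smul_mul_assoc, smul_smul]
      congr 1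
      have h4 : wedgeSign {i} K = wedgeSign {i} I * wedgeSign {i} (K \ I) := by
        simp only [wedgeSign_eq_prod, Finset.prod_singleton]
        rw [mul_comm, Finset.prod_sdiff (Finset.mem_powerset.1 hI)]
      rw [h4]
      linear_combination wedgeSign {i} I * wedgeSign I (K \ I) * wedgeSign_mul_self {i} (K \ I)
    · rw [Finset.smul_sum]
      refine Finset.sum_congr rfl fun I hI => ?_
      have hiI : i ∉ I := fun h' => h (Finset.mem_powerset.1 hI h')
      have h1 : insert i K \ I = insert i (K \ I) := Finset.insert_sdiff_of_notMem _ hiI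
      have h3 : i ∉ K \ I := by simp [h]
      rw [h1, leftDerL_apply, leftDer, if_neg h3, barL_apply, wedgeSign_insert_right h3,
        wedgeSign_singleton_comm hiI]
      simp only [smul_mul_assoc, mul_smul_comm, smul_smul]
      congr 1
      have h4 : wedgeSign {i} K = wedgeSign {i} I * wedgeSign {i} (K \ I) := by
        simp only [wedgeSign_eq_prod, Finset.prod_singleton]
        rw [mul_comm, Finset.prod_sdiff (Finset.mem_powerset.1 hI)]
      rw [h4]
      linear_combination (-1 : ℝ) ^ I.card * wedgeSign {i} (K \ I) * wedgeSign I (K \ I) *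
        wedgeSign_mul_self {i} I

/-- The parity sign in `Q_2` is what turns right derivatives into left ones, so that brackets can be
compared with the action of edges. -/
lemma rightDer_barL {d : ℕ} (i : Fin d) (x : Polyvector d) :
    rightDer i (barL d x) = -leftDerL i x := by
  funext I
  rw [Pi.neg_apply, leftDerL_apply, rightDer, leftDer]
  split_ifs with h
  · simp
  · rw [barL_apply, Finset.card_insert_of_notMem h, wedgeSign_singleton_comm h, smul_smul,
      ← neg_smul, pow_succ]
    congr 1
    have : (-1 : ℝ) ^ I.card * (-1) ^ I.card = 1 := by rw [← mul_pow]; simp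
    linear_combination (-wedgeSign {i} I) * this

/-- The wedge product as a bilinear map. -/
noncomputable def wedgeL (d : ℕ) : Polyvector d →ₗ[ℝ] Polyvector d →ₗ[ℝ] Polyvector d :=
  LinearMap.mk₂ ℝ wedge
    (fun x x' y => by funext K; simp [wedge, add_mul, Finset.sum_add_distrib])
    (fun c x y => by funext K; simp [wedge, Finset.smul_sum, smul_comm c])
    (fun x y y' => by funext K; simp [wedge, mul_add, Finset.sum_add_distrib])
    (fun c x y => by funext K; simp [wedge, Finset.smul_sum, smul_comm c])

lemma wedgeL_apply {d : ℕ} (x y : Polyvector d) : wedgeL d x y = wedge x y := rfl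

/-- The two summands are the actions of an edge from the first to the second vertex and of the
reversed edge. In the latter, the first vertex precedes the start and receives the parity sign. -/
lemma polyvectorQ_eq {d : ℕ} (x y : Polyvector d) :
    polyvectorQ x y = -∑ i : Fin d, (wedge (leftDerL i x) (coeffDerL i y) +
      wedge (coeffDerL i (barL d x)) (leftDerL i y)) := by
  change schouten (barL d x) y = _
  rw [schouten, ← Finset.sum_neg_distrib]
  refine Finset.sum_congr rfl fun i _ => ?_
  rw [rightDer_barL]
  have : wedge (-leftDerL i x) (coeffDer i y) = -wedge (leftDerL i x) (coeffDer i y) := by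
    rw [← wedgeL_apply, map_neg]; rfl
  rw [this, neg_add, sub_eq_add_neg]
  rfl

/-- The function `f` as a polyvector of degree `0`. -/
noncomputable def ofFunction (d : ℕ) : Smooth d →ₗ[ℝ] Polyvector d where
  toFun f := fun I => if I = ∅ then f else 0
  map_add' x y := by funext I; by_cases h : I = ∅ <;> simp [h]
  map_smul' c x := by funext I; by_cases h : I = ∅ <;> simp [h]

lemma ofFunction_apply {d : ℕ} (f : Smooth d) (I : Finset (Fin d)) :
    ofFunction d f I = if I = ∅ then f else 0 := rfl

lemma barL_ofFunction {d : ℕ} (f : Smooth d) : barL d (ofFunction d f) = ofFunction d f := by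
  funext I
  rw [barL_apply, ofFunction_apply]
  split_ifs with h <;> simp [h]

lemma coeffDerL_ofFunction {d : ℕ} (i : Fin d) (f : Smooth d) :
    coeffDerL i (ofFunction d f) = ofFunction d (pd i f) := by
  funext I
  change pd i (ofFunction d f I) = _
  rw [ofFunction_apply, ofFunction_apply]
  split_ifs with h <;> simp

/-! ### Amplitudes of lists of coloured edges -/

lemma IsHomogeneous.barL_eq {d k : ℕ} {x : Polyvector d} (h : IsHomogeneous k x) :
    barL d x = (-1 : ℝ) ^ k • x := by
  funext I
  rw [barL_apply, Pi.smul_apply]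
  by_cases hI : I.card = k
  · rw [hI]
  · rw [h I hI, smul_zero, smul_zero]

lemma IsHomogeneous.smul {d k : ℕ} {x : Polyvector d} (h : IsHomogeneous k x) (c : ℝ) :
    IsHomogeneous k (c • x) := fun I hI => by rw [Pi.smul_apply, h I hI, smul_zero]

lemma IsHomogeneous.coeffDerL {d k : ℕ} {x : Polyvector d} (h : IsHomogeneous k x) (i : Fin d) :
    IsHomogeneous k (coeffDerL i x) := fun I hI => by
  rw [coeffDerL_apply, coeffDer, h I hI, pd_zero]

lemma IsHomogeneous.leftDerL {d k : ℕ} {x : Polyvector d} (h : IsHomogeneous (k + 1) x)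
    (i : Fin d) : IsHomogeneous k (leftDerL i x) := fun I hI => by
  rw [leftDerL_apply, leftDer]
  split_ifs with hi
  · rfl
  · rw [h _ (by rw [Finset.card_insert_of_notMem hi]; omega), smul_zero]

lemma IsHomogeneous.leftDerL_eq_zero {d : ℕ} {x : Polyvector d} (h : IsHomogeneous 0 x)
    (i : Fin d) : Feynman.leftDerL i x = 0 := by
  funext I
  rw [leftDerL_apply, leftDer]
  split_ifs with hi
  · rfl
  · rw [h _ (by rw [Finset.card_insert_of_notMem hi]; omega), smul_zero]; rfl

lemma isHomogeneous_ofFunction {d : ℕ} (f : Smooth d) : IsHomogeneous 0 (ofFunction d f) := by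
  intro I hI
  rw [ofFunction_apply, if_neg (by rintro rfl; exact hI rfl)]

section Amplitude
variable {V : Type*} [Fintype V] [DecidableEq V] {d : ℕ}

/-- The action at the vertex `u` of an edge of colour `i` that starts at `s`. -/
noncomputable def startOp (pos : V → ℕ) (s : V) (i : Fin d) (u : V) :
    Polyvector d →ₗ[ℝ] Polyvector d :=
  if u = s then leftDerL i else if pos u < pos s then barL d else LinearMap.id

/-- The action at the vertex `u` of an edge of colour `i` that ends at `t`. -/
noncomputable def endOp (t : V) (i : Fin d) (u : V) : Polyvector d →ₗ[ℝ] Polyvector d :=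
  if u = t then coeffDerL i else LinearMap.id

/-- The action at the vertex `u` of a coloured edge `(s, t, i)`, when the vertices are ordered by
`pos`. -/
noncomputable def edgeOp (pos : V → ℕ) (e : V × V × Fin d) (u : V) :
    Polyvector d →ₗ[ℝ] Polyvector d :=
  endOp e.2.1 e.2.2 u ∘ₗ startOp pos e.1 e.2.2 u

/-- The action at the vertex `u` of a list of coloured edges. -/
noncomputable def listOp (pos : V → ℕ) : List (V × V × Fin d) → V → Polyvector d →ₗ[ℝ] Polyvector d
  | [], _ => LinearMap.id
  | e :: L, u => listOp pos L u ∘ₗ edgeOp pos e u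

/-- The amplitude of a list of coloured edges with polyvectors `φ u` at the vertices `u`, which are
ordered by `pos`. -/
noncomputable def amp (pos : V → ℕ) (L : List (V × V × Fin d)) (φ : V → Polyvector d) : Smooth d :=
  ∏ u, listOp pos L u (φ u) ∅

/-- The amplitude as a multilinear map. -/
noncomputable def ampMultilinear (pos : V → ℕ) (L : List (V × V × Fin d)) :
    MultilinearMap ℝ (fun _ : V => Polyvector d) (Smooth d) :=
  (MultilinearMap.mkPiAlgebra ℝ V (Smooth d)).compLinearMap fun u =>
    (LinearMap.proj ∅ : Polyvector d →ₗ[ℝ] Smooth d) ∘ₗ listOp pos L u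

lemma ampMultilinear_apply (pos : V → ℕ) (L : List (V × V × Fin d)) (φ : V → Polyvector d) :
    ampMultilinear pos L φ = amp pos L φ := by
  simp [ampMultilinear, amp]

lemma amp_cons (pos : V → ℕ) (e : V × V × Fin d) (L : List (V × V × Fin d))
    (φ : V → Polyvector d) : amp pos (e :: L) φ = amp pos L fun u => edgeOp pos e u (φ u) := rfl

omit [Fintype V] in
lemma listOp_append (pos : V → ℕ) (L L' : List (V × V × Fin d)) (u : V) :
    listOp pos (L ++ L') u = listOp pos L' u ∘ₗ listOp pos L u := by
  induction L with
  | nil => rfl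
  | cons e L ih => rw [List.cons_append, listOp, ih]; rfl

lemma amp_append (pos : V → ℕ) (L L' : List (V × V × Fin d)) (φ : V → Polyvector d) :
    amp pos (L ++ L') φ = amp pos L' fun u => listOp pos L u (φ u) := by
  simp only [amp, listOp_append]; rfl

lemma amp_smul (pos : V → ℕ) (L : List (V × V × Fin d)) (c : V → ℝ) (φ : V → Polyvector d) :
    amp pos L (fun u => c u • φ u) = (∏ u, c u) • amp pos L φ := by
  rw [← ampMultilinear_apply, ← ampMultilinear_apply, MultilinearMap.map_smul_univ]

lemma amp_eq_zero (pos : V → ℕ) (L : List (V × V × Fin d)) {φ : V → Polyvector d} (u : V)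
    (h : φ u = 0) : amp pos L φ = 0 :=
  Finset.prod_eq_zero (Finset.mem_univ u) (by rw [h, map_zero]; rfl)

lemma amp_update_sum {ι : Type*} (pos : V → ℕ) (L : List (V × V × Fin d)) (φ : V → Polyvector d)
    (u : V) (s : Finset ι) (x : ι → Polyvector d) :
    amp pos L (Function.update φ u (∑ i ∈ s, x i)) =
      ∑ i ∈ s, amp pos L (Function.update φ u (x i)) := by
  simp only [← ampMultilinear_apply]
  exact MultilinearMap.map_update_sum _ _ _ _ _

lemma amp_update_smul (pos : V → ℕ) (L : List (V × V × Fin d)) (φ : V → Polyvector d)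
    (u : V) (c : ℝ) (x : Polyvector d) :
    amp pos L (Function.update φ u (c • x)) = c • amp pos L (Function.update φ u x) := by
  simp only [← ampMultilinear_apply]
  exact MultilinearMap.map_update_smul _ _ _ _ _

omit [Fintype V] in
lemma endOp_startOp (pos : V → ℕ) (s t : V) (i j : Fin d) (u : V) (x : Polyvector d) :
    endOp t i u (startOp pos s j u x) = startOp pos s j u (endOp t i u x) := by
  simp only [endOp, startOp]
  split_ifs <;> simp [coeffDerL_barL, coeffDerL_leftDerL]

omit [Fintype V] in
lemma endOp_endOp (t t' : V) (i j : Fin d) (u : V) (x : Polyvector d) :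
    endOp t i u (endOp t' j u x) = endOp t' j u (endOp t i u x) := by
  simp only [endOp]
  split_ifs <;> simp [coeffDerL_comm i j]

omit [Fintype V] in
-- Two edges anticommute because exactly one vertex produces a sign: the earlier of the two starting
-- points. If they coincide, two odd derivatives meet there; otherwise an odd derivative meets the
-- parity operator of the later edge.
lemma startOp_startOp {pos : V → ℕ} (hpos : Function.Injective pos) (s s' : V) (i j : Fin d) (u : V)
    (x : Polyvector d) : startOp pos s i u (startOp pos s' j u x) =
      (if u = (if pos s < pos s' then s else s') then (-1 : ℝ) else 1) •
        startOp pos s' j u (startOp pos s i u x) := by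
  have hs : pos s = pos s' → s = s' := fun h => hpos h
  rcases lt_trichotomy (pos s) (pos s') with h | h | h
  · have hne : s ≠ s' := by rintro rfl; exact lt_irrefl _ h
    by_cases h1 : u = s
    · subst h1
      simp only [startOp, h, hne, leftDerL_barL, if_true, if_false]
      exact (neg_one_smul ℝ _).symm
    · by_cases h2 : u = s'
      · subst h2; simp [startOp, h1, h, not_lt_of_gt h]
      · simp only [startOp, h1, h2, h, if_true, if_false, one_smul]
        split_ifs <;> simp
  · have := hs h
    subst this
    by_cases h1 : u = s
    · subst h1
      simp only [startOp, leftDerL_leftDerL i j, lt_irrefl, if_true, if_false]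
      exact (neg_one_smul ℝ _).symm
    · simp [startOp, h1]
  · have hne : s ≠ s' := by rintro rfl; exact lt_irrefl _ h
    by_cases h1 : u = s'
    · subst h1
      simp only [startOp, h, not_lt_of_gt h, Ne.symm hne, leftDerL_barL, if_true, if_false]
      refine Eq.trans ?_ (neg_one_smul ℝ (-barL d (leftDerL j x))).symm
      rw [neg_neg]
    · by_cases h2 : u = s
      · subst h2; simp [startOp, h1, not_lt_of_gt h]
      · simp only [startOp, h1, h2, if_false, not_lt_of_gt h, one_smul]
        split_ifs <;> simp

omit [Fintype V] in
lemma edgeOp_endOp (pos : V → ℕ) (e : V × V × Fin d) (t : V) (i : Fin d) (u : V)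
    (x : Polyvector d) : edgeOp pos e u (endOp t i u x) = endOp t i u (edgeOp pos e u x) := by
  simp only [edgeOp, LinearMap.comp_apply, endOp_endOp t, ← endOp_startOp]

omit [Fintype V] in
lemma listOp_endOp (pos : V → ℕ) (L : List (V × V × Fin d)) (t : V) (i : Fin d) (u : V)
    (x : Polyvector d) : listOp pos L u (endOp t i u x) = endOp t i u (listOp pos L u x) := by
  induction L generalizing x with
  | nil => rfl
  | cons e L ih => simp only [listOp, LinearMap.comp_apply, edgeOp_endOp, ih]

/-- By `startOp_startOp` the exchange of two neighbouring edges costs a sign at one vertex only, and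
the amplitude is multilinear in the fields at the vertices. -/
lemma isAlt_amp {pos : V → ℕ} (hpos : Function.Injective pos) (φ : V → Polyvector d) :
    IsAlt fun L => amp pos L φ := by
  intro L L' a b
  simp only [amp_append, amp_cons]
  have : ∀ u x, edgeOp pos b u (edgeOp pos a u x) =
      (if u = (if pos b.1 < pos a.1 then b.1 else a.1) then (-1 : ℝ) else 1) •
        edgeOp pos a u (edgeOp pos b u x) := by
    intro u x
    simp only [edgeOp, LinearMap.comp_apply]
    rw [← endOp_startOp, endOp_endOp, startOp_startOp hpos, map_smul, map_smul, ← endOp_startOp]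
  simp only [this]
  rw [amp_smul, Finset.prod_ite_eq' Finset.univ _ (fun _ => (-1 : ℝ))]
  simp

/-- The Leibniz rule for the product over the vertices; coefficient derivatives commute with all
edge operators, so they can be applied to the fields first. -/
lemma pd_amp (pos : V → ℕ) (L : List (V × V × Fin d)) (i : Fin d) (φ : V → Polyvector d) :
    pd i (amp pos L φ) = ∑ t, amp pos L fun u => endOp t i u (φ u) := by
  simp only [amp, pd_prod, listOp_endOp]
  refine Finset.sum_congr rfl fun t _ => Finset.prod_congr rfl fun u _ => ?_
  simp only [endOp]
  split_ifs <;> rfl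

/-! ### Change of the order of the vertices -/

/-- The Koszul sign of passing from the order `pos` to the order `pos'`. -/
def reorderSign (pos pos' : V → ℕ) (k : V → ℕ) : ℝ :=
  ∏ u, ∏ v, if pos u < pos v ∧ pos' v < pos' u then (-1) ^ (k u * k v) else 1

omit [DecidableEq V] in
lemma reorderSign_eq_pow (pos pos' : V → ℕ) (k : V → ℕ) : reorderSign pos pos' k =
    (-1) ^ ∑ u, ∑ v, if pos u < pos v ∧ pos' v < pos' u then k u * k v else 0 := by
  simp only [reorderSign, ← Finset.prod_pow_eq_pow_sum]
  refine Finset.prod_congr rfl fun u _ => Finset.prod_congr rfl fun v _ => ?_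
  split_ifs <;> simp

/-- Raising the degree at `s` by one adds `k u` to the exponent for every `u` whose order relative
to `s` is reversed. -/
lemma reorderSign_add_single (pos pos' : V → ℕ) (k : V → ℕ) (s : V) :
    reorderSign pos pos' (k + Pi.single s 1) =
      (∏ u, if (pos u < pos s ∧ pos' s < pos' u) ∨ (pos s < pos u ∧ pos' u < pos' s)
        then (-1) ^ k u else 1) * reorderSign pos pos' k := by
  have h1 : (∏ u, if (pos u < pos s ∧ pos' s < pos' u) ∨ (pos s < pos u ∧ pos' u < pos' s)
        then (-1 : ℝ) ^ k u else 1) = (-1) ^ ((∑ u, if pos u < pos s ∧ pos' s < pos' u then k u else 0)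
          + ∑ u, if pos s < pos u ∧ pos' u < pos' s then k u else 0) := by
    rw [← Finset.sum_add_distrib, ← Finset.prod_pow_eq_pow_sum]
    refine Finset.prod_congr rfl fun u _ => ?_
    by_cases h : pos u < pos s ∧ pos' s < pos' u
    · have : ¬(pos s < pos u ∧ pos' u < pos' s) := by omega
      simp [h, this]
    · by_cases h' : pos s < pos u ∧ pos' u < pos' s <;> simp [h, h']
  rw [h1, reorderSign_eq_pow, reorderSign_eq_pow, ← pow_add]
  congr 1
  have h2 : ∀ u v, (if pos u < pos v ∧ pos' v < pos' u then
      (k + Pi.single s 1 : V → ℕ) u * (k + Pi.single s 1 : V → ℕ) v else 0) =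
      (if v = s then (if pos u < pos s ∧ pos' s < pos' u then k u else 0) else 0) +
      (if u = s then (if pos s < pos v ∧ pos' v < pos' s then k v else 0) else 0) +
      (if pos u < pos v ∧ pos' v < pos' u then k u * k v else 0) := by
    intro u v
    simp only [Pi.add_apply, Pi.single_apply]
    by_cases hu : u = s <;> by_cases hv : v = s
    · subst hu; subst hv; simp
    · subst hu; simp only [if_true, hv, if_false]; split_ifs <;> ring
    · subst hv; simp only [if_true, hu, if_false]; split_ifs <;> ring
    · simp [hu, hv]
  simp only [h2, Finset.sum_add_distrib, Finset.sum_ite_eq', Finset.mem_univ, if_true]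
  congr 1
  congr 1
  rw [Finset.sum_comm]
  simp

/-- Induction on the edges. An edge starting at `s` lowers the degree at `s` by one, and its parity
operators in the two orders differ at the vertices whose position relative to `s` changes; this is
the factor in `reorderSign_add_single`. If the degree at `s` is `0`, both sides vanish. Without
edges, only fields that are all of degree `0` have a nonzero amplitude, and then there is no sign.
-/
lemma amp_reorder {pos pos' : V → ℕ} (hpos : Function.Injective pos)
    (hpos' : Function.Injective pos') (L : List (V × V × Fin d)) (k : V → ℕ)
    (φ : V → Polyvector d) (hφ : ∀ u, IsHomogeneous (k u) (φ u)) :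
    amp pos L φ = reorderSign pos pos' k • amp pos' L φ := by
  induction L generalizing k φ with
  | nil =>
    by_cases hk : ∀ u, k u = 0
    · have : reorderSign pos pos' k = 1 := by simp [reorderSign, hk]
      rw [this, one_smul]; rfl
    · push Not at hk
      obtain ⟨u, hu⟩ := hk
      have h0 : φ u ∅ = 0 := hφ u ∅ (by simpa using hu.symm)
      have : ∀ pos : V → ℕ, amp pos [] φ = 0 := fun pos =>
        Finset.prod_eq_zero (Finset.mem_univ u) h0
      rw [this, this, smul_zero]
  | cons e L ih =>
    obtain ⟨s, t, i⟩ := e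
    rw [amp_cons, amp_cons]
    by_cases hs : k s = 0
    · have h0 : ∀ pos : V → ℕ, edgeOp pos (s, t, i) s (φ s) = 0 := by
        intro pos
        have := hφ s
        rw [hs] at this
        simp [edgeOp, startOp, this.leftDerL_eq_zero]
      rw [amp_eq_zero pos L s (h0 pos), amp_eq_zero pos' L s (h0 pos'), smul_zero]
    · obtain ⟨k', rfl⟩ : ∃ k' : V → ℕ, k = k' + Pi.single s 1 := by
        refine ⟨k - Pi.single s 1, ?_⟩
        funext u
        by_cases hu : u = s
        · subst hu; simp; omega
        · simp [hu]
      have hom : ∀ u, IsHomogeneous (k' u) (edgeOp pos' (s, t, i) u (φ u)) := by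
        intro u
        have h1 : IsHomogeneous (k' u) (startOp pos' s i u (φ u)) := by
          by_cases hu : u = s
          · subst hu
            have := hφ u
            simp only [Pi.add_apply, Pi.single_eq_same] at this
            simpa [startOp] using this.leftDerL i
          · have := hφ u
            simp only [Pi.add_apply, Pi.single_eq_of_ne hu, add_zero] at this
            simp only [startOp, hu, if_false]
            split_ifs
            · rw [this.barL_eq]; exact this.smul _
            · exact this
        simp only [edgeOp, endOp, LinearMap.comp_apply]
        split_ifs
        · exact h1.coeffDerL i
        · exact h1
      have hc : ∀ u, edgeOp pos (s, t, i) u (φ u) =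
          (if (pos u < pos s ∧ pos' s < pos' u) ∨ (pos s < pos u ∧ pos' u < pos' s)
            then (-1 : ℝ) ^ k' u else 1) • edgeOp pos' (s, t, i) u (φ u) := by
        intro u
        simp only [edgeOp, LinearMap.comp_apply]
        rw [← map_smul]
        congr 1
        by_cases hu : u = s
        · subst hu; simp [startOp]
        · have h1 : pos u ≠ pos s := fun h => hu (hpos h)
          have h2 : pos' u ≠ pos' s := fun h => hu (hpos' h)
          have := hφ u
          simp only [Pi.add_apply, Pi.single_eq_of_ne hu, add_zero] at this
          simp only [startOp, hu, if_false]
          by_cases h3 : pos u < pos s <;> by_cases h4 : pos' u < pos' s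
          · simp [h3, h4, not_lt_of_gt h3, not_lt_of_gt h4]
          · have : pos' s < pos' u := by omega
            simp [h3, h4, this, IsHomogeneous.barL_eq ‹_›]
          · have h5 : pos s < pos u := by omega
            have h6 : (-1 : ℝ) ^ k' u * (-1) ^ k' u = 1 := by rw [← mul_pow]; simp
            simp [h3, h4, h5, this.barL_eq, smul_smul, h6]
          · have : pos' s < pos' u := by omega
            simp [h3, h4]
      simp only [hc]
      rw [amp_smul, ih k' _ hom, smul_smul, reorderSign_add_single]

/-! ### Relabelling of the vertices -/

omit [Fintype V] in
lemma listOp_congr {pos pos' : V → ℕ} (h : ∀ u v, pos u < pos v ↔ pos' u < pos' v)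
    (L : List (V × V × Fin d)) (u : V) : listOp pos L u = listOp pos' L u := by
  induction L with
  | nil => rfl
  | cons e L ih => simp only [listOp, ih, edgeOp, startOp, h]

lemma amp_congr_pos {pos pos' : V → ℕ} (h : ∀ u v, pos u < pos v ↔ pos' u < pos' v)
    (L : List (V × V × Fin d)) (φ : V → Polyvector d) : amp pos L φ = amp pos' L φ := by
  simp only [amp, listOp_congr h]

/-- The image of a coloured edge under a map of vertices. -/
def mapEdge {V V' C : Type*} (e : V → V') (x : V × V × C) : V' × V' × C := (e x.1, e x.2.1, x.2.2)

lemma amp_map {V' : Type*} [Fintype V'] [DecidableEq V'] (e : V ≃ V') (pos : V' → ℕ)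
    (L : List (V × V × Fin d)) (φ : V' → Polyvector d) :
    amp pos (L.map (mapEdge e)) φ = amp (fun u => pos (e u)) L fun u => φ (e u) := by
  have : ∀ u, listOp pos (L.map (mapEdge e)) (e u) = listOp (fun u => pos (e u)) L u := by
    intro u
    induction L with
    | nil => rfl
    | cons a L ih => simp [listOp, ih, edgeOp, startOp, endOp, mapEdge]
  rw [amp, ← e.prod_comp]
  simp only [this, amp]

end Amplitude

/-! ### Collapsing vertices to a function -/

section Collapse
variable {V₁ V₂ : Type*} [Fintype V₁] [DecidableEq V₁] [Fintype V₂] [DecidableEq V₂] {d : ℕ}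

/-- The map that identifies the vertices in `V₂`. -/
def collapseMap (v : V₁ ⊕ V₂) : Option V₁ := v.elim some fun _ => none

/-- The lifts to `V₁ ⊕ V₂` of an edge that starts in `V₁`. -/
def collapseFiber (y : V₁ × Option V₁ × Fin d) : Finset (V₁ × (V₁ ⊕ V₂) × Fin d) :=
  Finset.univ.filter fun x => (x.1, collapseMap x.2.1, x.2.2) = y

omit [DecidableEq V₂] in
lemma sum_collapseFiber_some {M : Type*} [AddCommMonoid M] (s u : V₁) (i : Fin d)
    (h : V₁ × (V₁ ⊕ V₂) × Fin d → M) :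
    ∑ x ∈ collapseFiber (V₂ := V₂) (s, some u, i), h x = h (s, Sum.inl u, i) := by
  have : collapseFiber (V₂ := V₂) (s, some u, i) = {(s, Sum.inl u, i)} := by
    ext ⟨a, b, c⟩
    cases b <;> simp [collapseFiber, collapseMap]
  rw [this, Finset.sum_singleton]

lemma sum_collapseFiber_none {M : Type*} [AddCommMonoid M] (s : V₁) (i : Fin d)
    (h : V₁ × (V₁ ⊕ V₂) × Fin d → M) :
    ∑ x ∈ collapseFiber (V₂ := V₂) (s, none, i), h x = ∑ v : V₂, h (s, Sum.inr v, i) := by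
  have : collapseFiber (V₂ := V₂) (s, none, i) =
      (Finset.univ : Finset V₂).image fun v => (s, Sum.inr v, i) := by
    ext ⟨a, b, c⟩
    cases b <;> simp [collapseFiber, collapseMap, Prod.ext_iff, eq_comm]
  rw [this, Finset.sum_image]
  intro v _ v' _ h
  simpa using h

omit [Fintype V₁] [Fintype V₂] in
-- Inner edges can act on an outer vertex only by parity operators, which are invisible on the
-- coefficient of `ψ_∅`.
lemma listOp_map_inr_inl_apply_empty (pos : V₁ ⊕ V₂ → ℕ) (L : List (V₂ × V₂ × Fin d)) (u : V₁)
    (x : Polyvector d) :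
    listOp pos (L.map (mapEdge Sum.inr)) (Sum.inl u) x ∅ = x ∅ := by
  induction L generalizing x with
  | nil => rfl
  | cons e L ih =>
    simp only [List.map_cons, listOp, LinearMap.comp_apply, ih, edgeOp, endOp, startOp, mapEdge]
    simp only [reduceCtorEq, if_false]
    split_ifs <;> simp [barL_apply]

omit [Fintype V₁] [Fintype V₂] in
lemma listOp_map_inr_inr (pos : V₁ ⊕ V₂ → ℕ) (L : List (V₂ × V₂ × Fin d)) (v : V₂) :
    listOp pos (L.map (mapEdge Sum.inr)) (Sum.inr v) = listOp (fun v => pos (Sum.inr v)) L v := by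
  induction L with
  | nil => rfl
  | cons e L ih => simp [listOp, ih, edgeOp, startOp, endOp, mapEdge]

/-- An amplitude in which one argument is an amplitude is the sum over the graphs in which the edges
ending at this argument are distributed over the vertices of the inner graph. -/
lemma liftSum_amp_collapse {pos : V₁ ⊕ V₂ → ℕ} {pos' : Option V₁ → ℕ}
    (h12 : ∀ u v, pos (Sum.inl u) < pos (Sum.inr v))
    (h' : ∀ u v, pos' (some u) < pos' (some v) ↔ pos (Sum.inl u) < pos (Sum.inl v))
    (L₁ : List (V₁ × Option V₁ × Fin d)) (L₂ : List (V₂ × V₂ × Fin d))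
    (φ : V₁ ⊕ V₂ → Polyvector d) :
    liftSum collapseFiber (fun L => amp pos
        (L.map (fun x => (Sum.inl x.1, x.2.1, x.2.2)) ++ L₂.map (mapEdge Sum.inr)) φ) L₁ =
      amp pos' (L₁.map fun x => (some x.1, x.2.1, x.2.2)) fun o =>
        o.elim (ofFunction d (amp (fun v => pos (Sum.inr v)) L₂ fun v => φ (Sum.inr v)))
          fun u => φ (Sum.inl u) := by
  induction L₁ generalizing φ with
  | nil =>
    simp only [liftSum, List.map_nil, List.nil_append]
    rw [amp, Fintype.prod_sum_type]
    simp only [listOp_map_inr_inl_apply_empty, listOp_map_inr_inr]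
    rw [amp, Fintype.prod_option, mul_comm]
    simp only [listOp, LinearMap.id_apply, Option.elim, ofFunction_apply, if_true]
    rfl
  | cons y L₁ ih =>
    obtain ⟨s, t, i⟩ := y
    simp only [liftSum, List.map_cons, List.cons_append, amp_cons, ih]
    -- The inner vertices come after all outer ones, so the start of an outer edge leaves them
    -- alone. Likewise the collapsed vertex carries a function, which is even (`hn`), wherever it
    -- stands in the order `pos'`.
    have hs : ∀ v x, startOp pos (Sum.inl s) i (Sum.inr v) x = x := by
      intro v x
      simp [startOp, not_lt_of_gt (h12 s v)]
    have hs' : ∀ u, startOp pos (Sum.inl s) i (Sum.inl u) = startOp pos' (some s) i (some u) := by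
      intro u
      simp [startOp, h']
    have hn : ∀ f, startOp pos' (some s) i none (ofFunction d f) = ofFunction d f := by
      intro f
      simp only [startOp, reduceCtorEq, if_false]
      split_ifs
      · exact barL_ofFunction f
      · rfl
    cases t with
    | some u =>
      rw [sum_collapseFiber_some]
      congr 1
      funext o
      cases o with
      | none => simp [edgeOp, hs, hn, endOp]
      | some v => simp [edgeOp, hs', endOp]
    | none =>
      -- An edge ending at the collapsed vertex differentiates the inner amplitude; by `pd_amp` this
      -- is a sum over the inner vertices, i.e. over the lifts of the edge.
      rw [sum_collapseFiber_none]
      set ψ : Option V₁ → Polyvector d := fun o =>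
        o.elim 0 fun u => startOp pos' (some s) i (some u) (φ (Sum.inl u)) with hψ
      have e1 : ∀ v : V₂, (fun o : Option V₁ => o.elim (ofFunction d (amp (fun v => pos (Sum.inr v)) L₂
          fun v' => edgeOp pos (Sum.inl s, Sum.inr v, i) (Sum.inr v') (φ (Sum.inr v'))))
          fun u => edgeOp pos (Sum.inl s, Sum.inr v, i) (Sum.inl u) (φ (Sum.inl u))) =
          Function.update ψ none (ofFunction d (amp (fun v => pos (Sum.inr v)) L₂
          fun v' => endOp v i v' (φ (Sum.inr v')))) := by
        intro v
        funext o
        cases o with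
        | none => simp [edgeOp, hs, endOp]
        | some w => simp [hψ, edgeOp, hs', endOp]
      have e2 : (fun o : Option V₁ => edgeOp pos' (some s, none, i) o (o.elim (ofFunction d
          (amp (fun v => pos (Sum.inr v)) L₂ fun v => φ (Sum.inr v))) fun u => φ (Sum.inl u))) =
          Function.update ψ none (∑ v : V₂, ofFunction d (amp (fun v => pos (Sum.inr v)) L₂
          fun v' => endOp v i v' (φ (Sum.inr v')))) := by
        funext o
        cases o with
        | none => simp [edgeOp, hn, endOp, coeffDerL_ofFunction, pd_amp]
        | some w => simp [hψ, edgeOp, endOp]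
      simp only [e1]
      rw [e2, amp_update_sum]

end Collapse

/-! ### Merging two vertices -/

section Merge
variable {R : Type*} [Fintype R] [DecidableEq R] {d : ℕ}

/-- The map that identifies the first two vertices. -/
def mergeMap : Option (Option R) → Option R
  | none => none
  | some o => o

/-- The lifts of an edge to the graphs in which the first vertex is replaced by two vertices. -/
def mergeFiber (y : Option R × Option R × Fin d) :
    Finset (Option (Option R) × Option (Option R) × Fin d) :=
  Finset.univ.filter fun x => mapEdge mergeMap x = y

lemma sum_mergeFiber {M : Type*} [AddCommMonoid M] (s t : Option R) (i : Fin d)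
    (h : Option (Option R) × Option (Option R) × Fin d → M) :
    ∑ x ∈ mergeFiber (s, t, i), h x =
      ∑ s' with mergeMap s' = s, ∑ t' with mergeMap t' = t, h (s', t', i) := by
  rw [← Finset.sum_product']
  refine Finset.sum_bij' (fun x _ => (x.1, x.2.1)) (fun x _ => (x.1, x.2, i)) ?_ ?_ ?_ ?_ ?_
  · rintro ⟨a, b, c⟩ hx
    simp [mergeFiber, mapEdge] at hx ⊢
    exact ⟨hx.1, hx.2.1⟩
  · rintro ⟨a, b⟩ hx
    simp [mergeFiber, mapEdge] at hx ⊢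
    exact hx
  · rintro ⟨a, b, c⟩ hx
    simp [mergeFiber, mapEdge] at hx ⊢
    exact hx.2.2.symm
  · intros; rfl
  · rintro ⟨a, b, c⟩ hx
    simp [mergeFiber, mapEdge] at hx ⊢
    rw [hx.2.2]

lemma sum_mergeMap_none {M : Type*} [AddCommMonoid M] (h : Option (Option R) → M) :
    ∑ s with mergeMap s = none, h s = h none + h (some none) := by
  have : (Finset.univ.filter fun s : Option (Option R) => mergeMap s = none) =
      {none, some none} := by
    ext s
    rw [Finset.mem_filter]
    rcases s with _ | _ | s <;> simp [mergeMap]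
  rw [this, Finset.sum_pair (by simp)]

lemma sum_mergeMap_some {M : Type*} [AddCommMonoid M] (r : R) (h : Option (Option R) → M) :
    ∑ s with mergeMap s = some r, h s = h (some (some r)) := by
  have : (Finset.univ.filter fun s : Option (Option R) => mergeMap s = some r) =
      {some (some r)} := by
    ext s
    rw [Finset.mem_filter]
    rcases s with _ | _ | s <;> simp [mergeMap]
  rw [this, Finset.sum_singleton]

/-- An amplitude with a wedge product at the first vertex is a sum over the graphs in which this vertex
is replaced by two vertices. -/
lemma liftSum_amp_merge {pos : Option (Option R) → ℕ} {pos' : Option R → ℕ}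
    (h01 : pos none < pos (some none)) (h1 : ∀ r, pos (some none) < pos (some (some r)))
    (h0' : ∀ r, pos' none < pos' (some r))
    (h' : ∀ r r', pos' (some r) < pos' (some r') ↔ pos (some (some r)) < pos (some (some r')))
    (L : List (Option R × Option R × Fin d)) (φ : Option (Option R) → Polyvector d) :
    liftSum mergeFiber (fun L => amp pos L φ) L =
      amp pos' L fun o => o.elim (wedge (φ none) (φ (some none))) fun r => φ (some (some r)) := by
  induction L generalizing φ with
  | nil =>
    simp only [liftSum]
    rw [amp, Fintype.prod_option, Fintype.prod_option, amp, Fintype.prod_option, ← mul_assoc]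
    simp only [listOp, LinearMap.id_apply, Option.elim]
    congr 1
    simp [wedge, wedgeSign]
  | cons y L ih =>
    obtain ⟨s, t, i⟩ := y
    simp only [liftSum, amp_cons, ih, sum_mergeFiber]
    -- This is the graded Leibniz rule. Its parity sign on the first factor is the one that an edge
    -- starting at the second vertex puts on the first vertex, since the two are adjacent in the
    -- order.
    have hstart : ∀ x y, ∑ s' with mergeMap s' = s,
        wedge (startOp pos s' i none x) (startOp pos s' i (some none) y) =
          startOp pos' s i none (wedge x y) := by
      intro x y
      cases s with
      | none =>
        rw [sum_mergeMap_none]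
        simp [startOp, h01, not_lt_of_gt h01, leftDerL_wedge]
      | some r =>
        rw [sum_mergeMap_some]
        simp [startOp, h1, h0', h01.trans (h1 r), barL_wedge]
    have hend : ∀ x y, ∑ t' with mergeMap t' = t,
        wedge (endOp t' i none x) (endOp t' i (some none) y) = endOp t i none (wedge x y) := by
      intro x y
      cases t with
      | none =>
        rw [sum_mergeMap_none]
        simp [endOp, coeffDerL_wedge]
      | some r =>
        rw [sum_mergeMap_some]
        simp [endOp]
    have hrest : ∀ s' t', mergeMap s' = s → mergeMap t' = t → ∀ r,
        edgeOp pos (s', t', i) (some (some r)) = edgeOp pos' (s, t, i) (some r) := by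
      rintro s' t' rfl rfl r
      have e1 : endOp t' i (some (some r)) = endOp (mergeMap t') i (some r) := by
        rcases t' with _ | _ | t' <;> simp [endOp, mergeMap]
      have e2 : startOp pos s' i (some (some r)) = startOp pos' (mergeMap s') i (some r) := by
        rcases s' with _ | _ | s'
        · simp [startOp, mergeMap, not_lt_of_gt (h01.trans (h1 r)), not_lt_of_gt (h0' r)]
        · simp [startOp, mergeMap, not_lt_of_gt (h1 r), not_lt_of_gt (h0' r)]
        · simp [startOp, mergeMap, h']
      rw [edgeOp, edgeOp, e1, e2]
    set ψ : Option R → Polyvector d := fun o =>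
      o.elim 0 fun r => edgeOp pos' (s, t, i) (some r) (φ (some (some r))) with hψ
    have e1 : ∀ s' t', mergeMap s' = s → mergeMap t' = t →
        (fun o : Option R => o.elim (wedge (edgeOp pos (s', t', i) none (φ none))
          (edgeOp pos (s', t', i) (some none) (φ (some none)))) fun r =>
            edgeOp pos (s', t', i) (some (some r)) (φ (some (some r)))) =
          Function.update ψ none (wedge (edgeOp pos (s', t', i) none (φ none))
          (edgeOp pos (s', t', i) (some none) (φ (some none)))) := by
      intro s' t' hs' ht'
      funext o
      cases o with
      | none => simp
      | some r => simp [hψ, hrest s' t' hs' ht' r]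
    have e2 : (fun o : Option R => edgeOp pos' (s, t, i) o (o.elim (wedge (φ none) (φ (some none)))
        fun r => φ (some (some r)))) = Function.update ψ none
          (∑ s' with mergeMap s' = s, ∑ t' with mergeMap t' = t,
            wedge (edgeOp pos (s', t', i) none (φ none))
              (edgeOp pos (s', t', i) (some none) (φ (some none)))) := by
      funext o
      cases o with
      | none =>
        simp only [edgeOp, LinearMap.comp_apply, hend, Option.elim, Function.update_self]
        rw [← hstart, map_sum]
      | some r => simp [hψ]
    rw [e2, amp_update_sum]
    refine Finset.sum_congr rfl fun s' hs' => ?_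
    rw [amp_update_sum]
    refine Finset.sum_congr rfl fun t' ht' => ?_
    rw [e1 s' t' (Finset.mem_filter.1 hs').2 (Finset.mem_filter.1 ht').2]

end Merge

/-! ### State sums as sums of amplitudes -/

lemma pairCount_map {X Y : Type*} (f : X → Y) (r : Y → Y → Prop) [DecidableRel r] (l : List X) :
    pairCount r (l.map f) = pairCount (fun a b => r (f a) (f b)) l := by
  induction l with
  | nil => rfl
  | cons x l ih => simp only [List.map_cons, pairCount, ih, List.countP_map]; rfl

lemma pairing_eq {d : ℕ} (γ : Polyvector d) (is : List (Fin d)) :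
    pairing γ is =
      if is.Nodup then (-1 : ℝ) ^ pairCount (fun a b => b < a) is • γ is.toFinset else 0 := by
  rw [pairing, card_pairs_eq_pairCount (fun a b => b < a) is]

lemma pairing_nil {d : ℕ} (γ : Polyvector d) : pairing γ [] = γ ∅ := by
  simp [pairing_eq, pairCount]

lemma pairing_cons {d : ℕ} (γ : Polyvector d) (i : Fin d) (is : List (Fin d)) :
    pairing γ (i :: is) = pairing (leftDerL i γ) is := by
  rw [pairing_eq, pairing_eq, leftDerL_apply, leftDer]
  by_cases hi : i ∈ is
  · simp [hi]
  by_cases hn : is.Nodup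
  · have hi' : i ∉ is.toFinset := by simpa using hi
    rw [if_pos (List.nodup_cons.2 ⟨hi, hn⟩), if_pos hn, if_neg hi', List.toFinset_cons, smul_smul,
      pairCount, pow_add, mul_comm]
    congr 2
    rw [wedgeSign_eq_prod, Finset.prod_singleton, List.prod_toFinset _ hn]
    clear hi hn hi'
    induction is with
    | nil => simp
    | cons j is ih =>
      rw [List.countP_cons, List.map_cons, List.prod_cons, pow_add, ih, mul_comm]
      by_cases h : j < i <;> simp [h]
  · rw [if_neg fun h => hn (List.nodup_cons.1 h).2, if_neg hn]

lemma pairing_barL {d : ℕ} (γ : Polyvector d) (is : List (Fin d)) :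
    pairing (barL d γ) is = (-1 : ℝ) ^ is.length • pairing γ is := by
  rw [pairing_eq, pairing_eq]
  split_ifs with h
  · rw [barL_apply, List.toFinset_card_of_nodup h, smul_comm]
  · rw [smul_zero]

lemma pairing_coeffDerL {d : ℕ} (i : Fin d) (γ : Polyvector d) (is : List (Fin d)) :
    pairing (coeffDerL i γ) is = pd i (pairing γ is) := by
  rw [pairing_eq, pairing_eq]
  split_ifs with h
  · rw [pd_smul]; rfl
  · rw [pd_zero]

section
variable {V : Type*} [DecidableEq V] {d : ℕ}

/-- The colours of the edges that start at `u`. -/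
def startColours (L : List (V × V × Fin d)) (u : V) : List (Fin d) :=
  (L.filter fun e => e.1 = u).map fun e => e.2.2

/-- The colours of the edges that end at `u`. -/
def endColours (L : List (V × V × Fin d)) (u : V) : List (Fin d) :=
  (L.filter fun e => e.2.1 = u).map fun e => e.2.2

/-- Each odd derivative at `u` strips the first colour off the pairing. A parity operator, from an
edge starting later than `u`, counts the edges further down the list that start at `u`. -/
lemma listOp_apply_empty (pos : V → ℕ) (L : List (V × V × Fin d)) (u : V) (x : Polyvector d) :
    listOp pos L u x ∅ = (-1 : ℝ) ^ pairCount (fun a b => pos u < pos a.1 ∧ b.1 = u) L •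
      pdList (endColours L u) (pairing x (startColours L u)) := by
  induction L generalizing x with
  | nil => simp [listOp, pairCount, endColours, startColours, pdList, pairing_nil]
  | cons e L ih =>
    obtain ⟨s, t, i⟩ := e
    have h1 : ∀ y : Polyvector d, pdList (endColours L u) (pairing (endOp t i u y) (startColours L u)) =
        pdList (endColours ((s, t, i) :: L) u) (pairing y (startColours L u)) := by
      intro y
      by_cases h : u = t
      · subst h
        simp [endOp, endColours, pairing_coeffDerL, pdList_pd, pdList_cons]
      · simp [endOp, endColours, h, Ne.symm h]
    have h2 : pairing (startOp pos s i u x) (startColours L u) =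
        (-1 : ℝ) ^ (L.countP fun b => pos u < pos s ∧ b.1 = u) •
          pairing x (startColours ((s, t, i) :: L) u) := by
      by_cases h : u = s
      · subst h
        simp [startOp, startColours, pairing_cons]
      · by_cases h' : pos u < pos s
        · have : (startColours L u).length = L.countP fun b => b.1 = u := by
            rw [startColours, List.length_map, ← List.countP_eq_length_filter]
          simp only [startOp, h, h', if_true, if_false, pairing_barL, this, true_and]
          simp [startColours, Ne.symm h]
        · simp [startOp, h, h', startColours, Ne.symm h]
    simp only [listOp, edgeOp, LinearMap.comp_apply, ih, h1, h2]
    rw [← pdListLinear_apply, map_smul, smul_smul, pairCount, pow_add, mul_comm]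
    rfl

/-- Each inversion of starting points is counted at the starting point of its second edge, so the
local signs multiply to the sign of sorting the edges. -/
lemma sum_pairCount [Fintype V] (pos : V → ℕ) (L : List (V × V × Fin d)) :
    ∑ u, pairCount (fun a b : V × V × Fin d => pos u < pos a.1 ∧ b.1 = u) L =
      pairCount (fun a b => pos b.1 < pos a.1) L := by
  induction L with
  | nil => simp [pairCount]
  | cons e L ih =>
    simp only [pairCount, Finset.sum_add_distrib, ih]
    congr 1
    clear ih
    induction L with
    | nil => simp
    | cons e' L ih =>
      simp only [List.countP_cons, Finset.sum_add_distrib, ih]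
      congr 1
      rw [Finset.sum_eq_single e'.1]
      · simp
      · intro u _ hu; simp [Ne.symm hu]
      · simp

lemma amp_eq_prod [Fintype V] (pos : V → ℕ) (L : List (V × V × Fin d)) (φ : V → Polyvector d) :
    amp pos L φ = (-1 : ℝ) ^ pairCount (fun a b => pos b.1 < pos a.1) L •
      ∏ u, pdList (endColours L u) (pairing (φ u) (startColours L u)) := by
  rw [amp]
  simp only [listOp_apply_empty]
  rw [Finset.prod_smul, Finset.prod_pow_eq_pow_sum, sum_pairCount]

end

/-- The order of the vertices of a graph of type `(n,m)`. -/
def vertexPos {n m : ℕ} : Fin n ⊕ Fin m → ℕ := Sum.elim (fun v => v) fun w => n + w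

lemma vertexPos_injective {n m : ℕ} : Function.Injective (vertexPos : Fin n ⊕ Fin m → ℕ) := by
  rintro (v | v) (w | w) h <;> simp only [vertexPos, Sum.elim_inl, Sum.elim_inr] at h
  · rw [Fin.ext h]
  · omega
  · omega
  · rw [Fin.ext (by omega : (v : ℕ) = w)]

/-- An edge of a graph with a colour, as a coloured edge. -/
def toColoured {n m d : ℕ} (x : Edge n m × Fin d) : (Fin n ⊕ Fin m) × (Fin n ⊕ Fin m) × Fin d :=
  (Sum.inl x.1.1, x.1.2, x.2)

lemma toColoured_injective {n m d : ℕ} :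
    Function.Injective (toColoured : Edge n m × Fin d → _) := by
  rintro ⟨⟨a, b⟩, c⟩ ⟨⟨a', b'⟩, c'⟩ h
  simp only [toColoured, Prod.mk.injEq, Sum.inl.injEq] at h
  obtain ⟨rfl, rfl, rfl⟩ := h
  rfl

/-- The polyvectors at the internal vertices and the functions at the boundary vertices. -/
noncomputable def vertexFields {n m d : ℕ} (γ : Fin n → Polyvector d) (f : Fin m → Smooth d) :
    Fin n ⊕ Fin m → Polyvector d :=
  Sum.elim γ fun w => ofFunction d (f w)

/-- The amplitude of a graph with coloured edges. -/
noncomputable def graphAmp {n m d : ℕ} (γ : Fin n → Polyvector d) (f : Fin m → Smooth d)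
    (L : List (Edge n m × Fin d)) : Smooth d :=
  amp vertexPos (L.map toColoured) (vertexFields γ f)

lemma isAlt_graphAmp {n m d : ℕ} (γ : Fin n → Polyvector d) (f : Fin m → Smooth d) :
    IsAlt (graphAmp γ f) :=
  (isAlt_amp vertexPos_injective _).map _

lemma startColours_inr {n m d : ℕ} (L : List (Edge n m × Fin d)) (w : Fin m) :
    startColours (L.map toColoured) (Sum.inr w) = [] := by
  simp [startColours, toColoured, List.filter_map, Function.comp_def]

lemma graphAmp_eq_prod {n m d : ℕ} (γ : Fin n → Polyvector d) (f : Fin m → Smooth d)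
    (L : List (Edge n m × Fin d)) :
    graphAmp γ f L = (-1 : ℝ) ^ pairCount (fun a b => b.1.1 < a.1.1) L •
      ((∏ v, pdList (endColours (L.map toColoured) (Sum.inl v))
          (pairing (γ v) (startColours (L.map toColoured) (Sum.inl v)))) *
        ∏ w, pdList (endColours (L.map toColoured) (Sum.inr w)) (f w)) := by
  rw [graphAmp, amp_eq_prod, pairCount_map, Fintype.prod_sum_type]
  simp only [vertexFields, Sum.elim_inl, Sum.elim_inr, startColours_inr, pairing_nil,
    ofFunction_apply, if_true]
  rfl

/-- With the vertices in the order of their labels, the sign collected by the operator formalism is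
`starSign`. -/
lemma stateSum_eq {n m d : ℕ} (Γ : Graph n m) (γ : Fin n → Polyvector d) (f : Fin m → Smooth d) :
    stateSum Γ γ f =
      ∑ I : Fin Γ.length → Fin d, graphAmp γ f (List.ofFn fun a => (Γ.get a, I a)) := by
  rw [stateSum, Finset.smul_sum]
  refine Finset.sum_congr rfl fun I _ => ?_
  have h1 : starSign Γ = (-1) ^ pairCount (fun a b : Edge n m × Fin d => b.1.1 < a.1.1)
      (List.ofFn fun a => (Γ.get a, I a)) := by
    rw [starSign, card_pairs_eq_pairCount (fun a b : Edge n m => b.1 < a.1) Γ]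
    congr 1
    conv_lhs => rw [← List.ofFn_get Γ]
    have : List.ofFn Γ.get = (List.ofFn fun a => (Γ.get a, I a)).map Prod.fst := by
      rw [List.map_ofFn]; rfl
    rw [this, pairCount_map]
  have h2 : ∀ v, startColours ((List.ofFn fun a => (Γ.get a, I a)).map toColoured) (Sum.inl v) =
      outColours Γ I v := by
    intro v
    simp [startColours, outColours, List.ofFn_eq_map, List.filter_map, Function.comp_def, toColoured]
  have h3 : ∀ v, endColours ((List.ofFn fun a => (Γ.get a, I a)).map toColoured) v =
      inColours Γ I v := by
    intro v
    simp [endColours, inColours, List.ofFn_eq_map, List.filter_map, Function.comp_def, toColoured]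
  rw [graphAmp_eq_prod, h1]
  simp only [h2, h3]

/-- The sum of the amplitudes of all sets of coloured edges, weighted by a function of graphs. -/
noncomputable def ampSum {n m d : ℕ} (c : Graph n m → ℝ) (γ : Fin n → Polyvector d)
    (f : Fin m → Smooth d) : Smooth d :=
  ∑ S : Finset (Edge n m × Fin d), c (S.toList.map Prod.fst) • graphAmp γ f S.toList

lemma isSymm_smul_graphAmp {n m d : ℕ} {c : Graph n m → ℝ} (hc : IsAlt c)
    (γ : Fin n → Polyvector d) (f : Fin m → Smooth d) :
    IsSymm fun L : List (Edge n m × Fin d) => c (L.map Prod.fst) • graphAmp γ f L :=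
  (hc.map Prod.fst).isSymm_smul (isAlt_graphAmp γ f)

lemma vanishes_smul_graphAmp {n m d : ℕ} (c : Graph n m → ℝ)
    (γ : Fin n → Polyvector d) (f : Fin m → Smooth d) :
    VanishesOnDuplicates fun L : List (Edge n m × Fin d) =>
      c (L.map Prod.fst) • graphAmp γ f L := by
  intro l hl
  simp only [(isAlt_graphAmp γ f).vanishesOnDuplicates l hl, smul_zero]

lemma ampSum_eq_listSum {n m d E : ℕ} {c : Graph n m → ℝ} (hc : IsAlt c)
    (hE : ∀ Γ : Graph n m, Γ.length ≠ E → c Γ = 0) (γ : Fin n → Polyvector d)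
    (f : Fin m → Smooth d) :
    ampSum c γ f = (E.factorial : ℝ)⁻¹ •
      listSum E fun L : List (Edge n m × Fin d) => c (L.map Prod.fst) • graphAmp γ f L :=
  sum_eq_inv_factorial_smul_listSum E (fun L => c (L.map Prod.fst) • graphAmp γ f L)
    (isSymm_smul_graphAmp hc γ f) (vanishes_smul_graphAmp c γ f) fun l hl => by
      rw [hE _ (by simpa using hl), zero_smul]

/-- Pairs of an ordered graph and a colouring are lists of coloured edges, and `E!` orders give the
same term. Inadmissible graphs and other numbers of edges may be included since their coefficients
vanish; a set may even contain one edge in several colours. -/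
lemma expansion_eq_ampSum {d s : ℕ} {c : (n m : ℕ) → Graph n m → ℝ} {n : ℕ} (γ : Fin n → Polyvector d)
    (l : List (Smooth d)) (hc : IsAlt (c n l.length))
    (hadm : ∀ Γ : Graph n l.length, ¬Admissible Γ → c n l.length Γ = 0)
    (hlen : ∀ Γ : Graph n l.length, Γ.length + s ≠ 2 * n + l.length → c n l.length Γ = 0) :
    expansion d s c n γ l = ampSum (c n l.length) γ l.get := by
  classical
  rw [expansion]
  by_cases hs : s ≤ 2 * n + l.length
  · have hf : (Finset.range (2 * n + l.length + 1)).filter (fun E => E + s = 2 * n + l.length) =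
        {2 * n + l.length - s} := by
      ext E
      simp only [Finset.mem_filter, Finset.mem_range, Finset.mem_singleton]
      omega
    rw [hf, Finset.sum_singleton, ampSum_eq_listSum (E := 2 * n + l.length - s) hc
      (fun Γ h => hlen Γ (by omega)), ← sum_ofFn_eq_listSum, Finset.sum_filter_of_ne,
      Finset.smul_sum, ← (Equiv.arrowProdEquivProdArrow (Fin (2 * n + l.length - s))
        (fun _ => Edge n l.length) fun _ => Fin d).symm.sum_comp, Fintype.sum_prod_type]
    · refine Finset.sum_congr rfl fun Γ _ => ?_
      rw [mul_smul, ← Finset.smul_sum]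
      congr 1
      rw [stateSum_eq, Finset.smul_sum, ← (Equiv.arrowCongr (finCongr (List.length_ofFn (f := Γ)))
        (Equiv.refl (Fin d))).symm.sum_comp]
      refine Finset.sum_congr rfl fun I _ => ?_
      have h1 : (List.ofFn fun a => ((List.ofFn Γ).get a,
          ((Equiv.arrowCongr (finCongr (List.length_ofFn (f := Γ)))
            (Equiv.refl (Fin d))).symm I) a)) = List.ofFn fun a => (Γ a, I a) := by
        apply List.ext_get
        · simp
        · intro a h1 h2
          simp [Equiv.arrowCongr]
          rfl
      rw [h1]
      have h2 : List.ofFn Γ = (List.ofFn fun a => (Γ a, I a)).map Prod.fst := by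
        rw [List.map_ofFn]; rfl
      rw [h2]
      rfl
    · intro Γ _ h
      by_contra hΓ
      exact h (by rw [hadm _ hΓ, mul_zero, zero_smul])
  -- The required number of edges would be negative: the expansion is empty, and all coefficients
  -- are `0`.
  · have hf : (Finset.range (2 * n + l.length + 1)).filter (fun E => E + s = 2 * n + l.length) =
        ∅ := by
      ext E
      simp only [Finset.mem_filter, Finset.mem_range, Finset.notMem_empty, iff_false]
      omega
    rw [hf, Finset.sum_empty, ampSum]
    symm
    refine Finset.sum_eq_zero fun S _ => ?_
    rw [hlen _ (by omega), zero_smul]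

/-! ### Weights of graphs -/

lemma gen_eq_zero {n m : ℕ} {Γ : Graph n m} (h : ¬Admissible Γ) : gen Γ = 0 := by
  rw [gen, (Submodule.Quotient.mk_eq_zero _).2 (Submodule.subset_span (GraphRel.inadmissible Γ h)),
    map_zero]

lemma gen_swap {n m : ℕ} (u v : Graph n m) (a b : Edge n m) :
    gen (u ++ a :: b :: v) = -gen (u ++ b :: a :: v) := by
  rw [eq_neg_iff_add_eq_zero, gen, gen, ← map_add, ← Submodule.Quotient.mk_add,
    (Submodule.Quotient.mk_eq_zero _).2 (Submodule.subset_span (GraphRel.swap u v a b)), map_zero]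

lemma gen_relabel {n m : ℕ} (τ : Equiv.Perm (Fin n)) (Γ : Graph n m) :
    gen (relabel τ Γ) = gen Γ := by
  rw [← sub_eq_zero, gen, gen, ← map_sub, ← Submodule.Quotient.mk_sub,
    (Submodule.Quotient.mk_eq_zero _).2 (Submodule.subset_span (GraphRel.relabel Γ τ)), map_zero]

/-- Different descriptions of a quotient have numbers of internal vertices that agree only
propositionally; this compares their classes. -/
lemma gen_map_equiv {n n' m : ℕ} (τ : Fin n ≃ Fin n') (Γ : Graph n m) :
    gen (Γ.map fun e => (τ e.1, Sum.map τ id e.2) : Graph n' m) = gen Γ := by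
  have h : n = n' := by simpa using Fintype.card_congr τ
  subst h
  exact gen_relabel τ Γ

/-- The weight of a graph. -/
noncomputable def weight (W : FeynmanAlgebra →ₐ[ℝ] ℝ) {n m : ℕ} (Γ : Graph n m) : ℝ := W (gen Γ)

lemma isAlt_weight (W : FeynmanAlgebra →ₐ[ℝ] ℝ) {n m : ℕ} :
    IsAlt (weight W : Graph n m → ℝ) := fun u v a b => by
  rw [weight, gen_swap, map_neg]; rfl

lemma feynmanMap_eq_ampSum {W : FeynmanAlgebra →ₐ[ℝ] ℝ} (hW : IsWeight W) {d n : ℕ}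
    (γ : Fin n → Polyvector d) (l : List (Smooth d)) :
    feynmanMap W d n γ l = ampSum (weight W) γ l.get :=
  expansion_eq_ampSum γ l (isAlt_weight W) (fun Γ h => by rw [gen_eq_zero h, map_zero])
    fun Γ h => hW.degree_zero _ _ _ h

lemma ampSum_length_congr {d n m : ℕ} (c : (m : ℕ) → Graph n m → ℝ) (γ : Fin n → Polyvector d)
    (l : List (Smooth d)) (f : Fin m → Smooth d) (h : l = List.ofFn f) :
    ampSum (c l.length) γ l.get = ampSum (c m) γ f := by
  have hl : l.length = m := by rw [h, List.length_ofFn]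
  subst hl
  congr 1
  apply List.ofFn_injective
  rw [List.ofFn_get]
  exact h

lemma feynmanMap_ofFn {W : FeynmanAlgebra →ₐ[ℝ] ℝ} (hW : IsWeight W) {d n m : ℕ}
    (γ : Fin n → Polyvector d) (l : List (Smooth d)) (f : Fin m → Smooth d) (h : l = List.ofFn f) :
    feynmanMap W d n γ l = ampSum (weight W) γ f := by
  rw [feynmanMap_eq_ampSum hW]
  exact ampSum_length_congr (fun m => weight W) γ l f h

/-! ### The Feynman expansion is a pre-`L_∞`-morphism -/

lemma length_startColours {n m d : ℕ} (L : List (Edge n m × Fin d)) (v : Fin n) :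
    (startColours (L.map toColoured) (Sum.inl v)).length = L.countP fun e => e.1.1 = v := by
  rw [startColours, List.length_map, ← List.countP_eq_length_filter, List.countP_map]
  congr 1
  funext e
  simp [toColoured]

lemma sum_length_startColours {n m d : ℕ} (L : List (Edge n m × Fin d)) :
    ∑ v, (startColours (L.map toColoured) (Sum.inl v)).length = L.length := by
  simp only [length_startColours]
  induction L with
  | nil => simp
  | cons e L ih => simp [List.countP_cons, Finset.sum_add_distrib, ih]

lemma of_graphAmp_ne_zero {n m d : ℕ} {γ : Fin n → Polyvector d} {f : Fin m → Smooth d}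
    {L : List (Edge n m × Fin d)} (h : graphAmp γ f L ≠ 0) (v : Fin n) :
    (startColours (L.map toColoured) (Sum.inl v)).Nodup ∧
      γ v (startColours (L.map toColoured) (Sum.inl v)).toFinset ≠ 0 := by
  rw [graphAmp_eq_prod] at h
  have h1 : pairing (γ v) (startColours (L.map toColoured) (Sum.inl v)) ≠ 0 := by
    intro h0
    apply h
    rw [Finset.prod_eq_zero (Finset.mem_univ v), zero_mul, smul_zero]
    rw [h0, ← pdListLinear_apply, map_zero]
  rw [pairing_eq] at h1
  by_cases hn : (startColours (L.map toColoured) (Sum.inl v)).Nodup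
  · rw [if_pos hn] at h1
    exact ⟨hn, fun h0 => h1 (by rw [h0, smul_zero])⟩
  · exact absurd (if_neg hn) h1

/-- Each edge removes one `ψ` at its start, and in the end none may be left. -/
lemma graphAmp_eq_zero_of_homogeneous {n m d : ℕ} {γ : Fin n → Polyvector d} {k : Fin n → ℕ}
    (hγ : ∀ i, IsHomogeneous (k i) (γ i)) (f : Fin m → Smooth d) {L : List (Edge n m × Fin d)}
    (hL : L.length ≠ ∑ i, k i) : graphAmp γ f L = 0 := by
  by_contra h
  apply hL
  rw [← sum_length_startColours]
  refine Finset.sum_congr rfl fun v _ => ?_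
  obtain ⟨h1, h2⟩ := of_graphAmp_ne_zero h v
  by_contra hv
  exact h2 (hγ v _ (by rwa [List.toFinset_card_of_nodup h1]))

/-- The edges leaving a vertex need different colours, so at most `d` of them start at each of the
`n` vertices. -/
lemma graphAmp_eq_zero_of_length {n m d : ℕ} (γ : Fin n → Polyvector d)
    (f : Fin m → Smooth d) {L : List (Edge n m × Fin d)}
    (hL : n * d < L.length) : graphAmp γ f L = 0 := by
  by_contra h
  apply not_le_of_gt hL
  rw [← sum_length_startColours]
  calc _ ≤ ∑ _v : Fin n, d := Finset.sum_le_sum fun v _ => by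
        simpa using (of_graphAmp_ne_zero h v).1.length_le_card
    _ = n * d := by simp

lemma ampSum_eq_zero_of_degree {n m d : ℕ} {W : FeynmanAlgebra →ₐ[ℝ] ℝ} (hW : IsWeight W)
    {γ : Fin n → Polyvector d} {k : Fin n → ℕ}
    (hγ : ∀ i, IsHomogeneous (k i) (γ i)) (f : Fin m → Smooth d) (h : m + 2 * n ≠ ∑ i, k i + 2) :
    ampSum (weight W) γ f = 0 := by
  refine Finset.sum_eq_zero fun S _ => ?_
  by_cases hS : S.toList.length = ∑ i, k i
  · rw [weight, hW.degree_zero, zero_smul]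
    rw [List.length_map, hS]
    omega
  · rw [graphAmp_eq_zero_of_homogeneous hγ f hS, smul_zero]

/-- The amplitude as a multilinear map in the polyvectors. -/
noncomputable def graphAmpMultilinear {n m d : ℕ} (f : Fin m → Smooth d)
    (L : List (Edge n m × Fin d)) :
    MultilinearMap ℝ (fun _ : Fin n => Polyvector d) (Smooth d) :=
  (LinearMap.mulRight ℝ (∏ w, listOp vertexPos (L.map toColoured) (Sum.inr w)
      (ofFunction d (f w)) ∅)).compMultilinearMap
    ((MultilinearMap.mkPiAlgebra ℝ (Fin n) (Smooth d)).compLinearMap fun v =>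
      (LinearMap.proj ∅ : Polyvector d →ₗ[ℝ] Smooth d) ∘ₗ
        listOp vertexPos (L.map toColoured) (Sum.inl v))

lemma graphAmpMultilinear_apply {n m d : ℕ} (f : Fin m → Smooth d)
    (L : List (Edge n m × Fin d)) (γ : Fin n → Polyvector d) :
    graphAmpMultilinear f L γ = graphAmp γ f L := by
  rw [graphAmp, amp, Fintype.prod_sum_type]
  simp [graphAmpMultilinear, vertexFields]

lemma graphAmp_eq_elementaryOp {n m d : ℕ} (γ : Fin n → Polyvector d)
    (L : List (Edge n m × Fin d)) (l : List (Smooth d)) (h : l.length = m) :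
    graphAmp γ (fun w => l.get (w.cast h.symm)) L =
      elementaryOp ((-1 : ℝ) ^ pairCount (fun a b => b.1.1 < a.1.1) L •
        (∏ v, pdList (endColours (L.map toColoured) (Sum.inl v))
          (pairing (γ v) (startColours (L.map toColoured) (Sum.inl v)))))
        (List.ofFn fun w => endColours (L.map toColoured) (Sum.inr w)) l := by
  subst h
  rw [graphAmp_eq_prod, elementaryOp, if_pos (by simp), ← smul_mul_assoc]
  congr 1
  rw [← List.prod_ofFn]
  congr 1
  apply List.ext_get
  · simp
  · intro a h1 h2
    simp

lemma feynmanMap_mem_polyDiff {W : FeynmanAlgebra →ₐ[ℝ] ℝ} (hW : IsWeight W) {d n : ℕ}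
    (γ : Fin n → Polyvector d) : feynmanMap W d n γ ∈ polyDiff d := by
  -- Only finitely many arities occur: a nonzero amplitude has at most `n * d` edges, and degree `0`
  -- means that this number plus `2` is `2 * n + m`, whence `m ≤ n * d + 2`.
  have key : feynmanMap W d n γ = ∑ m ∈ Finset.range (n * d + 3),
      ∑ S : Finset (Edge n m × Fin d), weight W (S.toList.map Prod.fst) •
        elementaryOp ((-1 : ℝ) ^ pairCount (fun a b => b.1.1 < a.1.1) S.toList •
          (∏ v, pdList (endColours (S.toList.map toColoured) (Sum.inl v))
            (pairing (γ v) (startColours (S.toList.map toColoured) (Sum.inl v)))))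
          (List.ofFn fun w => endColours (S.toList.map toColoured) (Sum.inr w)) := by
    funext l
    simp only [Finset.sum_apply, Pi.smul_apply]
    rw [Finset.sum_eq_single l.length]
    · rw [feynmanMap_eq_ampSum hW, ampSum]
      refine Finset.sum_congr rfl fun S _ => ?_
      rw [← graphAmp_eq_elementaryOp γ S.toList l rfl]
      rfl
    · intro m _ hm
      refine Finset.sum_eq_zero fun S _ => ?_
      rw [elementaryOp, if_neg (by simpa using hm.symm), smul_zero]
    · intro hl
      refine Finset.sum_eq_zero fun S _ => ?_
      rw [← graphAmp_eq_elementaryOp γ S.toList l rfl]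
      simp only [Finset.mem_range, not_lt] at hl
      by_cases hS : S.toList.length + 2 = 2 * n + l.length
      · rw [graphAmp_eq_zero_of_length, smul_zero]
        omega
      · rw [weight, hW.degree_zero _ _ _ (by simpa using hS), zero_smul]
  rw [key]
  exact Submodule.sum_mem _ fun m _ => Submodule.sum_mem _ fun S _ =>
    Submodule.smul_mem _ _ (Submodule.subset_span ⟨_, _, rfl⟩)

lemma sum_finset_map_equiv {X Y M : Type*} [Fintype X] [Fintype Y] [AddCommMonoid M]
    (e : X ≃ Y) {G : List Y → M} (hG : IsSymm G) :
    ∑ S : Finset X, G (S.toList.map e) = ∑ S : Finset Y, G S.toList := by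
  rw [← e.finsetCongr.sum_comp]
  refine Finset.sum_congr rfl fun S _ => hG _ _ ?_
  rw [List.perm_ext_iff_of_nodup ((Finset.nodup_toList _).map e.injective) (Finset.nodup_toList _)]
  intro x
  simp only [List.mem_map, Finset.mem_toList, Equiv.finsetCongr_apply, Finset.mem_map,
    Equiv.coe_toEmbedding]

lemma reorderSign_sum {n m : ℕ} (pos pos' : Fin n ⊕ Fin m → ℕ) (k : Fin n → ℕ) :
    reorderSign pos pos' (Sum.elim k fun _ => 0) =
      reorderSign (fun v => pos (Sum.inl v)) (fun v => pos' (Sum.inl v)) k := by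
  simp only [reorderSign, Fintype.prod_sum_type, Sum.elim_inl, Sum.elim_inr, mul_zero, zero_mul,
    pow_zero, ite_self, Finset.prod_const_one, mul_one]

lemma isHomogeneous_vertexFields {n m d : ℕ} {γ : Fin n → Polyvector d} {k : Fin n → ℕ}
    (hγ : ∀ i, IsHomogeneous (k i) (γ i)) (f : Fin m → Smooth d) (u : Fin n ⊕ Fin m) :
    IsHomogeneous (Sum.elim k (fun _ => 0) u) (vertexFields γ f u) := by
  cases u with
  | inl v => exact hγ v
  | inr w => exact isHomogeneous_ofFunction _

/-- Permuting the arguments amounts to relabelling the internal vertices, which the weight ignores,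
and to changing their order, which costs the Koszul sign by `amp_reorder`. Boundary vertices carry
even fields and contribute no sign. -/
lemma feynmanMap_symm {W : FeynmanAlgebra →ₐ[ℝ] ℝ} (hW : IsWeight W) {d n : ℕ} {k : Fin n → ℕ}
    {γ : Fin n → Polyvector d} (hγ : ∀ i, IsHomogeneous (k i) (γ i)) (σ : Equiv.Perm (Fin n)) :
    feynmanMap W d n (γ ∘ σ) = koszulSign k σ • feynmanMap W d n γ := by
  funext l
  rw [Pi.smul_apply, feynmanMap_eq_ampSum hW, feynmanMap_eq_ampSum hW]
  let e : Fin n ⊕ Fin l.length ≃ Fin n ⊕ Fin l.length := Equiv.sumCongr σ (Equiv.refl _)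
  let r : Edge n l.length × Fin d ≃ Edge n l.length × Fin d :=
    Equiv.prodCongr (Equiv.prodCongr σ e) (Equiv.refl _)
  have hsign : reorderSign (fun u => vertexPos (e.symm u)) vertexPos
      (Sum.elim k fun _ : Fin l.length => 0) = koszulSign k σ := by
    rw [reorderSign_sum, reorderSign, koszulSign, ← Equiv.prod_comp σ]
    refine Finset.prod_congr rfl fun a _ => ?_
    rw [← Equiv.prod_comp σ]
    refine Finset.prod_congr rfl fun b _ => ?_
    simp [e, vertexPos]
  have hamp : ∀ L, graphAmp (γ ∘ σ) l.get L = koszulSign k σ • graphAmp γ l.get (L.map r) := by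
    intro L
    have h1 : vertexFields (γ ∘ σ) l.get = fun u => vertexFields γ l.get (e u) := by
      funext u
      cases u <;> rfl
    have h2 : (L.map r).map toColoured = (L.map toColoured).map (mapEdge e) := by
      simp only [List.map_map]
      rfl
    rw [graphAmp, graphAmp, h1, h2, ← hsign, ← amp_reorder
      (fun a b h => e.symm.injective (vertexPos_injective h)) vertexPos_injective
      _ _ _ (isHomogeneous_vertexFields hγ l.get), amp_map]
    simp
  have hw : ∀ L : List (Edge n l.length × Fin d), weight W (L.map Prod.fst) =
      weight W ((L.map r).map Prod.fst) := by
    intro L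
    rw [weight, weight, ← gen_relabel σ, relabel, List.map_map, List.map_map]
    rfl
  rw [ampSum, ampSum, ← sum_finset_map_equiv r
    (isSymm_smul_graphAmp (isAlt_weight W) γ l.get), Finset.smul_sum]
  refine Finset.sum_congr rfl fun S _ => ?_
  rw [hamp, hw, smul_comm]

lemma isPreLInfty_feynmanMap {W : FeynmanAlgebra →ₐ[ℝ] ℝ} (hW : IsWeight W) (d : ℕ) :
    IsPreLInfty (feynmanMap W d) where
  multilinear n _ := by
    refine ⟨MultilinearMap.pi fun l : List (Smooth d) => ∑ S : Finset (Edge n l.length × Fin d),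
      weight W (S.toList.map Prod.fst) • graphAmpMultilinear l.get S.toList, fun γ => ?_⟩
    funext l
    rw [feynmanMap_eq_ampSum hW]
    simp [ampSum, graphAmpMultilinear_apply]
  mem n _ γ := feynmanMap_mem_polyDiff hW γ
  symm n _ k γ hγ σ := feynmanMap_symm hW hγ σ
  degree n _ k γ hγ l hl := by
    rw [feynmanMap_eq_ampSum hW, ampSum_eq_zero_of_degree hW hγ _ hl]

/-! ### Orders in which some of the vertices are moved to the end -/

/-- The order in which the vertices with property `c` are moved to the end. -/
def shiftedPos {n m : ℕ} (c : Fin n ⊕ Fin m → Prop) [DecidablePred c] (u : Fin n ⊕ Fin m) : ℕ :=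
  vertexPos u + if c u then n + m else 0

lemma vertexPos_lt {n m : ℕ} (u : Fin n ⊕ Fin m) : vertexPos u < n + m := by
  rcases u with v | w
  · have := v.2; simp only [vertexPos, Sum.elim_inl]; omega
  · have := w.2; simp only [vertexPos, Sum.elim_inr]; omega

lemma shiftedPos_lt_iff {n m : ℕ} (c : Fin n ⊕ Fin m → Prop) [DecidablePred c]
    (u v : Fin n ⊕ Fin m) : shiftedPos c u < shiftedPos c v ↔
      (¬c u ∧ c v) ∨ ((c u ↔ c v) ∧ vertexPos u < vertexPos v) := by
  have hu := vertexPos_lt u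
  have hv := vertexPos_lt v
  by_cases h : c u <;> by_cases h' : c v <;> simp [shiftedPos, h, h'] <;> omega

lemma shiftedPos_injective {n m : ℕ} (c : Fin n ⊕ Fin m → Prop) [DecidablePred c] :
    Function.Injective (shiftedPos c) := by
  intro u v h
  have hu := vertexPos_lt u
  have hv := vertexPos_lt v
  apply vertexPos_injective
  by_cases h1 : c u <;> by_cases h2 : c v <;> simp [shiftedPos, h1, h2] at h <;> omega

/-- The order is reversed exactly for the pairs in which a moved vertex originally precedes one that
stays. -/
lemma reorderSign_shiftedPos {n m : ℕ} (c : Fin n ⊕ Fin m → Prop) [DecidablePred c]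
    (k : Fin n → ℕ) (I : Finset (Fin n)) (hI : ∀ v, v ∈ I ↔ ¬c (Sum.inl v)) :
    reorderSign vertexPos (shiftedPos c) (Sum.elim k fun _ => 0) = unshuffleSign k I := by
  rw [reorderSign_sum, reorderSign, unshuffleSign, Finset.prod_comm,
    ← Finset.prod_filter_mul_prod_filter_not Finset.univ (fun v => v ∈ I)]
  have h1 : (∏ v with v ∉ I, ∏ u : Fin n, if vertexPos (Sum.inl u : Fin n ⊕ Fin m) <
      vertexPos (Sum.inl v : Fin n ⊕ Fin m) ∧ shiftedPos c (Sum.inl v) < shiftedPos c (Sum.inl u)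
      then (-1 : ℝ) ^ (k u * k v) else 1) = 1 := by
    refine Finset.prod_eq_one fun v hv => Finset.prod_eq_one fun u _ => ?_
    have : c (Sum.inl v) := by simpa [hI] using hv
    rw [if_neg]
    rw [shiftedPos_lt_iff]
    rintro ⟨h1, h2 | h2⟩
    · exact h2.1 this
    · omega
  rw [h1, mul_one]
  refine Finset.prod_congr (by ext; simp) fun v hv => ?_
  have hcv : ¬c (Sum.inl v) := by rw [← hI]; simpa using hv
  rw [← Finset.prod_filter_mul_prod_filter_not Finset.univ (fun u => u ∈ I)]
  have h2 : (∏ u with u ∈ I, if vertexPos (Sum.inl u : Fin n ⊕ Fin m) <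
      vertexPos (Sum.inl v : Fin n ⊕ Fin m) ∧ shiftedPos c (Sum.inl v) < shiftedPos c (Sum.inl u)
      then (-1 : ℝ) ^ (k u * k v) else 1) = 1 := by
    refine Finset.prod_eq_one fun u hu => ?_
    have : ¬c (Sum.inl u) := by rw [← hI]; simpa using hu
    rw [if_neg]
    rw [shiftedPos_lt_iff]
    rintro ⟨h1, h2 | h2⟩
    · exact this h2.2
    · omega
  rw [h2, one_mul]
  refine Finset.prod_congr (by ext; simp) fun u hu => ?_
  have hcu : c (Sum.inl u) := by
    by_contra h
    rw [← hI] at h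
    exact Finset.mem_compl.1 hu h
  simp only [shiftedPos_lt_iff, hcv, hcu, vertexPos, Sum.elim_inl, Fin.val_fin_lt, not_false_eq_true,
    and_self, true_or, and_true, mul_comm (k u)]

/-! ### Brackets of polyvectors and contraction of edges -/

lemma liftSum_map {X Y X' Y' M : Type*} [AddCommMonoid M] (e : X → X')
    (he : Function.Injective e) (e' : Y → Y') (fib : Y → Finset X) (fib' : Y' → Finset X')
    (h1 : ∀ x y, x ∈ fib y ↔ e x ∈ fib' (e' y)) (h2 : ∀ y, ∀ z ∈ fib' (e' y), ∃ x, e x = z)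
    (G : List X' → M) (l : List Y) :
    liftSum fib (fun L => G (L.map e)) l = liftSum fib' G (l.map e') := by
  induction l generalizing G with
  | nil => rfl
  | cons y l ih =>
    simp only [liftSum, List.map_cons]
    have : fib' (e' y) = (fib y).map ⟨e, he⟩ := by
      ext z
      simp only [Finset.mem_map, Function.Embedding.coeFn_mk]
      constructor
      · intro hz
        obtain ⟨x, rfl⟩ := h2 y z hz
        exact ⟨x, (h1 x y).2 hz, rfl⟩
      · rintro ⟨x, hx, rfl⟩
        exact (h1 x y).1 hx
    rw [this, Finset.sum_map]
    exact Finset.sum_congr rfl fun x _ => ih fun L => G (e x :: L)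

/-- The map of vertices that identifies the vertices in `K` with `0`. -/
noncomputable def identify {n : ℕ} (K : Finset (Fin n)) (v : Fin n) : Fin (Kᶜ.card + 1) :=
  if h : v ∈ Kᶜ then (indexIn Kᶜ v h).succ else 0

/-- The map of edges that identifies the vertices in `K`. -/
noncomputable def identifyEdge {n m : ℕ} (K : Finset (Fin n)) (e : Edge n m) :
    Edge (Kᶜ.card + 1) m := (identify K e.1, Sum.map (identify K) id e.2)

lemma indexIn_orderEmbOfFin {n : ℕ} (J : Finset (Fin n)) (a : Fin J.card)
    (h : J.orderEmbOfFin rfl a ∈ J) : indexIn J (J.orderEmbOfFin rfl a) h = a := by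
  rw [indexIn, OrderIso.symm_apply_eq]
  rfl

lemma orderEmbOfFin_indexIn {n : ℕ} (J : Finset (Fin n)) (v : Fin n) (h : v ∈ J) :
    J.orderEmbOfFin rfl (indexIn J v h) = v := by
  have : J.orderIsoOfFin rfl (indexIn J v h) = ⟨v, h⟩ := OrderIso.apply_symm_apply _ _
  exact congrArg Subtype.val this

lemma identify_orderEmbOfFin {n : ℕ} (K : Finset (Fin n)) (a : Fin Kᶜ.card) :
    identify K (Kᶜ.orderEmbOfFin rfl a) = a.succ := by
  have h : Kᶜ.orderEmbOfFin rfl a ∈ Kᶜ := Finset.orderEmbOfFin_mem _ _ _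
  rw [identify, dif_pos h, indexIn_orderEmbOfFin]

lemma identify_of_mem {n : ℕ} {K : Finset (Fin n)} {v : Fin n} (h : v ∈ K) :
    identify K v = 0 := dif_neg (by simpa using h)

/-- The vertices of a graph, with `i` and `j` in front. -/
noncomputable def pairFirst {n : ℕ} (m : ℕ) {i j : Fin n} (hij : i ≠ j) :
    Option (Option (Fin (({i, j} : Finset (Fin n))ᶜ).card ⊕ Fin m)) ≃ Fin n ⊕ Fin m :=
  Equiv.ofBijective
    (fun o => o.elim (Sum.inl i) fun o => o.elim (Sum.inl j) fun u =>
      Sum.map ((({i, j} : Finset (Fin n))ᶜ).orderEmbOfFin rfl) id u) (by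
    have hmem : ∀ a, ({i, j} : Finset (Fin n))ᶜ.orderEmbOfFin rfl a ≠ i ∧
        ({i, j} : Finset (Fin n))ᶜ.orderEmbOfFin rfl a ≠ j := by
      intro a
      have := Finset.orderEmbOfFin_mem ({i, j} : Finset (Fin n))ᶜ rfl a
      simpa only [Finset.mem_compl, Finset.mem_insert, Finset.mem_singleton, not_or] using this
    constructor
    · rintro (_ | _ | a | w) (_ | _ | a' | w') h <;>
        simp [-Finset.compl_insert, hij, hij.symm, hmem, fun a => (hmem a).1.symm, fun a => (hmem a).2.symm] at h ⊢ <;>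
        exact h
    · rintro (v | w)
      · by_cases h1 : v = i
        · exact ⟨none, by simp [h1]⟩
        by_cases h2 : v = j
        · exact ⟨some none, by simp [h2]⟩
        have hv : v ∈ ({i, j} : Finset (Fin n))ᶜ := by simp [h1, h2]
        exact ⟨some (some (Sum.inl (indexIn _ v hv))), by simp [-Finset.compl_insert, orderEmbOfFin_indexIn]⟩
      · exact ⟨some (some (Sum.inr w)), by simp⟩)

lemma pairFirst_none {n m : ℕ} {i j : Fin n} (hij : i ≠ j) :
    pairFirst m hij none = Sum.inl i := rfl

lemma pairFirst_some_none {n m : ℕ} {i j : Fin n} (hij : i ≠ j) :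
    pairFirst m hij (some none) = Sum.inl j := rfl

lemma pairFirst_inl {n m : ℕ} {i j : Fin n} (hij : i ≠ j) (a) :
    pairFirst m hij (some (some (Sum.inl a))) =
      Sum.inl ((({i, j} : Finset (Fin n))ᶜ).orderEmbOfFin rfl a) := rfl

lemma pairFirst_inr {n m : ℕ} {i j : Fin n} (hij : i ≠ j) (w) :
    pairFirst m hij (some (some (Sum.inr w))) = Sum.inr w := rfl

/-- The vertices of a graph, with the first internal vertex in front. -/
def vertexFirst (r m : ℕ) : Option (Fin r ⊕ Fin m) ≃ Fin (r + 1) ⊕ Fin m where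
  toFun o := o.elim (Sum.inl 0) (Sum.map Fin.succ id)
  invFun := Sum.elim (Fin.cases none fun a => some (Sum.inl a)) fun w => some (Sum.inr w)
  left_inv := by rintro (_ | a | w) <;> simp
  right_inv := by
    rintro (v | w)
    · cases v using Fin.cases <;> simp
    · simp

/-- Translates the concrete identification of `i` and `j` into the abstract merging of the first two
vertices, to which `liftSum_amp_merge` applies. -/
lemma map_identify_pairFirst {n m : ℕ} {i j : Fin n} (hij : i ≠ j)
    (a : Option (Option (Fin (({i, j} : Finset (Fin n))ᶜ).card ⊕ Fin m))) :
    Sum.map (identify {i, j}) id (pairFirst m hij a) = vertexFirst _ m (mergeMap a) := by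
  rcases a with _ | _ | a | w
  · simp [pairFirst_none, vertexFirst, mergeMap, identify_of_mem]
  · simp [pairFirst_some_none, vertexFirst, mergeMap, identify_of_mem]
  · simp [-Finset.compl_insert, pairFirst_inl, vertexFirst, mergeMap, identify_orderEmbOfFin]
  · simp [pairFirst_inr, vertexFirst, mergeMap]

/-- The amplitude with a wedge product at the first vertex. -/
lemma liftSum_amp_identify {n m d : ℕ} {i j : Fin n} (hij : i < j)
    (L' : List (Edge (({i, j} : Finset (Fin n))ᶜ.card + 1) m × Fin d))
    (φ : Fin n ⊕ Fin m → Polyvector d) :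
    liftSum (fun y => Finset.univ.filter fun x : Edge n m × Fin d =>
        (identifyEdge {i, j} x.1, x.2) = y)
      (fun L => amp (shiftedPos fun u => u ≠ Sum.inl i ∧ u ≠ Sum.inl j) (L.map toColoured) φ) L' =
    amp vertexPos (L'.map toColoured) (Sum.elim (Fin.cons (wedge (φ (Sum.inl i)) (φ (Sum.inl j)))
      fun a => φ (Sum.inl (({i, j} : Finset (Fin n))ᶜ.orderEmbOfFin rfl a)))
        fun w => φ (Sum.inr w)) := by
  set e := pairFirst m hij.ne
  set e' := vertexFirst (({i, j} : Finset (Fin n))ᶜ).card m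
  have h1 : ∀ L : List (Edge n m × Fin d),
      amp (shiftedPos fun u => u ≠ Sum.inl i ∧ u ≠ Sum.inl j) (L.map toColoured) φ =
      amp (fun a => shiftedPos (fun u => u ≠ Sum.inl i ∧ u ≠ Sum.inl j) (e a))
        (L.map fun x => mapEdge e.symm (toColoured x)) fun a => φ (e a) := by
    intro L
    rw [← amp_map, List.map_map]
    congr 1
    refine List.map_congr_left fun x _ => ?_
    simp [mapEdge]
  have h2 : amp vertexPos (L'.map toColoured) (Sum.elim (Fin.cons (wedge (φ (Sum.inl i))
      (φ (Sum.inl j))) fun a => φ (Sum.inl (({i, j} : Finset (Fin n))ᶜ.orderEmbOfFin rfl a)))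
        fun w => φ (Sum.inr w)) =
      amp (fun a => vertexPos (e' a)) (L'.map fun x => mapEdge e'.symm (toColoured x))
        fun o => o.elim (wedge (φ (e none)) (φ (e (some none)))) fun r => φ (e (some (some r))) := by
    have : (fun o : Option (Fin (({i, j} : Finset (Fin n))ᶜ).card ⊕ Fin m) =>
        o.elim (wedge (φ (e none)) (φ (e (some none)))) fun r => φ (e (some (some r)))) =
        fun o => (Sum.elim (Fin.cons (wedge (φ (Sum.inl i)) (φ (Sum.inl j))) fun a =>
          φ (Sum.inl (({i, j} : Finset (Fin n))ᶜ.orderEmbOfFin rfl a)))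
        fun w => φ (Sum.inr w) : Fin (({i, j} : Finset (Fin n))ᶜ.card + 1) ⊕ Fin m → _)
          (e' o) := by
      funext o
      rcases o with _ | a | w <;> simp [-Finset.compl_insert, e, e', pairFirst_none, pairFirst_some_none, pairFirst_inl, pairFirst_inr,
    vertexFirst]
    rw [this, ← amp_map, List.map_map]
    congr 1
    refine List.map_congr_left fun x _ => ?_
    simp [mapEdge]
  simp only [h1]
  rw [h2, liftSum_map (fun x => mapEdge e.symm (toColoured x)) (e' := fun x =>
    mapEdge e'.symm (toColoured x)) (fib' := mergeFiber) (G := fun L => amp _ L _)]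
  · apply liftSum_amp_merge
    · rw [shiftedPos_lt_iff]
      right
      simpa [e, pairFirst_none, pairFirst_some_none, vertexPos] using hij
    · intro r
      rw [shiftedPos_lt_iff]
      left
      refine ⟨by simp [e, pairFirst_some_none], ?_, ?_⟩
      · intro h
        exact absurd (e.injective (h.trans (by rfl : Sum.inl i = e none))) (by simp)
      · intro h
        exact absurd (e.injective (h.trans (by rfl : Sum.inl j = e (some none)))) (by simp)
    · rintro (a | w)
      · simp [e', vertexFirst, vertexPos]
      · simp [e', vertexFirst, vertexPos]
    · intro r r'
      have hc : ∀ r, e (some (some r)) ≠ Sum.inl i ∧ e (some (some r)) ≠ Sum.inl j := by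
        intro r
        constructor
        · intro h
          exact absurd (e.injective (h.trans (by rfl : Sum.inl i = e none))) (by simp)
        · intro h
          exact absurd (e.injective (h.trans (by rfl : Sum.inl j = e (some none)))) (by simp)
      rw [shiftedPos_lt_iff]
      have hlt : ∀ (a : Fin (({i, j} : Finset (Fin n))ᶜ).card),
          (({i, j} : Finset (Fin n))ᶜ.orderEmbOfFin rfl a : ℕ) < n := fun a => Fin.is_lt _
      simp only [hc, ne_eq, not_false_eq_true, and_self, not_true_eq_false, false_and, false_or,
        true_and]
      rcases r with a | w <;> rcases r' with a' | w' <;>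
        simp [-Finset.compl_insert, e, e', pairFirst_inl, pairFirst_inr,
    vertexFirst, vertexPos]
      · have := hlt a; omega
      · have := hlt a'; omega
  · intro x x' h
    apply toColoured_injective
    simpa [mapEdge, Prod.ext_iff] using h
  · intro x y
    have hx := fun u => map_identify_pairFirst (m := m) hij.ne (e.symm u)
    simp only [e, Equiv.apply_symm_apply] at hx
    simp only [mergeFiber, Finset.mem_filter, Finset.mem_univ, true_and, mapEdge, toColoured,
      Prod.ext_iff, Equiv.eq_symm_apply, identifyEdge]
    rw [← hx, ← hx, Sum.map_inl, Sum.inl.injEq, and_assoc]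
  · intro y z hz
    simp only [mergeFiber, Finset.mem_filter, Finset.mem_univ, true_and, mapEdge, toColoured,
      Prod.ext_iff, Equiv.eq_symm_apply] at hz
    obtain ⟨a, b, c⟩ := z
    have := map_identify_pairFirst hij.ne a
    rw [show vertexFirst _ m (mergeMap a) = Sum.inl y.1.1 from hz.1] at this
    -- The abstract fibre allows edges that start anywhere, but identification fixes the boundary
    -- vertices, so a lift of an edge with internal start has internal start.
    obtain ⟨v, hv⟩ : ∃ v, e a = Sum.inl v := by
      cases h : e a with
      | inl v => exact ⟨v, rfl⟩
      | inr w =>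
        have h' : pairFirst m hij.ne a = Sum.inr w := h
        rw [h'] at this
        simp at this
    exact ⟨((v, e b), c), by simp [mapEdge, toColoured, ← hv]⟩

/-! ### The internal part of the differential -/

/-- The weight of the contraction of the edge `e` in a graph whose other edges are `l`. -/
noncomputable def contractWeight (W : FeynmanAlgebra →ₐ[ℝ] ℝ) {n m : ℕ} (e : Edge n m)
    (l : Graph n m) : ℝ :=
  match e with
  | (i, Sum.inl j) => if i ≠ j then weight W (l.map (identifyEdge {i, j})) else 0
  | (_, Sum.inr _) => 0

lemma identify_eq_iff {n : ℕ} {K : Finset (Fin n)} {v v' : Fin n} :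
    identify K v = identify K v' ↔ v = v' ∨ (v ∈ K ∧ v' ∈ K) := by
  by_cases h : v ∈ K <;> by_cases h' : v' ∈ K
  · simp [identify_of_mem, h, h']
  · have hc : v' ∈ Kᶜ := Finset.mem_compl.2 h'
    rw [identify_of_mem h, identify, dif_pos hc]
    simp only [h, h', and_false, or_false, (Fin.succ_ne_zero _).symm, false_iff]
    rintro rfl; exact h' h
  · have hc : v ∈ Kᶜ := Finset.mem_compl.2 h
    rw [identify_of_mem h', identify, dif_pos hc]
    simp only [h, false_and, or_false, (Fin.succ_ne_zero _), false_iff]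
    rintro rfl; exact h h'
  · have hc : v ∈ Kᶜ := Finset.mem_compl.2 h
    have hc' : v' ∈ Kᶜ := Finset.mem_compl.2 h'
    rw [identify, identify, dif_pos hc, dif_pos hc', Fin.succ_inj]
    simp only [h, false_and, or_false]
    constructor
    · intro e
      rw [← orderEmbOfFin_indexIn _ v hc, e, orderEmbOfFin_indexIn]
    · rintro rfl; rfl

/-- `contractEdge` drops the label `j`, whereas `identify` puts the merged vertex first. The two
quotients differ by a relabelling. -/
lemma weight_contractEdge (W : FeynmanAlgebra →ₐ[ℝ] ℝ) {n m : ℕ} (Γ : Graph (n + 1) m) (a : ℕ)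
    (i j : Fin (n + 1)) (h : i ≠ j) :
    W (gen (contractEdge Γ a i j h)) = weight W ((Γ.eraseIdx a).map (identifyEdge {i, j})) := by
  let τ₀ : Fin n → Fin (({i, j} : Finset (Fin (n + 1)))ᶜ.card + 1) := fun x =>
    identify {i, j} (finSuccAboveEquiv j x).1
  have hτ : Function.Bijective τ₀ := by
    constructor
    · intro x y hxy
      apply (finSuccAboveEquiv j).injective
      apply Subtype.ext
      have hx := (finSuccAboveEquiv j x).2
      have hy := (finSuccAboveEquiv j y).2
      rcases identify_eq_iff.1 hxy with h1 | ⟨h1, h2⟩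
      · exact h1
      · simp only [Finset.mem_insert, Finset.mem_singleton] at h1 h2
        rw [h1.resolve_right hx, h2.resolve_right hy]
    · intro z
      cases z using Fin.cases with
      | zero =>
        exact ⟨(finSuccAboveEquiv j).symm ⟨i, h⟩, by simp [τ₀, identify_of_mem]⟩
      | succ z =>
        have hz := Finset.orderEmbOfFin_mem ({i, j} : Finset (Fin (n + 1)))ᶜ rfl z
        have hz' : ({i, j} : Finset (Fin (n + 1)))ᶜ.orderEmbOfFin rfl z ≠ j := by
          intro h'
          rw [h'] at hz
          simp at hz
        refine ⟨(finSuccAboveEquiv j).symm ⟨_, hz'⟩, ?_⟩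
        simp only [τ₀, Equiv.apply_symm_apply]
        exact identify_orderEmbOfFin _ z
  have hm : ∀ v, Equiv.ofBijective τ₀ hτ (mergeVertex i j h v) = identify {i, j} v := by
    intro v
    change τ₀ _ = _
    simp only [τ₀, mergeVertex, Equiv.apply_symm_apply]
    split_ifs with hv
    · subst hv; simp [identify_of_mem]
    · rfl
  rw [← gen_map_equiv (Equiv.ofBijective τ₀ hτ), contractEdge, List.map_map, weight]
  congr 2
  refine List.map_congr_left fun x _ => ?_
  simp only [Function.comp_apply, hm, identifyEdge, Sum.map_map, Function.id_comp]
  congr 2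
  funext v
  exact hm v

lemma map_dInt (W : FeynmanAlgebra →ₐ[ℝ] ℝ) {n m : ℕ} (Γ : Graph n m) :
    W (dInt Γ) = signedPick (contractWeight W) Γ := by
  cases n with
  | zero =>
    cases Γ with
    | nil => simp [dInt, signedPick]
    | cons e l => exact e.1.elim0
  | succ n =>
    rw [← sum_eraseIdx_eq_signedPick, dInt, map_sum]
    refine Finset.sum_congr rfl fun a _ => ?_
    rcases h : Γ.get a with ⟨i, j | w⟩
    · simp only [contractWeight]
      by_cases hij : i = j
      · simp [hij]
      · rw [dif_pos hij, map_smul, if_pos hij, weight_contractEdge, smul_eq_mul]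
    · simp [contractWeight]

lemma isAlt_contractWeight (W : FeynmanAlgebra →ₐ[ℝ] ℝ) {n m : ℕ} (e : Edge n m) :
    IsAlt (contractWeight W e) := by
  obtain ⟨i, j | w⟩ := e
  · intro u v a b
    simp only [contractWeight]
    split_ifs
    · exact (isAlt_weight W).map (identifyEdge {i, j}) u v a b
    · simp
  · intro u v a b
    simp [contractWeight]

lemma isAlt_map_dInt (W : FeynmanAlgebra →ₐ[ℝ] ℝ) {n m : ℕ} :
    IsAlt fun Γ : Graph n m => W (dInt Γ) := by
  simp only [map_dInt]
  exact isAlt_signedPick (isAlt_contractWeight W)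

lemma signedPick_eq_zero {X : Type*} {h : X → List X → ℝ} {l : List X}
    (hl : ∀ e l', l'.length + 1 = l.length → h e l' = 0) : signedPick h l = 0 := by
  induction l generalizing h with
  | nil => rfl
  | cons x l ih =>
    rw [signedPick, hl x l (by simp), ih, sub_zero]
    intro e l' hl'
    exact hl e _ (by simpa using hl')

/-- The quotient has `n - 1` internal vertices, so degree `0` means `l.length + 2 = 2 * (n - 1) +
m`. -/
lemma contractWeight_eq_zero {W : FeynmanAlgebra →ₐ[ℝ] ℝ} (hW : IsWeight W) {n m : ℕ}
    (e : Edge n m) (l : Graph n m) (hl : l.length + 4 ≠ 2 * n + m) : contractWeight W e l = 0 := by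
  obtain ⟨i, j | w⟩ := e
  · simp only [contractWeight]
    split_ifs with hij
    · apply hW.degree_zero
      have h1 : ({i, j} : Finset (Fin n)).card = 2 := Finset.card_pair hij
      have h2 := Finset.card_compl_add_card ({i, j} : Finset (Fin n))
      rw [h1, Fintype.card_fin] at h2
      rw [List.length_map]
      omega
    · rfl
  · rfl

lemma map_dInt_eq_zero {W : FeynmanAlgebra →ₐ[ℝ] ℝ} (hW : IsWeight W) {n m : ℕ}
    (Γ : Graph n m) (hl : Γ.length + 3 ≠ 2 * n + m) : W (dInt Γ) = 0 := by
  rw [map_dInt]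
  exact signedPick_eq_zero fun e l' h => contractWeight_eq_zero hW e l' (by omega)

lemma liftSum_smul {X Y M : Type*} [AddCommGroup M] [Module ℝ M] (fib : Y → Finset X) (c : ℝ)
    (G : List X → M) (l : List Y) :
    liftSum fib (fun L => c • G L) l = c • liftSum fib G l := by
  induction l generalizing G with
  | nil => rfl
  | cons y l ih => simp only [liftSum, ih, Finset.smul_sum]

lemma listSum_smul {X M : Type*} [Fintype X] [AddCommGroup M] [Module ℝ M] (c : ℝ) (E : ℕ)
    (G : List X → M) : listSum E (fun l => c • G l) = c • listSum E G := by
  induction E generalizing G with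
  | zero => rfl
  | succ E ih => simp only [listSum, ih, Finset.smul_sum]

lemma amp_update_neg {V : Type*} [Fintype V] [DecidableEq V] {d : ℕ} (pos : V → ℕ)
    (L : List (V × V × Fin d)) (φ : V → Polyvector d) (u : V) (x : Polyvector d) :
    amp pos L (Function.update φ u (-x)) = -amp pos L (Function.update φ u x) := by
  simp only [← ampMultilinear_apply]
  exact MultilinearMap.map_update_neg _ _ _ _

lemma signedPick_map {X Y : Type*} (f : X → Y) (h : Y → List Y → ℝ) (l : List X) :
    signedPick h (l.map f) = signedPick (fun x l' => h (f x) (l'.map f)) l := by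
  induction l generalizing h with
  | nil => rfl
  | cons x l ih => simp only [List.map_cons, signedPick, ih]

/-- The amplitudes of the graphs with an edge between `i` and `j` sum up to the amplitudes of the
quotient graphs with the bracket of the two polyvectors. -/
lemma liftSum_graphAmp_pair {n m d : ℕ} {i j : Fin n} (hij : i < j)
    {γ : Fin n → Polyvector d} {k : Fin n → ℕ} (hγ : ∀ i, IsHomogeneous (k i) (γ i))
    (f : Fin m → Smooth d) (L' : List (Edge (({i, j} : Finset (Fin n))ᶜ.card + 1) m × Fin d)) :
    ∑ c, liftSum (fun y => Finset.univ.filter fun x : Edge n m × Fin d =>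
        (identifyEdge {i, j} x.1, x.2) = y)
      (fun L => graphAmp γ f (((i, Sum.inl j), c) :: L) +
        graphAmp γ f (((j, Sum.inl i), c) :: L)) L' =
    -(unshuffleSign k {i, j} • graphAmp (Fin.cons (polyvectorQ (γ i) (γ j)) fun a =>
      γ (({i, j} : Finset (Fin n))ᶜ.orderEmbOfFin rfl a)) f L') := by
  set pos : Fin n ⊕ Fin m → ℕ := shiftedPos fun u => u ≠ Sum.inl i ∧ u ≠ Sum.inl j with hpos
  set ε := unshuffleSign k {i, j} with hε
  have hlt : pos (Sum.inl i) < pos (Sum.inl j) := by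
    rw [hpos, shiftedPos_lt_iff]
    right
    simpa [vertexPos] using hij
  have hlt' : ∀ u : Fin n ⊕ Fin m, u ≠ Sum.inl i → u ≠ Sum.inl j →
      pos (Sum.inl i) < pos u ∧ pos (Sum.inl j) < pos u := by
    intro u h1 h2
    rw [hpos, shiftedPos_lt_iff, shiftedPos_lt_iff]
    exact ⟨Or.inl ⟨by simp, h1, h2⟩, Or.inl ⟨by simp, h1, h2⟩⟩
  set ψ : Polyvector d → Fin (({i, j} : Finset (Fin n))ᶜ.card + 1) ⊕ Fin m → Polyvector d :=
    fun x => Sum.elim (Fin.cons x fun a => γ (({i, j} : Finset (Fin n))ᶜ.orderEmbOfFin rfl a))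
      fun w => ofFunction d (f w) with hψ
  have hψu : ∀ x, ψ x = Function.update (ψ 0) (Sum.inl 0) x := by
    intro x
    funext u
    rcases u with v | w
    · cases v using Fin.cases with
      | zero => simp [hψ]
      | succ v => simp [hψ, Fin.succ_ne_zero]
    · simp [hψ]
  -- The vertices `i` and `j` are moved to the front; this is the origin of the Koszul sign.
  have hre : ∀ L : List (Edge n m × Fin d), graphAmp γ f L =
      ε • amp pos (L.map toColoured) (vertexFields γ f) := by
    intro L
    rw [graphAmp, amp_reorder vertexPos_injective (shiftedPos_injective fun u : Fin n ⊕ Fin m =>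
      u ≠ Sum.inl i ∧ u ≠ Sum.inl j) _ _ _
      (isHomogeneous_vertexFields hγ f), reorderSign_shiftedPos _ k {i, j}]
    intro v
    simp only [Finset.mem_insert, Finset.mem_singleton, ne_eq, Sum.inl.injEq]
    tauto
  have hlift : ∀ (s t : Fin n) (c : Fin d), (s = i ∧ t = j) ∨ (s = j ∧ t = i) →
      liftSum (fun y => Finset.univ.filter fun x : Edge n m × Fin d =>
        (identifyEdge {i, j} x.1, x.2) = y)
        (fun L => graphAmp γ f (((s, Sum.inl t), c) :: L)) L' =
      ε • amp vertexPos (L'.map toColoured) (ψ (wedge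
        (edgeOp pos (toColoured ((s, Sum.inl t), c)) (Sum.inl i) (γ i))
        (edgeOp pos (toColoured ((s, Sum.inl t), c)) (Sum.inl j) (γ j)))) := by
    intro s t c hst
    -- All other vertices now come after both ends of the edge, so it does not touch them.
    have e1 : ∀ u : Fin n ⊕ Fin m, u ≠ Sum.inl i → u ≠ Sum.inl j →
        edgeOp pos (toColoured ((s, Sum.inl t), c)) u = LinearMap.id := by
      intro u h1 h2
      obtain ⟨h3, h4⟩ := hlt' u h1 h2
      rcases hst with ⟨rfl, rfl⟩ | ⟨rfl, rfl⟩ <;>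
        simp [edgeOp, toColoured, startOp, endOp, h1, h2, not_lt_of_gt h3, not_lt_of_gt h4]
    have e2 : ψ (wedge (edgeOp pos (toColoured ((s, Sum.inl t), c)) (Sum.inl i) (γ i))
        (edgeOp pos (toColoured ((s, Sum.inl t), c)) (Sum.inl j) (γ j))) =
        (Sum.elim (Fin.cons (wedge
          (edgeOp pos (toColoured ((s, Sum.inl t), c)) (Sum.inl i) (vertexFields γ f (Sum.inl i)))
          (edgeOp pos (toColoured ((s, Sum.inl t), c)) (Sum.inl j) (vertexFields γ f (Sum.inl j))))
          fun a => edgeOp pos (toColoured ((s, Sum.inl t), c))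
            (Sum.inl (({i, j} : Finset (Fin n))ᶜ.orderEmbOfFin rfl a))
            (vertexFields γ f (Sum.inl (({i, j} : Finset (Fin n))ᶜ.orderEmbOfFin rfl a))))
          fun w => edgeOp pos (toColoured ((s, Sum.inl t), c)) (Sum.inr w)
            (vertexFields γ f (Sum.inr w))) := by
      rw [hψ]
      have hmem : ∀ a, ({i, j} : Finset (Fin n))ᶜ.orderEmbOfFin rfl a ≠ i ∧
          ({i, j} : Finset (Fin n))ᶜ.orderEmbOfFin rfl a ≠ j := by
        intro a
        have := Finset.orderEmbOfFin_mem ({i, j} : Finset (Fin n))ᶜ rfl a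
        simpa only [Finset.mem_compl, Finset.mem_insert, Finset.mem_singleton, not_or] using this
      funext u
      rcases u with v | w
      · cases v using Fin.cases with
        | zero => rfl
        | succ a =>
          simp only [Sum.elim_inl, Fin.cons_succ]
          rw [e1 _ (by simpa using (hmem a).1) (by simpa using (hmem a).2)]
          rfl
      · simp only [Sum.elim_inr]
        rw [e1 _ (by simp) (by simp)]
        rfl
    rw [e2]
    simp only [hre, List.map_cons, amp_cons]
    rw [liftSum_smul]
    congr 1
    exact liftSum_amp_identify hij L' _
  have hadd : ∀ c : Fin d, liftSum (fun y => Finset.univ.filter fun x : Edge n m × Fin d =>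
        (identifyEdge {i, j} x.1, x.2) = y)
      (fun L => graphAmp γ f (((i, Sum.inl j), c) :: L) +
        graphAmp γ f (((j, Sum.inl i), c) :: L)) L' =
      ε • amp vertexPos (L'.map toColoured) (ψ (wedge (leftDerL c (γ i)) (coeffDerL c (γ j)) +
        wedge (coeffDerL c (barL d (γ i))) (leftDerL c (γ j)))) := by
    intro c
    have := liftSum_finset_sum (fun y => Finset.univ.filter fun x : Edge n m × Fin d =>
        (identifyEdge {i, j} x.1, x.2) = y) Finset.univ
      (fun (b : Bool) L => if b then graphAmp γ f (((i, Sum.inl j), c) :: L) else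
        graphAmp γ f (((j, Sum.inl i), c) :: L)) L'
    simp only [Fintype.sum_bool, if_true, Bool.false_eq_true, if_false] at this
    rw [this, hlift i j c (Or.inl ⟨rfl, rfl⟩), hlift j i c (Or.inr ⟨rfl, rfl⟩), ← smul_add]
    congr 1
    have e1 : edgeOp pos (toColoured ((i, Sum.inl j), c)) (Sum.inl i) (γ i) = leftDerL c (γ i) := by
      simp [edgeOp, toColoured, startOp, endOp, hij.ne]
    have e2 : edgeOp pos (toColoured ((i, Sum.inl j), c)) (Sum.inl j) (γ j) =
        coeffDerL c (γ j) := by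
      simp [edgeOp, toColoured, startOp, endOp, hij.ne', not_lt_of_gt hlt]
    have e3 : edgeOp pos (toColoured ((j, Sum.inl i), c)) (Sum.inl i) (γ i) =
        coeffDerL c (barL d (γ i)) := by
      simp [edgeOp, toColoured, startOp, endOp, hij.ne, hlt]
    have e4 : edgeOp pos (toColoured ((j, Sum.inl i), c)) (Sum.inl j) (γ j) = leftDerL c (γ j) := by
      simp [edgeOp, toColoured, startOp, endOp, hij.ne']
    rw [e1, e2, e3, e4, hψu (wedge (leftDerL c (γ i)) (coeffDerL c (γ j))),
      hψu (wedge (coeffDerL c (barL d (γ i))) (leftDerL c (γ j))), hψu (_ + _),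
      ← ampMultilinear_apply, ← ampMultilinear_apply, ← ampMultilinear_apply,
      MultilinearMap.map_update_add]
  simp only [hadd]
  rw [← Finset.smul_sum, ← smul_neg]
  congr 1
  rw [graphAmp, show vertexFields (Fin.cons (polyvectorQ (γ i) (γ j)) fun a =>
      γ (({i, j} : Finset (Fin n))ᶜ.orderEmbOfFin rfl a)) f = ψ (polyvectorQ (γ i) (γ j)) from rfl,
    polyvectorQ_eq, hψu (-_), amp_update_neg, amp_update_sum, neg_neg]
  exact Finset.sum_congr rfl fun c _ => by rw [hψu]

lemma sum_offDiag {n : ℕ} {M : Type*} [AddCommGroup M] (T : Fin n → Fin n → M) :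
    ∑ i, ∑ j, (if i ≠ j then T i j else 0) =
      ∑ p : Fin n × Fin n with p.1 < p.2, (T p.1 p.2 + T p.2 p.1) := by
  rw [← Fintype.sum_prod_type' (f := fun i j => if i ≠ j then T i j else 0),
    Finset.sum_add_distrib, Finset.sum_filter, Finset.sum_filter,
    ← (Equiv.prodComm (Fin n) (Fin n)).sum_comp (fun p => if p.1 < p.2 then T p.2 p.1 else 0),
    ← Finset.sum_add_distrib]
  refine Finset.sum_congr rfl fun p _ => ?_
  simp only [Equiv.prodComm_apply, Prod.fst_swap, Prod.snd_swap]
  rcases lt_trichotomy p.1 p.2 with h | h | h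
  · simp [h, h.ne, not_lt_of_gt h]
  · simp [h]
  · simp [h, h.ne', not_lt_of_gt h]

/-- The contracted edge is picked from the list and its sign is absorbed by the amplitude. For each
pair `i < j` the two directions of the edge are combined, the remaining edges are grouped by their
images in the quotient, and `liftSum_graphAmp_pair` evaluates the fibres. -/
lemma ampSum_dInt {W : FeynmanAlgebra →ₐ[ℝ] ℝ} (hW : IsWeight W) {n m d : ℕ}
    {γ : Fin n → Polyvector d} {k : Fin n → ℕ} (hγ : ∀ i, IsHomogeneous (k i) (γ i))
    (f : Fin m → Smooth d) :
    ampSum (fun Γ : Graph n m => W (dInt Γ)) γ f =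
      -∑ p : Fin n × Fin n with p.1 < p.2, unshuffleSign k {p.1, p.2} •
        ampSum (weight W) (Fin.cons (polyvectorQ (γ p.1) (γ p.2))
          fun a => γ ((({p.1, p.2} : Finset (Fin n))ᶜ).orderEmbOfFin rfl a)) f := by
  -- With fewer than two internal vertices there is nothing to contract; otherwise `2 * n + m ≥ 4`
  -- and the number `E` of remaining edges is a natural number.
  by_cases hn : n < 2
  · have h1 : ∀ i j : Fin n, i = j := fun i j => Fin.ext (by omega)
    have h2 : (Finset.univ.filter fun p : Fin n × Fin n => p.1 < p.2) = ∅ := by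
      ext p
      simp [h1 p.1 p.2]
    rw [h2, Finset.sum_empty, neg_zero, ampSum]
    refine Finset.sum_eq_zero fun S _ => ?_
    rw [map_dInt, signedPick_eq_zero, zero_smul]
    rintro ⟨i, j | w⟩ l' _
    · simp [contractWeight, h1 i j]
    · rfl
  · obtain ⟨E, hE⟩ : ∃ E, E + 4 = 2 * n + m := ⟨2 * n + m - 4, by omega⟩
    rw [ampSum_eq_listSum (E := E + 1) (isAlt_map_dInt W)
      (fun Γ h => map_dInt_eq_zero hW Γ (by omega))]
    have h1 : (fun L : List (Edge n m × Fin d) => W (dInt (L.map Prod.fst)) • graphAmp γ f L) =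
        pick fun x L => contractWeight W x.1 (L.map Prod.fst) • graphAmp γ f (x :: L) := by
      funext L
      rw [map_dInt, signedPick_map, signedPick_smul _ (isAlt_graphAmp γ f)]
    -- The `E + 1` positions of the contracted edge turn `1/(E + 1)!` into the `1/E!` of the
    -- quotients.
    rw [h1, listSum_pick, ← Nat.cast_smul_eq_nsmul ℝ, smul_smul, Nat.factorial_succ, Nat.cast_mul,
      mul_inv, mul_comm, ← mul_assoc, mul_inv_cancel₀ (by exact_mod_cast E.succ_ne_zero), one_mul]
    have h2 : ∑ x : Edge n m × Fin d, listSum E (fun L => contractWeight W x.1 (L.map Prod.fst) •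
        graphAmp γ f (x :: L)) = ∑ i, ∑ j, (if i ≠ j then ∑ c, listSum E (fun L =>
          weight W ((L.map Prod.fst).map (identifyEdge {i, j})) •
            graphAmp γ f (((i, Sum.inl j), c) :: L)) else 0) := by
      rw [Fintype.sum_prod_type, Fintype.sum_prod_type]
      refine Finset.sum_congr rfl fun i _ => ?_
      rw [Fintype.sum_sum_type]
      have : ∑ w : Fin m, ∑ c : Fin d, listSum E (fun L =>
          contractWeight W (i, Sum.inr w) (L.map Prod.fst) •
            graphAmp γ f (((i, Sum.inr w), c) :: L)) = 0 :=
        Finset.sum_eq_zero fun w _ => Finset.sum_eq_zero fun c _ =>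
          listSum_eq_zero fun L _ => by rw [contractWeight, zero_smul]
      rw [this, add_zero]
      refine Finset.sum_congr rfl fun j _ => ?_
      by_cases hij : i = j
      · rw [if_neg (by simpa using hij)]
        exact Finset.sum_eq_zero fun c _ =>
          listSum_eq_zero fun L _ => by simp [contractWeight, hij]
      · rw [if_pos hij]
        exact Finset.sum_congr rfl fun c _ => listSum_congr fun L _ => by simp [contractWeight, hij]
    rw [h2, sum_offDiag, ← Finset.sum_neg_distrib, Finset.smul_sum]
    refine Finset.sum_congr rfl fun p hp => ?_
    obtain ⟨i, j⟩ := p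
    have hij : i < j := (Finset.mem_filter.1 hp).2
    dsimp only
    have hcard : ({i, j} : Finset (Fin n))ᶜ.card + 2 = n := by
      have h1 : ({i, j} : Finset (Fin n)).card = 2 := Finset.card_pair hij.ne
      have h2 := Finset.card_compl_add_card ({i, j} : Finset (Fin n))
      rwa [h1, Fintype.card_fin] at h2
    rw [ampSum_eq_listSum (E := E) (isAlt_weight W)
      (fun Γ h => hW.degree_zero _ _ Γ (by omega)), smul_comm, ← smul_neg]
    congr 1
    rw [Finset.pair_comm j i, ← Finset.sum_add_distrib]
    have h3 : ∀ c : Fin d, listSum E (fun L => weight W ((L.map Prod.fst).map (identifyEdge {i, j})) •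
          graphAmp γ f (((i, Sum.inl j), c) :: L)) +
        listSum E (fun L => weight W ((L.map Prod.fst).map (identifyEdge {i, j})) •
          graphAmp γ f (((j, Sum.inl i), c) :: L)) =
        listSum E fun L' => weight W (L'.map Prod.fst) • liftSum (fun y => Finset.univ.filter
          fun x : Edge n m × Fin d => (identifyEdge {i, j} x.1, x.2) = y)
          (fun L => graphAmp γ f (((i, Sum.inl j), c) :: L) +
            graphAmp γ f (((j, Sum.inl i), c) :: L)) L' := by
      intro c
      rw [← listSum_add, ← listSum_lift (fun x : Edge n m × Fin d => (identifyEdge {i, j} x.1, x.2))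
        (fun L' => weight W (L'.map Prod.fst))]
      refine listSum_congr fun L _ => ?_
      rw [smul_add, List.map_map, List.map_map]
      rfl
    simp only [h3]
    rw [← listSum_finset_sum]
    simp only [← Finset.smul_sum, liftSum_graphAmp_pair hij hγ]
    rw [← neg_smul, ← listSum_smul]
    refine listSum_congr fun L _ => ?_
    rw [smul_neg, smul_comm, neg_smul]

/-! ### Gerstenhaber compositions and collapsed subgraphs -/

section Quotient
variable {n m : ℕ} (J : Finset (Fin n)) {p b : ℕ} (hp : p + b ≤ m)

/-- The map of boundary vertices that collapses `p, …, p + b - 1`. -/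
def quotientBoundary (w : Fin m) : Fin (m - b + 1) :=
  ⟨if (w : ℕ) < p then w else if (w : ℕ) < p + b then p else w - b + 1, by
    have := w.2
    split_ifs <;> omega⟩

/-- The map of vertices that collapses `J` and `p, …, p + b - 1`. -/
noncomputable def quotientVertex : Fin n ⊕ Fin m → Fin Jᶜ.card ⊕ Fin (m - b + 1)
  | Sum.inl v => if hv : v ∈ Jᶜ then Sum.inl (indexIn Jᶜ v hv) else Sum.inr ⟨p, by omega⟩
  | Sum.inr w => Sum.inr (quotientBoundary hp w)

/-- The collapsed vertices. -/
def IsCollapsed (p b : ℕ) : Fin n ⊕ Fin m → Prop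
  | Sum.inl v => v ∈ J
  | Sum.inr w => p ≤ (w : ℕ) ∧ (w : ℕ) < p + b

instance : DecidablePred (IsCollapsed (m := m) J p b) := fun u =>
  match u with
  | Sum.inl v => inferInstanceAs (Decidable (v ∈ J))
  | Sum.inr w => inferInstanceAs (Decidable (p ≤ (w : ℕ) ∧ (w : ℕ) < p + b))

/-- The inclusion of the vertices of a collapsed subgraph. -/
noncomputable def subgraphVertex : Fin J.card ⊕ Fin b → Fin n ⊕ Fin m :=
  Sum.map (J.orderEmbOfFin rfl) fun w => ⟨p + w, by omega⟩

lemma orderEmbOfFin_compl_notMem (a : Fin Jᶜ.card) : Jᶜ.orderEmbOfFin rfl a ∉ J :=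
  Finset.mem_compl.1 (Finset.orderEmbOfFin_mem _ _ _)

/-- The vertices of a graph, as the vertices that are not collapsed and the vertices of the collapsed
subgraph. -/
noncomputable def splitVertices :
    (Fin Jᶜ.card ⊕ {w : Fin m // ¬(p ≤ (w : ℕ) ∧ (w : ℕ) < p + b)}) ⊕ (Fin J.card ⊕ Fin b) ≃
      Fin n ⊕ Fin m :=
  Equiv.ofBijective (Sum.elim (Sum.map (Jᶜ.orderEmbOfFin rfl) Subtype.val) (subgraphVertex J hp)) (by
    constructor
    · apply Function.Injective.sumElim
      · exact Function.Injective.sumMap (Jᶜ.orderEmbOfFin rfl).injective Subtype.val_injective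
      · refine Function.Injective.sumMap (J.orderEmbOfFin rfl).injective fun w w' h => ?_
        have := congrArg Fin.val h
        exact Fin.ext (by simpa using this)
      · rintro (a | w) (a' | w') h
        · simp only [subgraphVertex, Sum.map_inl, Sum.inl.injEq] at h
          exact orderEmbOfFin_compl_notMem J a (h ▸ Finset.orderEmbOfFin_mem _ _ _)
        · simp [subgraphVertex] at h
        · simp [subgraphVertex] at h
        · simp only [subgraphVertex, Sum.map_inr, Sum.inr.injEq] at h
          apply w.2
          rw [h]
          have := w'.2
          simp only
          omega
    · rintro (v | w)
      · by_cases hv : v ∈ J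
        · exact ⟨Sum.inr (Sum.inl (indexIn J v hv)), by simp [subgraphVertex, orderEmbOfFin_indexIn]⟩
        · exact ⟨Sum.inl (Sum.inl (indexIn Jᶜ v (Finset.mem_compl.2 hv))), by
            simp [orderEmbOfFin_indexIn]⟩
      · by_cases hw : p ≤ (w : ℕ) ∧ (w : ℕ) < p + b
        · refine ⟨Sum.inr (Sum.inr ⟨w - p, by omega⟩), ?_⟩
          simp only [subgraphVertex, Sum.elim_inr, Sum.map_inr]
          congr 1
          exact Fin.ext (by simp only; omega)
        · exact ⟨Sum.inl (Sum.inr ⟨w, hw⟩), rfl⟩)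

lemma quotientBoundary_outside (w : Fin m) (hw : ¬(p ≤ (w : ℕ) ∧ (w : ℕ) < p + b)) :
    (quotientBoundary hp w : ℕ) = if (w : ℕ) < p then (w : ℕ) else w - b + 1 := by
  simp only [quotientBoundary]
  split_ifs <;> omega

/-- The vertices of the quotient graph, with the collapsed vertex in front. -/
noncomputable def quotientVertices :
    Option (Fin Jᶜ.card ⊕ {w : Fin m // ¬(p ≤ (w : ℕ) ∧ (w : ℕ) < p + b)}) ≃
      Fin Jᶜ.card ⊕ Fin (m - b + 1) :=
  Equiv.ofBijective (fun o => o.elim (Sum.inr ⟨p, by omega⟩)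
      (Sum.map id fun w => quotientBoundary hp w.1)) (by
    have hne : ∀ w : {w : Fin m // ¬(p ≤ (w : ℕ) ∧ (w : ℕ) < p + b)},
        (quotientBoundary hp w.1 : ℕ) ≠ p := by
      intro w
      rw [quotientBoundary_outside hp w.1 w.2]
      have := w.2
      split_ifs <;> omega
    constructor
    · rintro (_ | a | w) (_ | a' | w') h
      · rfl
      · simp at h
      · simp only [Option.elim, Sum.map_inr, Sum.inr.injEq] at h
        exact absurd (congrArg Fin.val h).symm (hne w')
      · simp at h
      · simpa using h
      · simp at h
      · simp only [Option.elim, Sum.map_inr, Sum.inr.injEq] at h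
        exact absurd (congrArg Fin.val h) (hne w)
      · simp at h
      · simp only [Option.elim, Sum.map_inr, Sum.inr.injEq] at h
        have h' := congrArg Fin.val h
        rw [quotientBoundary_outside hp w.1 w.2, quotientBoundary_outside hp w'.1 w'.2] at h'
        have h1 := w.2
        have h2 := w'.2
        have : w = w' := by
          apply Subtype.ext
          apply Fin.ext
          split_ifs at h' <;> omega
        rw [this]
    · rintro (a | w)
      · exact ⟨some (Sum.inl a), rfl⟩
      · have hw := w.2
        rcases lt_trichotomy (w : ℕ) p with h | h | h
        · refine ⟨some (Sum.inr ⟨⟨w, by omega⟩, by simp only; omega⟩), ?_⟩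
          simp only [Option.elim, Sum.map_inr]
          congr 1
          apply Fin.ext
          simp [quotientBoundary, h]
        · refine ⟨none, ?_⟩
          simp only [Option.elim]
          congr 1
          exact Fin.ext h.symm
        · refine ⟨some (Sum.inr ⟨⟨w + b - 1, by omega⟩, by simp only; omega⟩), ?_⟩
          simp only [Option.elim, Sum.map_inr]
          congr 1
          apply Fin.ext
          simp only [quotientBoundary]
          split_ifs <;> omega)

lemma splitVertices_inl_inl (a) :
    splitVertices J hp (Sum.inl (Sum.inl a)) = Sum.inl (Jᶜ.orderEmbOfFin rfl a) := rfl

lemma splitVertices_inl_inr (w) :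
    splitVertices J hp (Sum.inl (Sum.inr w)) = Sum.inr w.1 := rfl

lemma splitVertices_inr (u) : splitVertices J hp (Sum.inr u) = subgraphVertex J hp u := rfl

lemma quotientVertices_none : quotientVertices J hp none = Sum.inr ⟨p, by omega⟩ := rfl

lemma quotientVertices_some_inl (a) :
    quotientVertices J hp (some (Sum.inl a)) = Sum.inl a := rfl

lemma quotientVertices_some_inr (w) :
    quotientVertices J hp (some (Sum.inr w)) = Sum.inr (quotientBoundary hp w.1) := rfl

/-- Identifies the concrete quotient of vertices with the abstract collapse of
`liftSum_amp_collapse`. -/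
lemma quotientVertex_splitVertices (z) : quotientVertex J hp (splitVertices J hp z) =
    quotientVertices J hp (collapseMap z) := by
  rcases z with (a | w) | (a | w)
  · have h : Jᶜ.orderEmbOfFin rfl a ∈ Jᶜ := Finset.orderEmbOfFin_mem _ _ _
    rw [splitVertices_inl_inl, quotientVertex, dif_pos h, indexIn_orderEmbOfFin]
    rfl
  · rfl
  · have h : J.orderEmbOfFin rfl a ∉ Jᶜ := by
      simp only [Finset.mem_compl, not_not]
      exact Finset.orderEmbOfFin_mem _ _ _
    rw [splitVertices_inr, subgraphVertex, Sum.map_inl, quotientVertex, dif_neg h]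
    rfl
  · rw [splitVertices_inr, subgraphVertex, Sum.map_inr, quotientVertex]
    change _ = Sum.inr _
    congr 1
    apply Fin.ext
    have := w.2
    simp only [quotientBoundary]
    split_ifs <;> omega

lemma isCollapsed_splitVertices_inl (z) : ¬IsCollapsed J p b (splitVertices J hp (Sum.inl z)) := by
  rcases z with a | w
  · exact orderEmbOfFin_compl_notMem J a
  · exact w.2

lemma isCollapsed_subgraphVertex (z) : IsCollapsed J p b (subgraphVertex J hp z) := by
  rcases z with a | w
  · exact Finset.orderEmbOfFin_mem _ _ _
  · have := w.2
    simp only [subgraphVertex, Sum.map_inr, IsCollapsed]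
    omega

lemma shiftedPos_subgraphVertex (u v) :
    shiftedPos (IsCollapsed J p b) (subgraphVertex J hp u) <
      shiftedPos (IsCollapsed J p b) (subgraphVertex J hp v) ↔ vertexPos u < vertexPos v := by
  rw [shiftedPos_lt_iff]
  simp only [isCollapsed_subgraphVertex, not_true_eq_false, false_and, false_or, true_and]
  have hlt : ∀ a, (J.orderEmbOfFin rfl a : ℕ) < n := fun a => Fin.is_lt _
  rcases u with a | w <;> rcases v with a' | w' <;> simp [subgraphVertex, vertexPos]
  · have := hlt a; omega
  · have := hlt a'; omega

lemma shiftedPos_splitVertices_inl (u v) :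
    vertexPos (quotientVertices J hp (some u)) < vertexPos (quotientVertices J hp (some v)) ↔
    shiftedPos (IsCollapsed J p b) (splitVertices J hp (Sum.inl u)) <
      shiftedPos (IsCollapsed J p b) (splitVertices J hp (Sum.inl v)) := by
  rw [shiftedPos_lt_iff]
  simp only [isCollapsed_splitVertices_inl, not_false_eq_true, and_false, false_or, true_and]
  have hlt : ∀ a, (Jᶜ.orderEmbOfFin rfl a : ℕ) < n := fun a => Fin.is_lt _
  rcases u with a | w <;> rcases v with a' | w' <;>
    simp only [quotientVertices_some_inl, quotientVertices_some_inr, splitVertices_inl_inl,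
      splitVertices_inl_inr, vertexPos, Sum.elim_inl, Sum.elim_inr]
  · simp
  · have := hlt a; omega
  · have := hlt a'; omega
  · have h1 := w.2
    have h2 := w'.2
    rw [quotientBoundary_outside hp w.1 w.2, quotientBoundary_outside hp w'.1 w'.2]
    split_ifs <;> omega

/-- The inclusion of the edges that do not start in `J`. -/
noncomputable def outerEdge {d : ℕ} (x : (Fin Jᶜ.card × (Fin n ⊕ Fin m)) × Fin d) :
    Edge n m × Fin d := ((Jᶜ.orderEmbOfFin rfl x.1.1, x.1.2), x.2)

/-- The inclusion of the edges of a collapsed subgraph. -/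
noncomputable def innerEdge {d : ℕ} (x : Edge J.card b × Fin d) : Edge n m × Fin d :=
  ((J.orderEmbOfFin rfl x.1.1, subgraphVertex J hp x.1.2), x.2)

/-- The map of edges that do not start in `J` to edges of the quotient. -/
noncomputable def quotientEdge {d : ℕ} (x : (Fin Jᶜ.card × (Fin n ⊕ Fin m)) × Fin d) :
    Edge Jᶜ.card (m - b + 1) × Fin d := ((x.1.1, quotientVertex J hp x.1.2), x.2)

/-- Moving the collapsed vertices to the end costs the unshuffle sign of `Jᶜ`; then
`liftSum_amp_collapse` applies. The value of `f'` at `p` is overwritten and therefore arbitrary. -/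
lemma liftSum_graphAmp_collapse {d : ℕ} {γ : Fin n → Polyvector d} {k : Fin n → ℕ}
    (hγ : ∀ i, IsHomogeneous (k i) (γ i)) (f : Fin m → Smooth d)
    (f' : Fin (m - b + 1) → Smooth d)
    (hf' : ∀ w : Fin m, ¬(p ≤ (w : ℕ) ∧ (w : ℕ) < p + b) → f' (quotientBoundary hp w) = f w)
    (L' : List (Edge Jᶜ.card (m - b + 1) × Fin d)) (L₂ : List (Edge J.card b × Fin d)) :
    liftSum (fun y => Finset.univ.filter fun x => quotientEdge J hp x = y)
      (fun L => graphAmp γ f (L.map (outerEdge J) ++ L₂.map (innerEdge J hp))) L' =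
    unshuffleSign k Jᶜ • graphAmp (fun a => γ (Jᶜ.orderEmbOfFin rfl a))
      (Function.update f' ⟨p, by omega⟩ (graphAmp (fun a => γ (J.orderEmbOfFin rfl a))
        (fun w => f ⟨p + w, by omega⟩) L₂)) L' := by
  set e := splitVertices J hp
  set e' := quotientVertices J hp
  set φ := vertexFields γ f
  have h1 : ∀ L : List ((Fin Jᶜ.card × (Fin n ⊕ Fin m)) × Fin d),
      graphAmp γ f (L.map (outerEdge J) ++ L₂.map (innerEdge J hp)) = unshuffleSign k Jᶜ •
      amp (fun a => shiftedPos (IsCollapsed J p b) (e a))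
        ((L.map fun x => (Sum.inl x.1.1, e.symm x.1.2, x.2)).map
          (fun x => (Sum.inl x.1, x.2.1, x.2.2)) ++ (L₂.map toColoured).map (mapEdge Sum.inr))
        fun a => φ (e a) := by
    intro L
    rw [graphAmp, amp_reorder vertexPos_injective (shiftedPos_injective (IsCollapsed J p b)) _ _ _
      (isHomogeneous_vertexFields hγ f), reorderSign_shiftedPos _ k Jᶜ]
    · congr 1
      rw [← amp_map e]
      congr 1
      simp only [List.map_append, List.map_map]
      congr 1
      · refine List.map_congr_left fun x _ => ?_
        simp [mapEdge, toColoured, outerEdge, e, splitVertices_inl_inl]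
    · intro v
      simp [IsCollapsed]
  simp only [h1]
  rw [liftSum_smul]
  congr 1
  rw [liftSum_map (fun x : (Fin Jᶜ.card × (Fin n ⊕ Fin m)) × Fin d =>
      ((Sum.inl x.1.1, e.symm x.1.2, x.2) :
        (Fin Jᶜ.card ⊕ {w : Fin m // ¬(p ≤ (w : ℕ) ∧ (w : ℕ) < p + b)}) × _ × Fin d))
    (e' := fun y => (Sum.inl y.1.1, e'.symm y.1.2, y.2)) (fib' := collapseFiber)
    (G := fun L => amp (fun a => shiftedPos (IsCollapsed J p b) (e a))
      (L.map (fun x => (Sum.inl x.1, x.2.1, x.2.2)) ++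
        (L₂.map toColoured).map (mapEdge Sum.inr)) fun a => φ (e a)),
    liftSum_amp_collapse (pos' := fun o => vertexPos (e' o))]
  · have h2 : (fun o : Option (Fin Jᶜ.card ⊕ {w : Fin m // ¬(p ≤ (w : ℕ) ∧ (w : ℕ) < p + b)}) =>
        o.elim (ofFunction d (amp (fun v => shiftedPos (IsCollapsed J p b) (e (Sum.inr v)))
          (L₂.map toColoured) fun v => φ (e (Sum.inr v)))) fun u => φ (e (Sum.inl u))) =
        fun o => vertexFields (fun a => γ (Jᶜ.orderEmbOfFin rfl a))
          (Function.update f' ⟨p, by omega⟩ (graphAmp (fun a => γ (J.orderEmbOfFin rfl a))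
          (fun w => f ⟨p + w, by omega⟩) L₂)) (e' o) := by
      funext o
      rcases o with _ | a | w
      · have h3 : (fun v => φ (e (Sum.inr v))) = vertexFields (fun a => γ (J.orderEmbOfFin rfl a))
            fun w : Fin b => f ⟨p + w, by omega⟩ := by
          funext v
          cases v <;> rfl
        simp only [Option.elim, e', quotientVertices_none, vertexFields, Sum.elim_inr,
          Function.update_self]
        rw [h3, graphAmp]
        congr 1
        exact amp_congr_pos (shiftedPos_subgraphVertex J hp) _ _
      · rfl
      · have hne : quotientBoundary hp w.1 ≠ ⟨p, by omega⟩ := by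
          intro h
          exact absurd (e'.injective (a₁ := some (Sum.inr w)) (a₂ := none)
            (congrArg Sum.inr h)) (by simp)
        simp only [Option.elim, e', quotientVertices_some_inr, vertexFields, Sum.elim_inr,
          Function.update_of_ne hne, hf' w.1 w.2, φ, e, splitVertices_inl_inr]
    rw [h2, ← amp_map e', graphAmp]
    congr 1
    simp only [List.map_map]
    refine List.map_congr_left fun x _ => ?_
    simp [mapEdge, toColoured, e', quotientVertices_some_inl]
  · intro u v
    rw [shiftedPos_lt_iff]
    exact Or.inl ⟨isCollapsed_splitVertices_inl J hp u, isCollapsed_subgraphVertex J hp v⟩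
  · exact shiftedPos_splitVertices_inl J hp
  · rintro ⟨⟨a, t⟩, c⟩ ⟨⟨a', t'⟩, c'⟩ h
    simpa [and_assoc] using h
  · intro x y
    have hx := quotientVertex_splitVertices J hp (e.symm x.1.2)
    simp only [e, Equiv.apply_symm_apply] at hx
    simp only [collapseFiber, Finset.mem_filter, Finset.mem_univ, true_and,
      Prod.ext_iff, Equiv.eq_symm_apply, quotientEdge, hx, e, e', Sum.inl.injEq, and_assoc]
  · intro y z hz
    obtain ⟨z₁, z₂, z₃⟩ := z
    simp only [collapseFiber, Finset.mem_filter, Finset.mem_univ, true_and, Prod.ext_iff] at hz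
    exact ⟨((y.1.1, e z₂), z₃), by simp [hz.1]⟩

end Quotient

/-! ### The coproduct -/

lemma pairCount_swap {X : Type*} (r : X → X → Prop) [DecidableRel r] (u v : List X) (a b : X) :
    pairCount r (u ++ a :: b :: v) + (if r b a then 1 else 0) =
      pairCount r (u ++ b :: a :: v) + if r a b then 1 else 0 := by
  induction u with
  | nil =>
    simp only [List.nil_append, pairCount, List.countP_cons, decide_eq_true_eq]
    omega
  | cons x u ih =>
    simp only [List.cons_append, pairCount, List.countP_append, List.countP_cons] at ih ⊢
    omega

lemma pairCount_eq_zero {X : Type*} (r : X → X → Prop) [DecidableRel r] {l : List X}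
    (h : l.Pairwise fun x y => ¬r x y) : pairCount r l = 0 := by
  induction h with
  | nil => rfl
  | cons hx _ ih =>
    rw [pairCount, ih, add_zero, List.countP_eq_zero]
    simpa using hx

section Coproduct
variable {n m : ℕ} (J : Finset (Fin n)) {p b : ℕ} (hp : p + b ≤ m)

lemma splitSign_eq (Γ : Graph n m) :
    splitSign Γ J = (-1) ^ pairCount (fun x y : Edge n m => x.1 ∈ J ∧ y.1 ∉ J) Γ := by
  rw [splitSign, card_pairs_eq_pairCount fun x y : Edge n m => x.1 ∈ J ∧ y.1 ∉ J]

lemma splitSign_swap (u v : Graph n m) (a b : Edge n m) :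
    splitSign (u ++ a :: b :: v) J =
      (if (a.1 ∈ J ↔ b.1 ∈ J) then 1 else -1) * splitSign (u ++ b :: a :: v) J := by
  have := pairCount_swap (fun x y : Edge n m => x.1 ∈ J ∧ y.1 ∉ J) u v a b
  rw [splitSign_eq, splitSign_eq]
  by_cases ha : a.1 ∈ J <;> by_cases hb : b.1 ∈ J <;>
    simp only [ha, hb, not_true_eq_false, not_false_eq_true, and_true, and_false, if_true,
      if_false, iff_true, iff_false, add_zero] at this ⊢
  · rw [this, one_mul]
  · rw [this, pow_succ]; ring
  · rw [← this, pow_succ]; ring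
  · rw [this, one_mul]

lemma quotientGraph_append (u v : Graph n m) :
    quotientGraph (u ++ v) J p b hp = quotientGraph u J p b hp ++ quotientGraph v J p b hp :=
  List.filterMap_append

lemma quotientGraph_cons_of_mem {a : Edge n m} (ha : a.1 ∈ J) (l : Graph n m) :
    quotientGraph (a :: l) J p b hp = quotientGraph l J p b hp :=
  List.filterMap_cons_none (by simp [ha])

lemma quotientGraph_cons_of_notMem {a : Edge n m} (ha : a.1 ∉ J) (l : Graph n m) :
    quotientGraph (a :: l) J p b hp =
      (indexIn Jᶜ a.1 (Finset.mem_compl.2 ha), quotientVertex J hp a.2) ::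
        quotientGraph l J p b hp := by
  apply List.filterMap_cons_some
  rw [dif_pos (Finset.mem_compl.2 ha)]
  rcases a with ⟨s, v | w⟩ <;> rfl

lemma subgraph_append (u v : Graph n m) (p b : ℕ) :
    subgraph (u ++ v) J p b = subgraph u J p b ++ subgraph v J p b :=
  List.filterMap_append

lemma subgraph_cons_of_notMem {a : Edge n m} (ha : a.1 ∉ J) (l : Graph n m) (p b : ℕ) :
    subgraph (a :: l) J p b = subgraph l J p b :=
  List.filterMap_cons_none (by simp [ha])

lemma subgraph_cons_of_mem {a : Edge n m} (ha : a.1 ∈ J) {p b : ℕ} (ha' : IsCollapsed J p b a.2) :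
    ∃ t, ∀ l, subgraph (a :: l) J p b = (indexIn J a.1 ha, t) :: subgraph l J p b := by
  rcases a with ⟨s, v | w⟩
  · refine ⟨Sum.inl (indexIn J v ha'), fun l => List.filterMap_cons_some ?_⟩
    have ha' : v ∈ J := ha'
    simp only at ha
    simp [ha, ha']
  · refine ⟨Sum.inr ⟨w - p, by have : _ ∧ _ := ha'; omega⟩, fun l => List.filterMap_cons_some ?_⟩
    have ha' : p ≤ (w : ℕ) ∧ (w : ℕ) < p + b := ha'
    simp only at ha
    simp [ha, ha']

lemma isNormal_iff (Γ : Graph n m) (p b : ℕ) : IsNormal Γ J p b ↔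
    2 ≤ 2 * J.card + b ∧ J.card + b < n + m ∧ ∀ e ∈ Γ, e.1 ∈ J → IsCollapsed J p b e.2 := by
  rw [IsNormal]
  refine and_congr_right fun _ => and_congr_right fun _ => forall₃_congr fun e _ _ => ?_
  rcases e with ⟨s, v | w⟩ <;> rfl

open Classical in
/-- The contribution of a subgraph to the weight of the coproduct. -/
noncomputable def coWeight (W : FeynmanAlgebra →ₐ[ℝ] ℝ) (Γ : Graph n m) : ℝ :=
  if IsNormal Γ J p b then
    splitSign Γ J * (weight W (quotientGraph Γ J p b hp) * weight W (subgraph Γ J p b))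
  else 0

/-- Exactly one factor changes sign: the weight of the subgraph if both edges start in `J`, that of
the quotient if neither does, and `splitSign` in the mixed case. -/
lemma isAlt_coWeight (W : FeynmanAlgebra →ₐ[ℝ] ℝ) : IsAlt (coWeight J hp W) := by
  intro u v x y
  have hN : IsNormal (u ++ x :: y :: v) J p b ↔ IsNormal (u ++ y :: x :: v) J p b := by
    rw [isNormal_iff, isNormal_iff]
    refine and_congr_right fun _ => and_congr_right fun _ => forall_congr' fun e => ?_
    have : e ∈ u ++ x :: y :: v ↔ e ∈ u ++ y :: x :: v := by
      simp only [List.mem_append, List.mem_cons]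
      tauto
    rw [this]
  rw [coWeight, coWeight]
  by_cases h : IsNormal (u ++ x :: y :: v) J p b
  swap
  · rw [if_neg h, if_neg (hN.not.1 h), neg_zero]
  rw [if_pos h, if_pos (hN.1 h), splitSign_swap]
  have hc := ((isNormal_iff J _ p b).1 h).2.2
  have hx := hc x (by simp)
  have hy := hc y (by simp)
  rw [quotientGraph_append, quotientGraph_append, subgraph_append, subgraph_append]
  by_cases hxJ : x.1 ∈ J <;> by_cases hyJ : y.1 ∈ J
  · obtain ⟨t, ht⟩ := subgraph_cons_of_mem J hxJ (hx hxJ)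
    obtain ⟨t', ht'⟩ := subgraph_cons_of_mem J hyJ (hy hyJ)
    simp only [quotientGraph_cons_of_mem J hp hxJ, quotientGraph_cons_of_mem J hp hyJ, ht, ht',
      hxJ, hyJ, if_true]
    rw [isAlt_weight W]
    ring
  · obtain ⟨t, ht⟩ := subgraph_cons_of_mem J hxJ (hx hxJ)
    simp only [quotientGraph_cons_of_mem J hp hxJ, quotientGraph_cons_of_notMem J hp hyJ, ht,
      subgraph_cons_of_notMem J hyJ, hxJ, hyJ, iff_false, not_true_eq_false, if_false]
    ring
  · obtain ⟨t, ht⟩ := subgraph_cons_of_mem J hyJ (hy hyJ)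
    simp only [quotientGraph_cons_of_mem J hp hyJ, quotientGraph_cons_of_notMem J hp hxJ, ht,
      subgraph_cons_of_notMem J hxJ, hxJ, hyJ, iff_true, if_false]
    ring
  · simp only [quotientGraph_cons_of_notMem J hp hxJ, quotientGraph_cons_of_notMem J hp hyJ,
      subgraph_cons_of_notMem J hxJ, subgraph_cons_of_notMem J hyJ, hxJ, hyJ, if_true]
    rw [isAlt_weight W]
    ring

lemma length_quotientGraph_add {Γ : Graph n m}
    (h : ∀ e ∈ Γ, e.1 ∈ J → IsCollapsed J p b e.2) :
    (quotientGraph Γ J p b hp).length + (subgraph Γ J p b).length = Γ.length := by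
  induction Γ with
  | nil => rfl
  | cons a l ih =>
    have ih := ih fun e he => h e (List.mem_cons_of_mem _ he)
    by_cases ha : a.1 ∈ J
    · obtain ⟨t, ht⟩ := subgraph_cons_of_mem J ha (h a (by simp) ha)
      rw [quotientGraph_cons_of_mem J hp ha, ht, List.length_cons, List.length_cons]
      omega
    · rw [quotientGraph_cons_of_notMem J hp ha, subgraph_cons_of_notMem J ha, List.length_cons,
        List.length_cons]
      omega

/-- If quotient and subgraph both have degree `0`, their edges number `(2|Jᶜ| + (m - b + 1) - 2) +
(2|J| + b - 2) = 2n + m - 3`. -/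
lemma coWeight_eq_zero {W : FeynmanAlgebra →ₐ[ℝ] ℝ} (hW : IsWeight W) (Γ : Graph n m)
    (hl : Γ.length + 3 ≠ 2 * n + m) : coWeight J hp W Γ = 0 := by
  rw [coWeight]
  split_ifs with h
  · have h1 := length_quotientGraph_add J hp ((isNormal_iff J _ p b).1 h).2.2
    have h2 := Finset.card_compl_add_card J
    rw [Fintype.card_fin] at h2
    by_cases h3 : (quotientGraph Γ J p b hp).length + 2 = 2 * Jᶜ.card + (m - b + 1)
    · rw [weight, weight, hW.degree_zero _ _ (subgraph Γ J p b) (by omega), mul_zero, mul_zero]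
    · rw [weight, hW.degree_zero _ _ _ h3, zero_mul, mul_zero]
  · rfl

lemma map_coprodB (W : FeynmanAlgebra →ₐ[ℝ] ℝ) (Γ : Graph n m) :
    W (coprodB Γ) = ∑ J : Finset (Fin n), ∑ p ∈ Finset.range (m + 1), ∑ b ∈ Finset.range (m + 1),
      if hp : p + b ≤ m then (-1 : ℝ) ^ (m - b + 1 + p * (b + 1)) * coWeight J hp W Γ else 0 := by
  rw [coprodB, map_sum]
  refine Finset.sum_congr rfl fun J _ => ?_
  rw [map_sum]
  refine Finset.sum_congr rfl fun p _ => ?_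
  rw [map_sum]
  refine Finset.sum_congr rfl fun b _ => ?_
  split_ifs with hp hn
  · rw [coWeight, if_pos hn, map_smul, map_mul, smul_eq_mul, mul_assoc]
    rfl
  · rw [coWeight, if_neg hn, map_zero, mul_zero]
  · rw [map_zero]

lemma outerEdge_injective {d : ℕ} :
    Function.Injective (outerEdge J : (Fin Jᶜ.card × (Fin n ⊕ Fin m)) × Fin d → _) := by
  rintro ⟨⟨a, t⟩, c⟩ ⟨⟨a', t'⟩, c'⟩ h
  simpa [outerEdge] using h

lemma innerEdge_injective {d : ℕ} :
    Function.Injective (innerEdge J hp : Edge J.card b × Fin d → _) := by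
  have hi : Function.Injective (subgraphVertex J hp) := fun u v h =>
    Sum.inr_injective ((splitVertices J hp).injective h)
  rintro ⟨⟨a, t⟩, c⟩ ⟨⟨a', t'⟩, c'⟩ h
  simpa [innerEdge, hi.eq_iff] using h

lemma outerEdge_notMem {d : ℕ} (x : (Fin Jᶜ.card × (Fin n ⊕ Fin m)) × Fin d) :
    (outerEdge J x).1.1 ∉ J := orderEmbOfFin_compl_notMem J _

lemma innerEdge_mem {d : ℕ} (x : Edge J.card b × Fin d) :
    (innerEdge J hp x).1.1 ∈ J := Finset.orderEmbOfFin_mem _ _ _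

lemma quotientGraph_split {d : ℕ} (LA : List ((Fin Jᶜ.card × (Fin n ⊕ Fin m)) × Fin d))
    (LB : List (Edge J.card b × Fin d)) :
    quotientGraph ((LA.map (outerEdge J) ++ LB.map (innerEdge J hp)).map Prod.fst) J p b hp =
      (LA.map (quotientEdge J hp)).map Prod.fst := by
  induction LA with
  | nil =>
    simp only [List.map_nil, List.nil_append]
    induction LB with
    | nil => rfl
    | cons x l ih =>
      rw [List.map_cons, List.map_cons, quotientGraph_cons_of_mem J hp (innerEdge_mem J hp x), ih]
  | cons x l ih =>
    rw [List.map_cons, List.cons_append, List.map_cons,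
      quotientGraph_cons_of_notMem J hp (outerEdge_notMem J x), ih, List.map_cons, List.map_cons]
    congr 1
    simp only [quotientEdge, outerEdge, indexIn_orderEmbOfFin]

lemma subgraph_split {d : ℕ} (LA : List ((Fin Jᶜ.card × (Fin n ⊕ Fin m)) × Fin d))
    (LB : List (Edge J.card b × Fin d)) :
    subgraph ((LA.map (outerEdge J) ++ LB.map (innerEdge J hp)).map Prod.fst) J p b =
      LB.map Prod.fst := by
  induction LA with
  | nil =>
    simp only [List.map_nil, List.nil_append]
    induction LB with
    | nil => rfl
    | cons x l ih =>
      rw [List.map_cons, List.map_cons, List.map_cons, ← ih]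
      apply List.filterMap_cons_some
      have h := innerEdge_mem J hp x
      obtain ⟨⟨a, v | w⟩, c⟩ := x
      · have h' : J.orderEmbOfFin rfl v ∈ J := Finset.orderEmbOfFin_mem _ _ _
        rw [dif_pos h]
        simp only [innerEdge, subgraphVertex, Sum.map_inl, dif_pos h', indexIn_orderEmbOfFin]
      · have h' : p ≤ p + (w : ℕ) ∧ p + (w : ℕ) < p + b := by omega
        rw [dif_pos h]
        simp only [innerEdge, subgraphVertex, Sum.map_inr, dif_pos h', indexIn_orderEmbOfFin,
          add_tsub_cancel_left]
  | cons x l ih =>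
    rw [List.map_cons, List.cons_append, List.map_cons,
      subgraph_cons_of_notMem J (outerEdge_notMem J x), ih]

/-- With the outer edges in front `splitSign` is `1`. The right side has no normality condition, so
all terms of the Gerstenhaber composition are matched. -/
lemma coWeight_split {W : FeynmanAlgebra →ₐ[ℝ] ℝ} (hW : IsWeight W) {d : ℕ}
    (LA : List ((Fin Jᶜ.card × (Fin n ⊕ Fin m)) × Fin d))
    (LB : List (Edge J.card b × Fin d)) :
    coWeight J hp W ((LA.map (outerEdge J) ++ LB.map (innerEdge J hp)).map Prod.fst) =
      weight W (LB.map Prod.fst) * weight W ((LA.map (quotientEdge J hp)).map Prod.fst) := by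
  rw [coWeight, quotientGraph_split, subgraph_split]
  split_ifs with h
  · rw [splitSign_eq, pairCount_eq_zero, pow_zero, one_mul, mul_comm]
    rw [List.map_append, List.pairwise_append]
    refine ⟨?_, ?_, ?_⟩
    · refine List.Pairwise.imp_of_mem (R := fun _ _ => True) ?_ (List.pairwise_of_forall fun _ _ => trivial)
      intro x y hx _ _ hxy
      simp only [List.map_map, List.mem_map] at hx
      obtain ⟨x, _, rfl⟩ := hx
      exact outerEdge_notMem J x hxy.1
    · refine List.Pairwise.imp_of_mem (R := fun _ _ => True) ?_ (List.pairwise_of_forall fun _ _ => trivial)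
      intro x y _ hy _ hxy
      simp only [List.map_map, List.mem_map] at hy
      obtain ⟨y, _, rfl⟩ := hy
      exact hxy.2 (innerEdge_mem J hp y)
    · intro x hx y hy hxy
      simp only [List.map_map, List.mem_map] at hx
      obtain ⟨x, _, rfl⟩ := hx
      exact outerEdge_notMem J x hxy.1
  -- No edge of the list leaves the subgraph, so only a size condition can fail. Then either the
  -- quotient is of type `(0,1)` or the subgraph is of type `(0,b)` with `b ≤ 1`; both are without
  -- edges and not of degree `0`.
  · have h1 : ¬(2 ≤ 2 * J.card + b ∧ J.card + b < n + m) := by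
      intro h1
      refine h ((isNormal_iff J _ p b).2 ⟨h1.1, h1.2, ?_⟩)
      intro e he heJ
      simp only [List.map_append, List.map_map, List.mem_append, List.mem_map] at he
      rcases he with ⟨x, _, rfl⟩ | ⟨x, _, rfl⟩
      · exact absurd heJ (outerEdge_notMem J x)
      · exact isCollapsed_subgraphVertex J hp _
    have h2 := Finset.card_compl_add_card J
    rw [Fintype.card_fin] at h2
    by_cases h3 : 2 ≤ 2 * J.card + b
    · have h4 : Jᶜ.card = 0 := by omega
      have h5 : LA = [] := by
        rw [List.eq_nil_iff_forall_not_mem]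
        intro x _
        exact absurd x.1.1.2 (by omega)
      subst h5
      rw [weight, weight, hW.degree_zero _ _ ((List.map _ _).map _), mul_zero]
      simp only [List.map_nil, List.length_nil]
      omega
    · have h5 : LB = [] := by
        rw [List.eq_nil_iff_forall_not_mem]
        intro x _
        exact absurd x.1.1.2 (by omega)
      subst h5
      rw [weight, hW.degree_zero _ _ (List.map _ _), zero_mul]
      simp only [List.map_nil, List.length_nil]
      omega

end Coproduct

/-! ### ### The coproduct as composition of operators -/

lemma graphAmp_update_sum {n m d : ℕ} {ι : Type*} (γ : Fin n → Polyvector d)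
    (f : Fin m → Smooth d) (w : Fin m) (s : Finset ι) (c : ι → ℝ) (x : ι → Smooth d)
    (L : List (Edge n m × Fin d)) :
    graphAmp γ (Function.update f w (∑ i ∈ s, c i • x i)) L =
      ∑ i ∈ s, c i • graphAmp γ (Function.update f w (x i)) L := by
  have h : ∀ y, vertexFields γ (Function.update f w y) =
      Function.update (vertexFields γ f) (Sum.inr w) (ofFunction d y) := by
    intro y
    funext u
    rcases u with v | w'
    · simp [vertexFields]
    · by_cases hw : w' = w
      · subst hw; simp [vertexFields]
      · simp [vertexFields, hw]
  simp only [graphAmp, h, map_sum, map_smul, amp_update_sum, amp_update_smul]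

lemma ampSum_update_sum {n m d : ℕ} {ι : Type*} (c' : Graph n m → ℝ) (γ : Fin n → Polyvector d)
    (f : Fin m → Smooth d) (w : Fin m) (s : Finset ι) (c : ι → ℝ) (x : ι → Smooth d) :
    ampSum c' γ (Function.update f w (∑ i ∈ s, c i • x i)) =
      ∑ i ∈ s, c i • ampSum c' γ (Function.update f w (x i)) := by
  simp only [ampSum, graphAmp_update_sum, Finset.smul_sum]
  rw [Finset.sum_comm]
  exact Finset.sum_congr rfl fun i _ => Finset.sum_congr rfl fun S _ => smul_comm _ _ _

/-- A set of edges on which `coWeight` is nonzero splits into outer edges, starting outside `J`, and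
edges of the subgraph. For fixed inner edges, the outer ones are grouped by their images in the
quotient and the collapse formula is applied; linearity in the inserted function then restores the
sum over the inner edges. -/
lemma ampSum_coWeight {W : FeynmanAlgebra →ₐ[ℝ] ℝ} (hW : IsWeight W) {n m d : ℕ}
    (J : Finset (Fin n)) {p b : ℕ} (hp : p + b ≤ m) {γ : Fin n → Polyvector d} {k : Fin n → ℕ}
    (hγ : ∀ i, IsHomogeneous (k i) (γ i)) (f : Fin m → Smooth d)
    (f' : Fin (m - b + 1) → Smooth d)
    (hf' : ∀ w : Fin m, ¬(p ≤ (w : ℕ) ∧ (w : ℕ) < p + b) → f' (quotientBoundary hp w) = f w) :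
    ampSum (coWeight J hp W) γ f = unshuffleSign k Jᶜ •
      ampSum (weight W) (fun a => γ (Jᶜ.orderEmbOfFin rfl a))
        (Function.update f' ⟨p, by omega⟩ (ampSum (weight W)
          (fun a => γ (J.orderEmbOfFin rfl a)) fun w : Fin b => f ⟨p + w, by omega⟩)) := by
  conv_rhs => rw [ampSum.eq_def (weight W) (fun a => γ (J.orderEmbOfFin rfl a)), ampSum_update_sum]
  rw [ampSum, sum_finset_split (outerEdge J) (innerEdge J hp) (outerEdge_injective J)
    (innerEdge_injective J hp) ?_ (fun L => coWeight J hp W (L.map Prod.fst) • graphAmp γ f L)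
    (isSymm_smul_graphAmp (isAlt_coWeight J hp W) γ f), Finset.sum_comm, Finset.smul_sum]
  · refine Finset.sum_congr rfl fun SB _ => ?_
    simp only [coWeight_split J hp hW, mul_smul]
    rw [← Finset.smul_sum, smul_comm]
    congr 1
    by_cases hE : 2 ≤ 2 * Jᶜ.card + (m - b + 1)
    · obtain ⟨E, hE⟩ : ∃ E, E + 2 = 2 * Jᶜ.card + (m - b + 1) := ⟨_, Nat.sub_add_cancel hE⟩
      have hw : ∀ Γ : Graph Jᶜ.card (m - b + 1), Γ.length ≠ E → weight W Γ = 0 :=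
        fun Γ h => hW.degree_zero _ _ _ (by omega)
      rw [ampSum_eq_listSum (E := E) (isAlt_weight W) hw, smul_comm,
        sum_eq_inv_factorial_smul_listSum E (fun L : List ((Fin Jᶜ.card × (Fin n ⊕ Fin m)) × Fin d) =>
          weight W ((L.map (quotientEdge J hp)).map Prod.fst) •
          graphAmp γ f (L.map (outerEdge J) ++ SB.toList.map (innerEdge J hp)))]
      · congr 1
        rw [listSum_lift (quotientEdge J hp) (fun L => weight W (L.map Prod.fst)) (fun L =>
          graphAmp γ f (L.map (outerEdge J) ++ SB.toList.map (innerEdge J hp))), ← listSum_smul]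
        refine listSum_congr fun L _ => ?_
        rw [liftSum_graphAmp_collapse J hp hγ f f' hf', smul_comm]
      · exact IsAlt.isSymm_smul (((isAlt_weight W).map Prod.fst).map (quotientEdge J hp))
          (((isAlt_graphAmp γ f).append_right _).map (outerEdge J))
      · intro l hl
        dsimp only
        have := (((isAlt_graphAmp γ f).append_right
          (SB.toList.map (innerEdge J hp))).map (outerEdge J)).vanishesOnDuplicates l hl
        rw [this, smul_zero]
      · intro l hl
        rw [hw _ (by simpa using hl), zero_smul]
    -- Degree `0` would need a negative number of edges in the quotient, so both sides are `0`.
    · have hw : ∀ Γ : Graph Jᶜ.card (m - b + 1), weight W Γ = 0 :=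
        fun Γ => hW.degree_zero _ _ _ (by omega)
      simp only [ampSum, hw, zero_smul, Finset.sum_const_zero, smul_zero]
  swap
  · intro x y h
    exact outerEdge_notMem J x (h ▸ innerEdge_mem J hp y)
  -- An edge that is neither outer nor inner leads from the subgraph to a vertex outside, which
  -- violates normality.
  · intro l x hx hA hB
    rw [coWeight, if_neg, zero_smul]
    intro hN
    have hc := ((isNormal_iff J _ p b).1 hN).2.2 x.1 (List.mem_map_of_mem hx)
    obtain ⟨⟨s, t⟩, c⟩ := x
    by_cases hs : s ∈ J
    · have ht := hc hs
      obtain ⟨z, rfl⟩ := (splitVertices J hp).surjective t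
      rcases z with z | z
      · exact isCollapsed_splitVertices_inl J hp z ht
      · refine hB ((indexIn J s hs, z), c) ?_
        simp only [innerEdge, orderEmbOfFin_indexIn]
        rfl
    · refine hA ((indexIn Jᶜ s (Finset.mem_compl.2 hs), t), c) ?_
      simp only [outerEdge, orderEmbOfFin_indexIn]

/-! ### The coboundary of a weight -/

lemma coboundary_eq (W : FeynmanAlgebra →ₐ[ℝ] ℝ) {n m : ℕ} (Γ : Graph n m) :
    coboundary W Γ = W (dInt Γ) + W (coprodB Γ) := by
  rw [coboundary, totalD, map_add]

lemma isAlt_coboundary (W : FeynmanAlgebra →ₐ[ℝ] ℝ) {n m : ℕ} :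
    IsAlt (coboundary W : Graph n m → ℝ) := by
  intro u v a b
  have h := isAlt_map_dInt W u v a b
  dsimp only at h
  rw [coboundary_eq, coboundary_eq, h, neg_add, map_coprodB, map_coprodB]
  congr 1
  simp only [← Finset.sum_neg_distrib]
  refine Finset.sum_congr rfl fun J _ => Finset.sum_congr rfl fun p _ =>
    Finset.sum_congr rfl fun c _ => ?_
  split_ifs with hp
  · rw [isAlt_coWeight J hp W u v a b, mul_neg]
  · rw [neg_zero]

lemma coboundary_eq_zero_of_length {W : FeynmanAlgebra →ₐ[ℝ] ℝ} (hW : IsWeight W) {n m : ℕ}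
    (Γ : Graph n m) (hl : Γ.length + 3 ≠ 2 * n + m) : coboundary W Γ = 0 := by
  rw [coboundary_eq, map_dInt_eq_zero hW Γ hl, map_coprodB, zero_add]
  refine Finset.sum_eq_zero fun J _ => Finset.sum_eq_zero fun p _ =>
    Finset.sum_eq_zero fun c _ => ?_
  split_ifs with hp
  · rw [coWeight_eq_zero J hp hW Γ hl, mul_zero]
  · rfl

lemma signedPick_eq_zero_of_perm {X : Type*} {h : X → List X → ℝ} {l : List X}
    (hl : ∀ e l', (e :: l').Perm l → h e l' = 0) : signedPick h l = 0 := by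
  induction l generalizing h with
  | nil => rfl
  | cons x l ih =>
    rw [signedPick, hl x l (List.Perm.refl _), ih, sub_zero]
    exact fun e l' h' => hl e _ ((List.Perm.swap x e l').trans (h'.cons x))

lemma weight_eq_zero_of_loop (W : FeynmanAlgebra →ₐ[ℝ] ℝ) {n m : ℕ} {Γ : Graph n m} {v : Fin n}
    (h : (v, Sum.inl v) ∈ Γ) : weight W Γ = 0 := by
  rw [weight, gen_eq_zero, map_zero]
  exact fun hΓ => hΓ.2 _ h rfl

lemma map_dInt_eq_zero_of_loop (W : FeynmanAlgebra →ₐ[ℝ] ℝ) {n m : ℕ} {Γ : Graph n m} {v : Fin n}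
    (h : (v, Sum.inl v) ∈ Γ) : W (dInt Γ) = 0 := by
  rw [map_dInt]
  refine signedPick_eq_zero_of_perm fun e l' hl => ?_
  rcases List.mem_cons.1 (hl.mem_iff.2 h) with rfl | h'
  · simp [contractWeight]
  · obtain ⟨i, j | w⟩ := e
    · rw [contractWeight]
      split_ifs
      · exact weight_eq_zero_of_loop W (v := identify {i, j} v)
          (List.mem_map.2 ⟨_, h', rfl⟩)
      · rfl
    · rfl

lemma coWeight_eq_zero_of_loop (W : FeynmanAlgebra →ₐ[ℝ] ℝ) {n m : ℕ} (J : Finset (Fin n)) {p b : ℕ}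
    (hp : p + b ≤ m) {Γ : Graph n m} {v : Fin n}
    (h : (v, Sum.inl v) ∈ Γ) : coWeight J hp W Γ = 0 := by
  rw [coWeight]
  split_ifs with hN
  · by_cases hv : v ∈ J
    · rw [weight_eq_zero_of_loop W (Γ := subgraph Γ J p b) (v := indexIn J v hv), mul_zero, mul_zero]
      exact List.mem_filterMap.2 ⟨_, h, by simp [hv]⟩
    · have hv' : v ∈ Jᶜ := Finset.mem_compl.2 hv
      rw [weight_eq_zero_of_loop W (Γ := quotientGraph Γ J p b hp) (v := indexIn Jᶜ v hv'),
        zero_mul, mul_zero]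
      refine List.mem_filterMap.2 ⟨_, h, ?_⟩
      rw [dif_pos hv']
      simp only [dif_pos hv']
  · rfl

/-- Repeated edges are excluded by alternation. A loop is never contracted itself and stays a loop
when another edge is contracted; in the coproduct it lies in the subgraph or in the quotient. -/
lemma coboundary_eq_zero_of_not_admissible (W : FeynmanAlgebra →ₐ[ℝ] ℝ) {n m : ℕ} {Γ : Graph n m}
    (h : ¬Admissible Γ) : coboundary W Γ = 0 := by
  by_cases hΓ : Γ.Nodup
  · obtain ⟨e, he, he'⟩ : ∃ e ∈ Γ, e.2 = Sum.inl e.1 := by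
      by_contra h'
      push Not at h'
      exact h ⟨hΓ, h'⟩
    obtain ⟨v, t⟩ := e
    have ht : t = Sum.inl v := he'
    subst ht
    rw [coboundary_eq, map_dInt_eq_zero_of_loop W he, map_coprodB, zero_add]
    refine Finset.sum_eq_zero fun J _ => Finset.sum_eq_zero fun p _ =>
      Finset.sum_eq_zero fun c _ => ?_
    split_ifs with hp
    · rw [coWeight_eq_zero_of_loop W J hp he, mul_zero]
    · rfl
  · exact (isAlt_coboundary W).vanishesOnDuplicates _ hΓ

lemma coboundaryMap_eq_ampSum {W : FeynmanAlgebra →ₐ[ℝ] ℝ} (hW : IsWeight W) {d n : ℕ}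
    (γ : Fin n → Polyvector d) (l : List (Smooth d)) :
    coboundaryMap W d n γ l = ampSum (coboundary W) γ l.get :=
  expansion_eq_ampSum γ l (isAlt_coboundary W)
    (fun _ h => coboundary_eq_zero_of_not_admissible W h)
    fun Γ h => coboundary_eq_zero_of_length hW Γ h

lemma ampSum_coboundary (W : FeynmanAlgebra →ₐ[ℝ] ℝ) {n m d : ℕ} (γ : Fin n → Polyvector d)
    (f : Fin m → Smooth d) :
    ampSum (coboundary W) γ f = ampSum (fun Γ => W (dInt Γ)) γ f +
      ∑ J : Finset (Fin n), ∑ p ∈ Finset.range (m + 1), ∑ b ∈ Finset.range (m + 1),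
        if hp : p + b ≤ m then
          (-1 : ℝ) ^ (m - b + 1 + p * (b + 1)) • ampSum (coWeight J hp W) γ f
        else 0 := by
  have h : ∀ S : Finset (Edge n m × Fin d),
      coboundary W (S.toList.map Prod.fst) • graphAmp γ f S.toList =
      W (dInt (S.toList.map Prod.fst)) • graphAmp γ f S.toList +
      ∑ J : Finset (Fin n), ∑ p ∈ Finset.range (m + 1), ∑ b ∈ Finset.range (m + 1),
        if hp : p + b ≤ m then
          (-1 : ℝ) ^ (m - b + 1 + p * (b + 1)) •
            coWeight J hp W (S.toList.map Prod.fst) • graphAmp γ f S.toList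
        else 0 := by
    intro S
    rw [coboundary_eq, add_smul, map_coprodB, Finset.sum_smul]
    congr 1
    refine Finset.sum_congr rfl fun J _ => ?_
    rw [Finset.sum_smul]
    refine Finset.sum_congr rfl fun p _ => ?_
    rw [Finset.sum_smul]
    refine Finset.sum_congr rfl fun b _ => ?_
    split_ifs
    · rw [mul_smul]
    · rw [zero_smul]
  rw [ampSum, ampSum, Finset.sum_congr rfl fun S _ => h S, Finset.sum_add_distrib, Finset.sum_comm]
  congr 1
  refine Finset.sum_congr rfl fun J _ => ?_
  rw [Finset.sum_comm]
  refine Finset.sum_congr rfl fun p _ => ?_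
  rw [Finset.sum_comm]
  refine Finset.sum_congr rfl fun b _ => ?_
  split_ifs
  · rw [ampSum, Finset.smul_sum]
  · exact Finset.sum_const_zero

/-! ### The commutator with the codifferentials -/

lemma unshuffleSign_mul_self {n : ℕ} (k : Fin n → ℕ) (I : Finset (Fin n)) :
    unshuffleSign k I * unshuffleSign k I = 1 := by
  rw [unshuffleSign, ← Finset.prod_mul_distrib]
  refine Finset.prod_eq_one fun i _ => ?_
  rw [← Finset.prod_mul_distrib]
  refine Finset.prod_eq_one fun j _ => ?_
  split_ifs
  · rw [← pow_add, Even.neg_one_pow ⟨_, rfl⟩]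
  · rw [one_mul]

/-- Each pair from `I × Iᶜ` is inverted by exactly one of the two unshuffles, so the signs multiply
to that of exchanging the two blocks. -/
lemma unshuffleSign_compl {n : ℕ} (k : Fin n → ℕ) (I : Finset (Fin n)) :
    unshuffleSign k Iᶜ = unshuffleSign k I * (-1) ^ ((∑ i ∈ I, k i) * ∑ i ∈ Iᶜ, k i) := by
  have h : unshuffleSign k I * unshuffleSign k Iᶜ = (-1) ^ ((∑ i ∈ I, k i) * ∑ i ∈ Iᶜ, k i) := by
    rw [unshuffleSign, unshuffleSign, compl_compl, Finset.prod_comm (s := Iᶜ),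
      ← Finset.prod_mul_distrib, Finset.sum_mul_sum, ← Finset.prod_pow_eq_pow_sum]
    refine Finset.prod_congr rfl fun i hi => ?_
    rw [← Finset.prod_mul_distrib, ← Finset.prod_pow_eq_pow_sum]
    refine Finset.prod_congr rfl fun j hj => ?_
    have hij : i ≠ j := by
      rintro rfl
      exact Finset.mem_compl.1 hj hi
    rcases lt_or_gt_of_ne hij with h | h
    · simp [h, not_lt_of_gt h, mul_comm]
    · simp [h, not_lt_of_gt h]
  rw [← h, ← mul_assoc, unshuffleSign_mul_self, one_mul]

/-- The Gerstenhaber composition, with a sign according to the arity of the first argument. -/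
noncomputable def signedCirc {d : ℕ} (Φ Ψ : Cochain d) : Cochain d :=
  circ (fun l => (-1 : ℝ) ^ l.length • Φ l) Ψ

/-- Graded symmetry of `Q_2`: with the parity sign included, the bracket is the symmetrization of a
single composition. Operators have mixed arities, so parity is a condition on the support; `hs`
pulls the sign of `Φ` out of the slot of `Ψ`. -/
lemma cochainQ_eq {d : ℕ} {Φ Ψ : Cochain d} {a b : ℕ}
    (hΦ : ∀ l, (-1 : ℝ) ^ l.length ≠ (-1) ^ a → Φ l = 0)
    (hΨ : ∀ l, (-1 : ℝ) ^ l.length ≠ (-1) ^ b → Ψ l = 0)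
    (hs : ∀ u v (c : ℝ) (x : Smooth d), Ψ (u ++ [c • x] ++ v) = c • Ψ (u ++ [x] ++ v)) :
    cochainQ Φ Ψ = signedCirc Φ Ψ + (-1 : ℝ) ^ (a * b) • signedCirc Ψ Φ := by
  funext l
  rw [cochainQ, gerstenhaber, Pi.add_apply, Pi.smul_apply, sub_eq_add_neg]
  congr 1
  rw [signedCirc, circ, Finset.smul_sum, ← Finset.sum_neg_distrib]
  refine Finset.sum_congr rfl fun p hp => ?_
  rw [Finset.smul_sum, ← Finset.sum_neg_distrib]
  refine Finset.sum_congr rfl fun q hq => ?_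
  simp only [Finset.mem_range] at hp hq
  have hlen : ((l.drop p).take q).length = q := by
    rw [List.length_take, List.length_drop]
    omega
  have hlen' : ∀ x : Smooth d, (l.take p ++ [x] ++ l.drop (p + q)).length + q = l.length + 1 := by
    intro x
    simp only [List.length_append, List.length_take, List.length_drop, List.length_singleton]
    omega
  rw [hlen, hs]
  by_cases h1 : (-1 : ℝ) ^ q = (-1) ^ a
  swap
  · have h0 : Φ ((l.drop p).take q) = 0 := hΦ _ (by rwa [hlen])
    have h2 := hs (l.take p) (l.drop (p + q)) 0 0
    rw [zero_smul, zero_smul] at h2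
    simp only [h0, h2, smul_zero, neg_zero]
  set L := l.take p ++ [Φ ((l.drop p).take q)] ++ l.drop (p + q) with hL
  have hL' := hlen' (Φ ((l.drop p).take q))
  rw [← hL] at hL'
  by_cases h2 : (-1 : ℝ) ^ L.length = (-1) ^ b
  swap
  · rw [hΨ _ h2, smul_zero, smul_zero, smul_zero, smul_zero, smul_zero, neg_zero]
  rw [smul_smul, smul_smul, smul_smul, ← neg_smul]
  congr 1
  have h3 : (-1 : ℝ) ^ (a * b) = (-1) ^ (q * L.length) := by
    rw [pow_mul, ← h1, ← pow_mul, mul_comm q b, pow_mul, ← h2, ← pow_mul, mul_comm]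
  -- Replacing `q` arguments by one gives `L.length + q = l.length + 1`, so the two exponents have
  -- equal parity.
  have h4 : (-1 : ℝ) ^ ((q + 1) * (l.length + q)) = (-1) ^ ((q + 1) * (L.length + 1)) := by
    have : (q + 1) * (L.length + 1) + 2 * ((q + 1) * q) = (q + 1) * (l.length + q) + 2 * (q + 1) := by
      have : l.length + 1 = L.length + q := hL'.symm
      nlinarith
    have h5 := congrArg (fun t => (-1 : ℝ) ^ t) this
    simpa [pow_add, pow_mul] using h5.symm
  rw [h3, h4, add_mul, one_mul, mul_add, mul_one, pow_add, pow_add, pow_add, pow_one]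
  have h6 : (-1 : ℝ) ^ q * (-1) ^ q = 1 := by rw [← pow_add, Even.neg_one_pow ⟨_, rfl⟩]
  linear_combination ((-1 : ℝ) ^ (q * L.length) * (-1) ^ L.length * (-1) ^ (p * (q + 1))) * h6

lemma sum_orderEmbOfFin {n : ℕ} (k : Fin n → ℕ) (I : Finset (Fin n)) :
    ∑ a, k (I.orderEmbOfFin rfl a) = ∑ i ∈ I, k i := by
  rw [← Finset.sum_coe_sort I, ← (I.orderIsoOfFin rfl).toEquiv.sum_comp]
  rfl

lemma ampSum_update_smul {n m d : ℕ} (c' : Graph n m → ℝ) (γ : Fin n → Polyvector d)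
    (f : Fin m → Smooth d) (w : Fin m) (c : ℝ) (x : Smooth d) :
    ampSum c' γ (Function.update f w (c • x)) = c • ampSum c' γ (Function.update f w x) := by
  simpa using ampSum_update_sum c' γ f w {()} (fun _ => c) fun _ => x

lemma append_eq_ofFn_update {X : Type*} (u v : List X) (x y : X) :
    u ++ [x] ++ v = List.ofFn (Function.update (u ++ [y] ++ v).get
      ⟨u.length, by simp⟩ x) := by
  apply List.ext_getElem
  · simp
    omega
  · intro i h1 h2
    simp only [List.getElem_ofFn, Function.update_apply, Fin.mk.injEq, List.get_eq_getElem]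
    split_ifs with h
    · subst h; simp
    · rcases lt_or_gt_of_ne h with h | h
      · simp [h]
      · rw [List.getElem_append_right (by simp; omega), List.getElem_append_right (by simp; omega)]
        simp

variable {W : FeynmanAlgebra →ₐ[ℝ] ℝ}

lemma feynmanMap_append_smul (hW : IsWeight W) {d n : ℕ} (γ : Fin n → Polyvector d)
    (u v : List (Smooth d)) (c : ℝ) (x : Smooth d) :
    feynmanMap W d n γ (u ++ [c • x] ++ v) = c • feynmanMap W d n γ (u ++ [x] ++ v) := by
  rw [feynmanMap_ofFn hW γ _ _ (append_eq_ofFn_update u v (c • x) 0),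
    feynmanMap_ofFn hW γ _ _ (append_eq_ofFn_update u v x 0), ampSum_update_smul]

lemma weight_nil (hW : IsWeight W) (m : ℕ) :
    weight W ([] : Graph 0 m) = if m = 2 then 1 else 0 := by
  split_ifs with h
  · subst h; exact hW.normalized
  · exact hW.degree_zero _ _ _ (by simpa using Ne.symm h)

/-- Without internal vertices there are no edges, and by degree and normalization only the graph of
type `(0,2)` counts. This makes the Hochschild differential part of the quadratic terms. -/
lemma feynmanMap_zero (hW : IsWeight W) {d : ℕ} (γ : Fin 0 → Polyvector d) :
    feynmanMap W d 0 γ = mulOp d := by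
  funext l
  rw [feynmanMap_eq_ampSum hW, ampSum, Fintype.sum_eq_single ∅]
  · rw [Finset.toList_empty, List.map_nil, weight_nil hW, mulOp, graphAmp_eq_prod]
    simp only [pairCount, pow_zero, one_smul, Finset.univ_eq_empty, Finset.prod_empty, one_mul,
      List.map_nil, endColours, List.filter_nil, pdList, List.foldr_nil]
    split_ifs
    · rw [one_smul, ← List.prod_ofFn, List.ofFn_get]
    · rw [zero_smul]
  · intro S hS
    obtain ⟨x, _⟩ := Finset.nonempty_iff_ne_empty.2 hS
    exact x.1.1.elim0

lemma hochschild_eq_cochainQ {d : ℕ} (Φ : Cochain d) : hochschild Φ = cochainQ (mulOp d) Φ := by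
  have : (fun l : List (Smooth d) => (-1 : ℝ) ^ l.length • mulOp d l) = mulOp d := by
    funext l
    rw [mulOp]
    split_ifs with h
    · rw [h, Even.neg_one_pow ⟨1, rfl⟩, one_smul]
    · rw [smul_zero]
  rw [hochschild, cochainQ, this]

/-- The cardinality of `univ` equals `n` only propositionally; the increasing enumeration is the
identity. -/
lemma Taylor.on_univ {d n : ℕ} (F : Taylor d) (γ : Fin n → Polyvector d) :
    F.on γ Finset.univ = F n γ := by
  have h : ∀ (I : Finset (Fin n)) (N : ℕ) (h : I.card = N),
      F.on γ I = F N fun a => γ (I.orderEmbOfFin h a) := by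
    rintro I N rfl
    rfl
  rw [h Finset.univ n (by simp)]
  congr 1
  funext a
  congr 1
  have := Finset.orderEmbOfFin_unique (s := (Finset.univ : Finset (Fin n))) (k := n) (by simp)
    (f := id) (by simp) strictMono_id
  rw [← this]
  rfl

lemma on_eq_zero (hW : IsWeight W) {d n : ℕ} {γ : Fin n → Polyvector d} {k : Fin n → ℕ}
    (hγ : ∀ i, IsHomogeneous (k i) (γ i)) (I : Finset (Fin n)) (l : List (Smooth d))
    (hl : (-1 : ℝ) ^ l.length ≠ (-1) ^ ∑ i ∈ I, k i) : (feynmanMap W d).on γ I l = 0 := by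
  rw [Taylor.on, feynmanMap_eq_ampSum hW, ampSum_eq_zero_of_degree hW
    (k := fun a => k (I.orderEmbOfFin rfl a)) (fun a => hγ _)]
  rw [sum_orderEmbOfFin]
  intro h
  apply hl
  have h5 := congrArg (fun t => (-1 : ℝ) ^ t) h
  simpa [pow_add, pow_mul] using h5

lemma unshuffleSign_smul_cochainQ (hW : IsWeight W) {d n : ℕ} {γ : Fin n → Polyvector d}
    {k : Fin n → ℕ} (hγ : ∀ i, IsHomogeneous (k i) (γ i)) (I : Finset (Fin n)) :
    unshuffleSign k I • cochainQ ((feynmanMap W d).on γ I) ((feynmanMap W d).on γ Iᶜ) =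
      unshuffleSign k I • signedCirc ((feynmanMap W d).on γ I) ((feynmanMap W d).on γ Iᶜ) +
      unshuffleSign k Iᶜ • signedCirc ((feynmanMap W d).on γ Iᶜ) ((feynmanMap W d).on γ I) := by
  rw [cochainQ_eq (fun l hl => on_eq_zero hW hγ I l hl) (fun l hl => on_eq_zero hW hγ Iᶜ l hl)
    (fun u v c x => feynmanMap_append_smul hW _ u v c x), smul_add, smul_smul,
    unshuffleSign_compl]

/-- The quadratic part of the commutator, including the terms of the Hochschild differential. -/
lemma hochschild_add_sum_cochainQ (hW : IsWeight W) {d n : ℕ} (hn : 1 ≤ n)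
    {γ : Fin n → Polyvector d} {k : Fin n → ℕ} (hγ : ∀ i, IsHomogeneous (k i) (γ i)) :
    hochschild (feynmanMap W d n γ) +
      (1 / 2 : ℝ) • ∑ I : Finset (Fin n) with I.Nonempty ∧ Iᶜ.Nonempty,
        unshuffleSign k I •
          cochainQ ((feynmanMap W d).on γ I) ((feynmanMap W d).on γ Iᶜ) =
    ∑ J : Finset (Fin n), unshuffleSign k Jᶜ •
      signedCirc ((feynmanMap W d).on γ Jᶜ) ((feynmanMap W d).on γ J) := by
  set A := (feynmanMap W d).on γ
  set C : Finset (Fin n) → Cochain d := fun J => unshuffleSign k Jᶜ • signedCirc (A Jᶜ) (A J)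
    with hC
  set T : Finset (Fin n) → Cochain d := fun I => unshuffleSign k I • cochainQ (A I) (A Iᶜ) with hT
  have hTC : ∀ I, T I = C Iᶜ + C I := by
    intro I
    simp only [hT, hC, compl_compl]
    exact unshuffleSign_smul_cochainQ hW hγ I
  -- `Q_1 = Q_2(μ, ·)`, and `μ` is the coefficient on the empty collection.
  have h0 : hochschild (feynmanMap W d n γ) = T ∅ := by
    have h1 : A ∅ = mulOp d := feynmanMap_zero hW _
    have h2 : A Finset.univ = feynmanMap W d n γ := Taylor.on_univ _ _
    have h3 : unshuffleSign k ∅ = 1 := Finset.prod_empty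
    rw [hochschild_eq_cochainQ, ← h1, ← h2]
    simp only [hT, h3, one_smul, Finset.compl_empty]
  have h1 : T Finset.univ = T ∅ := by
    rw [hTC, hTC, Finset.compl_univ, Finset.compl_empty, add_comm]
  have h2 : ∑ I, T I = 2 • ∑ J, C J := by
    simp only [hTC, Finset.sum_add_distrib]
    rw [two_smul, ← (Equiv.ofBijective _ (compl_bijective (α := Finset (Fin n)))).sum_comp C]
    rfl
  -- The sets left out of the commutator are `∅` and the full set, distinct because `n ≥ 1`. Each
  -- contributes the Hochschild term once, so after halving it occurs exactly once.
  have h3 : ∑ I, T I = ∑ I with I.Nonempty ∧ Iᶜ.Nonempty, T I + 2 • T ∅ := by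
    rw [← Finset.sum_filter_add_sum_filter_not Finset.univ
      fun I : Finset (Fin n) => I.Nonempty ∧ Iᶜ.Nonempty]
    congr 1
    have h4 : (Finset.univ.filter fun I : Finset (Fin n) => ¬(I.Nonempty ∧ Iᶜ.Nonempty)) =
        {∅, Finset.univ} := by
      ext I
      simp only [Finset.mem_filter, Finset.mem_univ, true_and, Finset.mem_insert,
        Finset.mem_singleton, not_and_or, Finset.not_nonempty_iff_eq_empty,
        Finset.compl_eq_empty_iff]
    have h5 : (∅ : Finset (Fin n)) ≠ Finset.univ := by
      intro h
      have := congrArg Finset.card h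
      simp at this
      omega
    rw [h4, Finset.sum_pair h5, h1, two_smul]
  rw [h2] at h3
  have h4 : (1 / 2 : ℝ) • (2 • ∑ J, C J) = ∑ J, C J := by
    rw [← Nat.cast_smul_eq_nsmul ℝ, smul_smul]
    norm_num
  rw [h0, ← h4, h3, smul_add, ← Nat.cast_smul_eq_nsmul ℝ 2 (T ∅), smul_smul, add_comm]
  norm_num

/-- Entry `p` is overwritten, so the truncated index `w + b - 1` for `p = b = 0` and the default `y`
are harmless. -/
lemma take_append_drop_eq_ofFn {X : Type*} (l : List X) {p b : ℕ} (hp : p + b ≤ l.length) (x y : X) :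
    l.take p ++ [x] ++ l.drop (p + b) = List.ofFn (Function.update
      (fun w : Fin (l.length - b + 1) => if (w : ℕ) < p then l.getD w y else l.getD (w + b - 1) y)
      ⟨p, by omega⟩ x) := by
  apply List.ext_getElem
  · simp
    omega
  · intro i h1 h2
    simp only [List.length_ofFn] at h2
    simp only [List.getElem_ofFn, Function.update_apply, Fin.mk.injEq]
    rcases lt_trichotomy i p with h | h | h
    · rw [if_neg h.ne, if_pos h, List.getElem_append_left (by simp; omega),
        List.getElem_append_left (by simp; omega), List.getElem_take,
        List.getD_eq_getElem _ _ (by omega)]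
    · subst h
      rw [if_pos rfl, List.getElem_append_left (by simp; omega),
        List.getElem_append_right (by simp)]
      simp
    · rw [if_neg h.ne', if_neg (by omega), List.getElem_append_right (by simp; omega),
        List.getElem_drop, List.getD_eq_getElem _ _ (by omega)]
      congr 1
      simp only [List.length_append, List.length_take, List.length_singleton]
      omega

/-- The sign `(-1)^(m - b + 1)` in `Δ_b` is the parity of the arity of the outer operator, and
`(-1)^(p * (b + 1))` is the Gerstenhaber sign; the Koszul sign is the one found in
`ampSum_coWeight`. -/
lemma signedCirc_eq (hW : IsWeight W) {d n : ℕ} {γ : Fin n → Polyvector d}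
    {k : Fin n → ℕ} (hγ : ∀ i, IsHomogeneous (k i) (γ i)) (J : Finset (Fin n))
    (l : List (Smooth d)) :
    unshuffleSign k Jᶜ • signedCirc ((feynmanMap W d).on γ Jᶜ) ((feynmanMap W d).on γ J) l =
      ∑ p ∈ Finset.range (l.length + 1), ∑ b ∈ Finset.range (l.length + 1),
        if hp : p + b ≤ l.length then
          (-1 : ℝ) ^ (l.length - b + 1 + p * (b + 1)) • ampSum (coWeight J hp W) γ l.get
        else 0 := by
  rw [signedCirc, circ, Finset.smul_sum]
  refine Finset.sum_congr rfl fun p hp => ?_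
  rw [Finset.mem_range] at hp
  rw [Finset.smul_sum]
  symm
  -- The composition stops at `b ≤ m - p`, while `Δ_b` runs over all `b ≤ m` with a side condition.
  rw [← Finset.sum_subset (Finset.range_mono (by omega : l.length - p + 1 ≤ l.length + 1))]
  · refine Finset.sum_congr rfl fun b hb => ?_
    rw [Finset.mem_range] at hb
    have hpb : p + b ≤ l.length := by omega
    rw [dif_pos hpb]
    have hlen : ∀ x : Smooth d, (l.take p ++ [x] ++ l.drop (p + b)).length = l.length - b + 1 := by
      intro x
      simp only [List.length_append, List.length_take, List.length_drop, List.length_singleton]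
      omega
    have hin : (l.drop p).take b = List.ofFn fun w : Fin b => l.get ⟨p + w, by omega⟩ := by
      apply List.ext_getElem
      · simp
        omega
      · intro i h1 h2
        simp
    rw [hlen, ampSum_coWeight hW J hpb hγ l.get
      (fun w => if (w : ℕ) < p then l.getD w 0 else l.getD (w + b - 1) 0), smul_smul, smul_smul,
      smul_smul, Taylor.on, Taylor.on, feynmanMap_ofFn hW _ ((l.drop p).take b) _ hin,
      feynmanMap_ofFn hW _ _ _ (take_append_drop_eq_ofFn l hpb _ 0)]
    · congr 1
      rw [pow_add]
      ring
    · intro w hw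
      rw [quotientBoundary_outside hpb w hw]
      split_ifs with h1 h2
      · exact List.getD_eq_getElem _ _ _
      · omega
      · rw [List.getD_eq_getElem _ _ (by have := w.2; omega), List.get_eq_getElem]
        congr 1
        omega
  · intro b _ hb
    rw [Finset.mem_range] at hb
    rw [dif_neg (by omega)]

/-- The commutator with the codifferentials is the expansion with the coboundary of the weight. -/
lemma commutatorQ_feynmanMap (hW : IsWeight W) {d n : ℕ} (hn : 1 ≤ n)
    {γ : Fin n → Polyvector d} {k : Fin n → ℕ} (hγ : ∀ i, IsHomogeneous (k i) (γ i)) :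
    commutatorQ (feynmanMap W d) n k γ = coboundaryMap W d n γ := by
  funext l
  have h1 : (∑ p : Fin n × Fin n with p.1 < p.2, unshuffleSign k {p.1, p.2} •
      feynmanMap W d ((({p.1, p.2} : Finset (Fin n))ᶜ).card + 1)
        (Fin.cons (polyvectorQ (γ p.1) (γ p.2))
          fun a => γ ((({p.1, p.2} : Finset (Fin n))ᶜ).orderEmbOfFin rfl a))) l =
      -ampSum (fun Γ => W (dInt Γ)) γ l.get := by
    rw [ampSum_dInt hW hγ, neg_neg, Finset.sum_apply]
    refine Finset.sum_congr rfl fun q _ => ?_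
    rw [Pi.smul_apply, feynmanMap_eq_ampSum hW]
  rw [coboundaryMap_eq_ampSum hW, ampSum_coboundary, commutatorQ,
    hochschild_add_sum_cochainQ hW hn hγ, Pi.sub_apply, h1, sub_neg_eq_add, add_comm,
    Finset.sum_apply]
  exact congrArg _ (Finset.sum_congr rfl fun J _ => signedCirc_eq hW hγ J l)

/-! ### Monomials -/

/-- A coordinate function. -/
def coord {d : ℕ} (i : Fin d) : Smooth d := ⟨fun x => x i, (contDiff_apply ℝ ℝ i : ContDiff ℝ ∞ fun x : Fin d → ℝ => x i)⟩

/-- The product of the coordinate functions in `A`. -/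
def monomial {d : ℕ} (A : Finset (Fin d)) : Smooth d := ∏ i ∈ A, coord i

/-- The value of a function at the origin. -/
def evalZero (d : ℕ) : Smooth d →ₐ[ℝ] ℝ :=
  (Pi.evalAlgHom ℝ (fun _ : Fin d → ℝ => ℝ) 0).comp (smoothAlg d).val

lemma evalZero_coord {d : ℕ} (i : Fin d) : evalZero d (coord i) = 0 := rfl

lemma pd_coord {d : ℕ} (i j : Fin d) : pd i (coord j) = if j = i then 1 else 0 := by
  have h : pd i (coord j) = ⟨fun _ => if j = i then 1 else 0,
      (contDiff_const : ContDiff ℝ ∞ fun _ : Fin d → ℝ => (if j = i then 1 else 0 : ℝ))⟩ := by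
    ext x
    change fderiv ℝ (fun x : Fin d → ℝ => x j) x (Pi.single i 1) = _
    rw [(hasFDerivAt_apply j x).fderiv]
    simp [Pi.single_apply]
  rw [h]
  split_ifs <;> rfl

lemma pd_monomial_of_notMem {d : ℕ} {i : Fin d} {A : Finset (Fin d)} (h : i ∉ A) :
    pd i (monomial A) = 0 := by
  rw [monomial, pd_prod]
  refine Finset.sum_eq_zero fun b hb => Finset.prod_eq_zero hb ?_
  rw [if_pos rfl, pd_coord, if_neg]
  rintro rfl
  exact h hb

lemma pd_monomial_of_mem {d : ℕ} {i : Fin d} {A : Finset (Fin d)} (h : i ∈ A) :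
    pd i (monomial A) = monomial (A.erase i) := by
  have h1 : monomial A = coord i * monomial (A.erase i) := (Finset.mul_prod_erase A coord h).symm
  rw [h1, pd_mul, pd_coord, if_pos rfl, one_mul, pd_monomial_of_notMem (Finset.notMem_erase i A),
    mul_zero, add_zero]

/-- At the origin a derivative of a squarefree monomial survives only if each of its variables is
removed, exactly once. -/
lemma evalZero_pdList_monomial {d : ℕ} (is : List (Fin d)) (A : Finset (Fin d)) :
    evalZero d (pdList is (monomial A)) = if is.Nodup ∧ is.toFinset = A then 1 else 0 := by
  induction is generalizing A with
  | nil =>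
    change evalZero d (monomial A) = _
    simp only [List.nodup_nil, List.toFinset_nil, true_and, eq_comm (a := ∅)]
    split_ifs with h
    · rw [h, monomial, Finset.prod_empty, map_one]
    · obtain ⟨i, hi⟩ := Finset.nonempty_iff_ne_empty.2 h
      rw [monomial, map_prod]
      exact Finset.prod_eq_zero hi (evalZero_coord i)
  | cons i is ih =>
    rw [pdList_cons, ← pdList_pd]
    by_cases hi : i ∈ A
    · rw [pd_monomial_of_mem hi, ih]
      congr 1
      rw [List.nodup_cons, List.toFinset_cons, eq_iff_iff]
      constructor
      · rintro ⟨h1, h2⟩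
        have h3 : i ∉ is := by
          rw [← List.mem_toFinset, h2]
          exact Finset.notMem_erase i A
        exact ⟨⟨h3, h1⟩, by rw [h2, Finset.insert_erase hi]⟩
      · rintro ⟨⟨h3, h1⟩, h2⟩
        exact ⟨h1, by rw [← h2, Finset.erase_insert (by simpa using h3)]⟩
    · rw [pd_monomial_of_notMem hi, ← pdListLinear_apply, map_zero, map_zero, if_neg]
      rintro ⟨_, rfl⟩
      simp at hi

/-- The polyvector field `x_A ψ_K`. -/
noncomputable def monomialPolyvector {d : ℕ} (A K : Finset (Fin d)) : Polyvector d :=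
  fun I => if I = K then monomial A else 0

lemma isHomogeneous_monomialPolyvector {d : ℕ} (A K : Finset (Fin d)) :
    IsHomogeneous K.card (monomialPolyvector A K) := by
  intro I hI
  rw [monomialPolyvector, if_neg]
  rintro rfl
  exact hI rfl

lemma evalZero_pdList_pairing_ne_zero_iff {d : ℕ} (is js : List (Fin d)) (A K : Finset (Fin d)) :
    evalZero d (pdList js (pairing (monomialPolyvector A K) is)) ≠ 0 ↔
      (is.Nodup ∧ is.toFinset = K) ∧ js.Nodup ∧ js.toFinset = A := by
  rw [pairing_eq, monomialPolyvector]
  by_cases h1 : is.Nodup <;> by_cases h2 : is.toFinset = K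
  · rw [if_pos h1, if_pos h2, ← pdListLinear_apply, map_smul, pdListLinear_apply, map_smul,
      evalZero_pdList_monomial]
    simp [h1, h2]
  · rw [if_pos h1, if_neg h2, smul_zero, ← pdListLinear_apply, map_zero, map_zero]
    simp [h2]
  · rw [if_neg h1, ← pdListLinear_apply, map_zero, map_zero]
    simp [h1]
  · rw [if_neg h1, ← pdListLinear_apply, map_zero, map_zero]
    simp [h1]

/-! ### ### Fields dual to a set of coloured edges -/

section
variable {n m d : ℕ}

lemma mem_startColours (L : List (Edge n m × Fin d)) (v : Fin n) (c : Fin d) :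
    c ∈ startColours (L.map toColoured) (Sum.inl v) ↔ ∃ x ∈ L, x.1.1 = v ∧ x.2 = c := by
  simp [startColours, toColoured]

lemma mem_endColours (L : List (Edge n m × Fin d)) (u : Fin n ⊕ Fin m) (c : Fin d) :
    c ∈ endColours (L.map toColoured) u ↔ ∃ x ∈ L, x.1.2 = u ∧ x.2 = c := by
  rw [endColours, List.mem_map]
  simp only [List.mem_filter, List.mem_map, decide_eq_true_eq]
  constructor
  · rintro ⟨_, ⟨⟨x, hx, rfl⟩, h1⟩, h2⟩
    exact ⟨x, hx, h1, h2⟩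
  · rintro ⟨x, hx, h1, h2⟩
    exact ⟨_, ⟨⟨x, hx, rfl⟩, h1⟩, h2⟩

lemma nodup_startColours {L : List (Edge n m × Fin d)} (h : (L.map Prod.snd).Nodup)
    (u : Fin n ⊕ Fin m) : (startColours (L.map toColoured) u).Nodup := by
  refine h.sublist ?_
  rw [show L.map Prod.snd = (L.map toColoured).map fun e => e.2.2 by rw [List.map_map]; rfl]
  exact List.filter_sublist.map _

lemma nodup_endColours {L : List (Edge n m × Fin d)} (h : (L.map Prod.snd).Nodup)
    (u : Fin n ⊕ Fin m) : (endColours (L.map toColoured) u).Nodup := by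
  refine h.sublist ?_
  rw [show L.map Prod.snd = (L.map toColoured).map fun e => e.2.2 by rw [List.map_map]; rfl]
  exact List.filter_sublist.map _

/-- Fields for which, at the origin, only the edges in `S` have a nonzero amplitude. -/
noncomputable def dualPolyvectors (S : Finset (Edge n m × Fin d)) (v : Fin n) : Polyvector d :=
  monomialPolyvector (endColours (S.toList.map toColoured) (Sum.inl v)).toFinset
    (startColours (S.toList.map toColoured) (Sum.inl v)).toFinset

/-- Functions for which, at the origin, only the edges in `S` have a nonzero amplitude. -/
noncomputable def dualFunctions (S : Finset (Edge n m × Fin d)) (w : Fin m) : Smooth d :=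
  monomial (endColours (S.toList.map toColoured) (Sum.inr w)).toFinset

lemma evalZero_graphAmp_dual_ne_zero_iff (S : Finset (Edge n m × Fin d))
    (L : List (Edge n m × Fin d)) :
    evalZero d (graphAmp (dualPolyvectors S) (dualFunctions S) L) ≠ 0 ↔
      (∀ v, (startColours (L.map toColoured) (Sum.inl v)).Nodup ∧
        (startColours (L.map toColoured) (Sum.inl v)).toFinset =
          (startColours (S.toList.map toColoured) (Sum.inl v)).toFinset) ∧
      ∀ u, (endColours (L.map toColoured) u).Nodup ∧
        (endColours (L.map toColoured) u).toFinset =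
          (endColours (S.toList.map toColoured) u).toFinset := by
  rw [graphAmp_eq_prod, map_smul, smul_ne_zero_iff_right (by simp), map_mul, mul_ne_zero_iff,
    map_prod, map_prod, Finset.prod_ne_zero_iff, Finset.prod_ne_zero_iff]
  simp only [dualPolyvectors, dualFunctions, evalZero_pdList_pairing_ne_zero_iff,
    evalZero_pdList_monomial, Finset.mem_univ, true_implies, ne_eq, ite_eq_right_iff,
    one_ne_zero, imp_false, not_not, forall_and, Sum.forall]
  tauto

lemma evalZero_graphAmp_dual_ne_zero {S : Finset (Edge n m × Fin d)}
    (hS : Set.InjOn Prod.snd (S : Set (Edge n m × Fin d))) :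
    evalZero d (graphAmp (dualPolyvectors S) (dualFunctions S) S.toList) ≠ 0 := by
  have h : (S.toList.map Prod.snd).Nodup :=
    (List.nodup_map_iff_inj_on (Finset.nodup_toList S)).2 fun x hx y hy =>
      hS (Finset.mem_toList.1 hx) (Finset.mem_toList.1 hy)
  exact (evalZero_graphAmp_dual_ne_zero_iff S _).2
    ⟨fun v => ⟨nodup_startColours h _, rfl⟩, fun u => ⟨nodup_endColours h _, rfl⟩⟩

/-- An edge of `T` shares colour and start with some edge of `S`, and colour and end with another.
Colours are distinct in `S`, so these coincide and `T ⊆ S`; every colour of `S` occurs in `T`,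
whence equality. -/
lemma eq_of_evalZero_graphAmp_dual_ne_zero {S T : Finset (Edge n m × Fin d)}
    (hS : Set.InjOn Prod.snd (S : Set (Edge n m × Fin d)))
    (h : evalZero d (graphAmp (dualPolyvectors S) (dualFunctions S) T.toList) ≠ 0) : T = S := by
  obtain ⟨h1, h2⟩ := (evalZero_graphAmp_dual_ne_zero_iff S _).1 h
  have hs : ∀ v c, (∃ x ∈ T, x.1.1 = v ∧ x.2 = c) ↔ ∃ x ∈ S, x.1.1 = v ∧ x.2 = c := by
    intro v c
    have := congrArg (c ∈ ·) (h1 v).2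
    simpa only [List.mem_toFinset, mem_startColours, Finset.mem_toList, eq_iff_iff] using this
  have ht : ∀ u c, (∃ x ∈ T, x.1.2 = u ∧ x.2 = c) ↔ ∃ x ∈ S, x.1.2 = u ∧ x.2 = c := by
    intro v c
    have := congrArg (c ∈ ·) (h2 v).2
    simpa only [List.mem_toFinset, mem_endColours, Finset.mem_toList, eq_iff_iff] using this
  have hTS : ∀ x ∈ T, x ∈ S := by
    intro x hx
    obtain ⟨y, hy, hy1, hy2⟩ := (hs x.1.1 x.2).1 ⟨x, hx, rfl, rfl⟩
    obtain ⟨z, hz, hz1, hz2⟩ := (ht x.1.2 x.2).1 ⟨x, hx, rfl, rfl⟩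
    have hyz : y = z := hS hy hz (hy2.trans hz2.symm)
    subst hyz
    have : x = y := Prod.ext (Prod.ext hy1.symm hz1.symm) hy2.symm
    rwa [this]
  refine Finset.Subset.antisymm hTS fun x hx => ?_
  obtain ⟨y, hy, _, hy2⟩ := (hs x.1.1 x.2).2 ⟨x, hx, rfl, rfl⟩
  rwa [← hS (hTS y hy) hx hy2]

/-- The weights of the graphs with at most `d` edges are determined by the operators on `ℝ^d`. -/
lemma eq_zero_of_ampSum_eq_zero {c : Graph n m → ℝ} (hc : IsAlt c)
    (h : ∀ (k : Fin n → ℕ) (γ : Fin n → Polyvector d), (∀ i, IsHomogeneous (k i) (γ i)) →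
      ∀ f : Fin m → Smooth d, ampSum c γ f = 0) (Γ : Graph n m) (hd : Γ.length ≤ d) : c Γ = 0 := by
  classical
  -- The `a`-th edge receives the colour `a`; this is where at most `d` edges are needed.
  let L : List (Edge n m × Fin d) := List.ofFn fun a : Fin Γ.length => (Γ.get a, a.castLE hd)
  have hL : L.map Prod.fst = Γ := by
    rw [List.map_ofFn]
    exact List.ofFn_get Γ
  have hsnd : (L.map Prod.snd).Nodup := by
    rw [List.map_ofFn, List.nodup_ofFn]
    exact Fin.castLE_injective hd
  have hnd : L.Nodup := hsnd.of_map _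
  have hS : Set.InjOn Prod.snd (L.toFinset : Set (Edge n m × Fin d)) := by
    intro x hx y hy
    rw [Finset.mem_coe, List.mem_toFinset] at hx hy
    exact List.inj_on_of_nodup_map hsnd hx hy
  have h0 := congrArg (evalZero d) (h _ (dualPolyvectors L.toFinset)
    (fun v => isHomogeneous_monomialPolyvector _ _) (dualFunctions L.toFinset))
  rw [map_zero, ampSum, map_sum, Finset.sum_eq_single L.toFinset] at h0
  · rw [map_smul, smul_eq_mul, mul_eq_zero] at h0
    have h1 := h0.resolve_right (evalZero_graphAmp_dual_ne_zero hS)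
    -- Passing through the finite set may change the order of the edges, hence the coefficient by a
    -- sign.
    have hp : (L.toFinset.toList.map Prod.fst).Perm Γ := by
      conv_rhs => rw [← hL]
      exact ((List.toFinset_toList hnd)).map _
    rcases hc.perm hp with h2 | h2
    · rw [← h2, h1]
    · rw [h1] at h2
      linarith
  · intro T _ hT
    rw [map_smul, smul_eq_mul]
    by_contra hne
    exact hT (eq_of_evalZero_graphAmp_dual_ne_zero hS (right_ne_zero_of_mul hne))
  · exact fun h => absurd (Finset.mem_univ _) h

end

/-! ### ### Cocycles and `L_∞`-morphisms -/

variable {W : FeynmanAlgebra →ₐ[ℝ] ℝ}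

lemma weight_nil_of_eq_zero (hW : IsWeight W) {N M : ℕ} (hN : N = 0) :
    weight W ([] : Graph N M) = if M = 2 then 1 else 0 := by
  subst hN
  exact weight_nil hW M

lemma coWeight_nil (hW : IsWeight W) (J : Finset (Fin 0)) {p b : ℕ} (hp : p + b ≤ 3) :
    coWeight J hp W ([] : Graph 0 3) = if b = 2 then 1 else 0 := by
  have h1 : J.card = 0 := by simp [Finset.eq_empty_of_isEmpty J]
  have h2 : Jᶜ.card = 0 := by simp [Finset.eq_empty_of_isEmpty Jᶜ]
  rw [coWeight]
  by_cases hb : b = 2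
  · subst hb
    rw [if_pos rfl, if_pos ((isNormal_iff J _ _ _).2 ⟨by omega, by omega, by simp⟩),
      show quotientGraph ([] : Graph 0 3) J p 2 hp = [] from rfl,
      show subgraph ([] : Graph 0 3) J p 2 = [] from rfl, weight_nil_of_eq_zero hW h1,
      weight_nil_of_eq_zero hW h2, splitSign_eq]
    simp [pairCount]
  · rw [if_neg hb, if_neg]
    rw [isNormal_iff]
    omega

/-- The multiplication is associative. -/
lemma coboundary_of_isEmpty (hW : IsWeight W) {m : ℕ} (Γ : Graph 0 m) : coboundary W Γ = 0 := by
  cases Γ with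
  | cons e l => exact e.1.elim0
  | nil =>
    by_cases hm : m = 3
    · subst hm
      have h : W (dInt ([] : Graph 0 3)) = 0 := by rw [map_dInt]; rfl
      rw [coboundary_eq, h, map_coprodB]
      -- Only `b = 2` with `p = 0` or `p = 1` contributes, with signs `(-1)^2` and `(-1)^5`: the two
      -- bracketings of a triple product.
      simp only [coWeight_nil hW]
      simp [Finset.sum_range_succ]
      norm_num
    · exact coboundary_eq_zero_of_length hW _ (by simpa using Ne.symm hm)

/-- For `n ≥ 1` the vanishing commutator is the expansion of `δW`, whose coefficients are recovered
on dual fields. The case `n = 0` is not seen by the commutator and is settled separately. -/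
lemma coboundary_eq_zero_of_isLInfty (hW : IsWeight W) {d n m : ℕ} (h : IsLInfty (feynmanMap W d))
    (Γ : Graph n m) (hd : Γ.length ≤ d) : coboundary W Γ = 0 := by
  rcases Nat.eq_zero_or_pos n with rfl | hn
  · exact coboundary_of_isEmpty hW Γ
  · refine eq_zero_of_ampSum_eq_zero (isAlt_coboundary W) (fun k γ hγ f => ?_) Γ hd
    rw [← ampSum_length_congr (fun m => coboundary W) γ (List.ofFn f) f rfl,
      ← coboundaryMap_eq_ampSum hW, ← commutatorQ_feynmanMap hW hn hγ, h.2 n hn k γ hγ]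
    rfl

lemma isLInfty_of_coboundary_eq_zero (hW : IsWeight W)
    (h : ∀ (n m : ℕ) (Γ : Graph n m), Admissible Γ → coboundary W Γ = 0) (d : ℕ) :
    IsLInfty (feynmanMap W d) := by
  refine ⟨isPreLInfty_feynmanMap hW d, fun n hn k γ hγ => ?_⟩
  rw [commutatorQ_feynmanMap hW hn hγ]
  funext l
  rw [coboundaryMap_eq_ampSum hW]
  refine Finset.sum_eq_zero fun S _ => ?_
  by_cases hS : Admissible (S.toList.map Prod.fst)
  · rw [h _ _ _ hS, zero_smul]
  · rw [coboundary_eq_zero_of_not_admissible W hS, zero_smul]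

end Feynman

theorem theoremT (W : Feynman.FeynmanAlgebra →ₐ[ℝ] ℝ) (hW : Feynman.IsWeight W) :
    (∀ d : ℕ, Feynman.IsPreLInfty (Feynman.feynmanMap W d)) ∧
    (∀ (d n : ℕ), 1 ≤ n → ∀ (k : Fin n → ℕ) (γ : Fin n → Feynman.Polyvector d),
      (∀ i, Feynman.IsHomogeneous (k i) (γ i)) →
        Feynman.commutatorQ (Feynman.feynmanMap W d) n k γ = Feynman.coboundaryMap W d n γ) ∧
    ((∀ d : ℕ, Feynman.IsLInfty (Feynman.feynmanMap W d)) ↔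
      ∀ (n m : ℕ) (Γ : Feynman.Graph n m), Feynman.Admissible Γ → Feynman.coboundary W Γ = 0) ∧
    (∀ d : ℕ, Feynman.IsLInfty (Feynman.feynmanMap W d) →
      ∀ (n m : ℕ) (Γ : Feynman.Graph n m), Feynman.Admissible Γ → Γ.length ≤ d →
        Feynman.coboundary W Γ = 0) :=
  ⟨Feynman.isPreLInfty_feynmanMap hW,
    fun _ _ hn _ _ hγ => Feynman.commutatorQ_feynmanMap hW hn hγ,
    -- Each graph is tested in the dimension given by its number of edges.
    ⟨fun h _ _ Γ _ => Feynman.coboundary_eq_zero_of_isLInfty hW (h Γ.length) Γ le_rfl,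
      Feynman.isLInfty_of_coboundary_eq_zero hW⟩,
    fun _ h _ _ Γ _ hd => Feynman.coboundary_eq_zero_of_isLInfty hW h Γ hd⟩
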